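/- Let $n\ge 1$, $\alpha>0$ and $\theta\in(0,\frac{\pi}{2})$, let $E_{n+1}=(0,\dots,0,1)$ and $\overline{\mathbb{R}^{n+1}_+}=\{x\in\mathbb{R}^{n+1}:\langle x,E_{n+1}\rangle\ge 0\}$, and let $M$ be a compact smooth $n$-manifold with boundary. A capillary hypersurface with contact angle $\theta$ is the image $\Sigma=X(M)$ of a smooth embedding $X:M\to\overline{\mathbb{R}^{n+1}_+}$ with $X(\partial M)\subset\partial\mathbb{R}^{n+1}_+$ such that $\langle\nu,E_{n+1}\rangle=\cos\theta$ along $\partial\Sigma$, where $\nu$ is the unit normal of $\Sigma$ pointing out of the bounded domain $\widehat\Sigma$ enclosed by $\Sigma$ and $\partial\mathbb{R}^{n+1}_+$. Denote by $h$ and $H$ the second fundamental form and the mean curvature (the trace of $h$) of $\Sigma$ with respect to $\nu$, with the sign for which round spheres have $h>0$; $\Sigma$ is strictly convex if $h$ is positive definite at every point of $\Sigma$, boundary points included. Let $W_\theta(\widehat\Sigma)=|\Sigma|-\cos\theta\,|\widehat{\partial\Sigma}|$ be the capillary area, where $\widehat{\partial\Sigma}$ is the part of the boundary of $\widehat\Sigma$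 lying on $\partial\mathbb{R}^{n+1}_+$. For $0<T\le+\infty$ consider a solution $X:M\times[0,T)\to\overline{\mathbb{R}^{n+1}_+}$ of $$\partial_tX=(\phi(t)-H^\alpha)\,(\nu-\cos\theta\,E_{n+1})\ \text{ in } M\times[0,T),\qquad \langle\nu,E_{n+1}\rangle=\cos\theta\ \text{ on }\partial M\times[0,T),\qquad X(\cdot,0)=X_0,$$ such that each $\Sigma_t=X(M,t)$ is a capillary hypersurface with contact angle $\theta$ and $H>0$, and such that $X$ and $\nu$ are smooth on $M\times(0,T)$ and, together with their first spatial derivatives, continuous on $M\times[0,T)$. Here $\phi$ is, for all $t$, either $$\phi(t)=\frac{1}{W_\theta(\widehat{\Sigma_t})}\int_{\Sigma_t}(1-\cos\theta\langle\nu,E_{n+1}\rangle)\,H^\alpha\,dA$$ (volume preserving flow) or $$\phi(t)=\frac{\int_{\Sigma_t}(1-\cos\theta\langle\nu,E_{n+1}\rangle)\,H^{\alpha+1}\,dA}{\int_{\Sigma_t}(1-\cos\theta\langle\nu,E_{n+1}\rangle)\,H\,dA}$$ (area preserving flow). **Proposition.** If $\Sigma_0=X_0(M)$ is strictly convex, then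 $\Sigma_t$ is strictly convex for all $t\in[0,T)$. In particular this holds on the maximal interval $[0,T^*)$ of existence of the solution. -/

import Mathlib

open Set Filter Topology MeasureTheory
open scoped Manifold ContDiff RealInnerProductSpace

noncomputable section

namespace CapillaryFlow

/-- The ambient Euclidean space `ℝⁿ⁺¹`. -/
abbrev Ambient (n : ℕ) : Type := EuclideanSpace ℝ (Fin (n + 1))

/-- The vector `Eₙ₊₁ = (0, …, 0, 1)`; the closed half-space is `{x | 0 ≤ ⟪x, Eₙ₊₁⟫}`. -/
def vertical (n : ℕ) : Ambient n := EuclideanSpace.single (Fin.last n) 1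

/-- The open domain enclosed by `S` and the hyperplane `{⟪x, Eₙ₊₁⟫ = 0}`: the union of the bounded
connected components of the open upper half-space with `S` removed. -/
def enclosedDomain {n : ℕ} (S : Set (Ambient n)) : Set (Ambient n) :=
  {x | x ∈ {y | 0 < ⟪y, vertical n⟫} \ S ∧
    Bornology.IsBounded (connectedComponentIn ({y | 0 < ⟪y, vertical n⟫} \ S) x)}

/-- The wetted region: the part of the boundary of the enclosed domain which lies on the
hyperplane `{⟪x, Eₙ₊₁⟫ = 0}`. -/
def wettedRegion {n : ℕ} (S : Set (Ambient n)) : Set (Ambient n) :=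
  closure (enclosedDomain S) ∩ {x | ⟪x, vertical n⟫ = 0}

/-- The capillary area `W_θ = |Σ| - cos θ |wetted region|`. -/
def capillaryArea {n : ℕ} (θ : ℝ) (S : Set (Ambient n)) : ℝ :=
  (μHE[n] : Measure (Ambient n)).real S
    - Real.cos θ * (μHE[n] : Measure (Ambient n)).real (wettedRegion S)

section Hypersurface

variable {n : ℕ} [NeZero n] {M : Type*} [TopologicalSpace M]
  [ChartedSpace (EuclideanHalfSpace n) M]

/-- The differential of `F : M → ℝⁿ⁺¹` at `p`, applied to the tangent vector `v`. -/
def diff (F : M → Ambient n) (p : M) (v : TangentSpace (𝓡∂ n) p) : Ambient n :=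
  mfderiv (𝓡∂ n) 𝓘(ℝ, Ambient n) F p v

/-- The first fundamental form (the induced metric) of `X : M → ℝⁿ⁺¹`. -/
def firstForm (X : M → Ambient n) (p : M) (v w : TangentSpace (𝓡∂ n) p) : ℝ :=
  ⟪diff X p v, diff X p w⟫

/-- The second fundamental form `h(v, w) = ⟪D_v ν, dX w⟫` of `X` with respect to the unit
normal `ν`. It is positive on a round sphere with its outward normal. -/
def secondForm (X ν : M → Ambient n) (p : M) (v w : TangentSpace (𝓡∂ n) p) : ℝ :=
  ⟪diff ν p v, diff X p w⟫

/-- The `i`-th vector of the coordinate basis of the tangent space. -/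
def coordVec (p : M) (i : Fin n) : TangentSpace (𝓡∂ n) p :=
  (EuclideanSpace.single i 1 : EuclideanSpace ℝ (Fin n))

/-- The mean curvature `H = gⁱʲ hᵢⱼ`. -/
def meanCurv (X ν : M → Ambient n) (p : M) : ℝ :=
  ((Matrix.of fun i j => firstForm X p (coordVec p i) (coordVec p j))⁻¹ *
    (Matrix.of fun i j => secondForm X ν p (coordVec p i) (coordVec p j))).trace

/-- Strict convexity: the second fundamental form with respect to the outward normal is positive
definite at every point, boundary points included. -/
def StrictlyConvex (X ν : M → Ambient n) : Prop :=
  ∀ (p : M) (v : TangentSpace (𝓡∂ n) p), v ≠ 0 → 0 < secondForm X ν p v v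

/-- `ν` is the smooth unit normal field of `X` pointing out of the enclosed domain. (At points on
the hyperplane, in particular along the boundary, the direction is determined by continuity.) -/
structure IsOutwardNormal (X ν : M → Ambient n) : Prop where
  smooth : ContMDiff (𝓡∂ n) 𝓘(ℝ, Ambient n) ∞ ν
  unit : ∀ p, ‖ν p‖ = 1
  normal : ∀ (p : M) (v : TangentSpace (𝓡∂ n) p), ⟪diff X p v, ν p⟫ = 0
  outward : ∀ p, 0 < ⟪X p, vertical n⟫ → ∀ᶠ s in 𝓝[>] (0 : ℝ),
    X p - s • ν p ∈ enclosedDomain (range X) ∧ X p + s • ν p ∉ enclosedDomain (range X)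

/-- `X : M → ℝⁿ⁺¹` is a smooth embedding into the closed upper half-space, with the boundary of
`M` going to the hyperplane, whose image is a capillary hypersurface with outward unit normal `ν`
and contact angle `θ`. -/
structure IsCapillaryHypersurface (θ : ℝ) (X ν : M → Ambient n) : Prop where
  smooth : ContMDiff (𝓡∂ n) 𝓘(ℝ, Ambient n) ∞ X
  immersion : ∀ p, Function.Injective (diff X p)
  embedding : IsEmbedding X
  mem_halfSpace : ∀ p, 0 ≤ ⟪X p, vertical n⟫
  boundary_mem : ∀ p ∈ (𝓡∂ n).boundary M, ⟪X p, vertical n⟫ = 0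
  outwardNormal : IsOutwardNormal X ν
  contact_angle : ∀ p ∈ (𝓡∂ n).boundary M, ⟪ν p, vertical n⟫ = Real.cos θ

/-- The `n`-dimensional area measure `dA` of the embedded hypersurface `X`, as a measure on `M`. -/
def areaMeasure [MeasurableSpace M] (X : M → Ambient n) : Measure M :=
  (μHE[n] : Measure (Ambient n)).comap X

/-- The two kinds of constrained flow. -/
inductive Constraint
  | volume
  | area

/-- The non-local term `φ` of the volume preserving, respectively area preserving, flow, as a
functional of the hypersurface. -/
def nonlocalTerm [MeasurableSpace M] (α θ : ℝ) (X ν : M → Ambient n) : Constraint → ℝ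
  | .volume =>
      (∫ p, (1 - Real.cos θ * ⟪ν p, vertical n⟫) * meanCurv X ν p ^ α ∂(areaMeasure X))
        / capillaryArea θ (range X)
  | .area =>
      (∫ p, (1 - Real.cos θ * ⟪ν p, vertical n⟫) * meanCurv X ν p ^ (α + 1) ∂(areaMeasure X))
        / ∫ p, (1 - Real.cos θ * ⟪ν p, vertical n⟫) * meanCurv X ν p ∂(areaMeasure X)

/-- The time interval `[0, T)`, where `T ≤ +∞`. -/
def timeInterval (T : EReal) : Set ℝ := {t | 0 ≤ t ∧ (t : EReal) < T}

/-- `F` is smooth on `M × (0, T)`, and `F` together with its spatial differential is continuous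
up to the initial time, on `M × [0, T)`. -/
structure SmoothFamily [IsManifold (𝓡∂ n) ∞ M] (T : EReal) (F : ℝ → M → Ambient n) : Prop where
  smooth : ContMDiffOn (𝓘(ℝ, ℝ).prod (𝓡∂ n)) 𝓘(ℝ, Ambient n) ∞
    (fun q : ℝ × M => F q.1 q.2) ({t | t ∈ timeInterval T ∧ 0 < t} ×ˢ univ)
  continuous : ContinuousOn (fun q : ℝ × M => F q.1 q.2) (timeInterval T ×ˢ univ)
  continuous_diff : ContinuousOn
    (fun q : ℝ × TangentBundle (𝓡∂ n) M => diff (F q.1) q.2.proj q.2.snd)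
    (timeInterval T ×ˢ univ)

/-- `X`, with outward unit normals `ν`, is a smooth solution on `[0, T)` of
`∂ₜX = (φ(t) - H^α) (ν - cos θ Eₙ₊₁)` in the class of capillary hypersurfaces with contact angle
`θ` and positive mean curvature. -/
structure IsSolution [IsManifold (𝓡∂ n) ∞ M] [MeasurableSpace M] (c : Constraint) (α θ : ℝ)
    (T : EReal) (X ν : ℝ → M → Ambient n) : Prop where
  smooth : SmoothFamily T X
  smooth_normal : SmoothFamily T ν
  capillary : ∀ t ∈ timeInterval T, IsCapillaryHypersurface θ (X t) (ν t)
  meanCurv_pos : ∀ t ∈ timeInterval T, ∀ p, 0 < meanCurv (X t) (ν t) p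
  evolution : ∀ t ∈ timeInterval T, ∀ p,
    HasDerivWithinAt (fun s => X s p)
      ((nonlocalTerm α θ (X t) (ν t) c - meanCurv (X t) (ν t) p ^ α) •
        (ν t p - Real.cos θ • vertical n)) (Ici 0) t

end Hypersurface

end CapillaryFlow

end

/-!
Strict convexity is preserved because the second fundamental form `h` stays above a decaying
positive multiple of the metric `g`. The multiple is the barrier
`L = ε e^{-K t} (1 + ⟪X, Eₙ₊₁⟫)`, and the claim is that the pinching form `h - L g` stays positive
definite if `ε` is small and `K` is large.

By compactness, strict convexity of the initial hypersurface gives this on a short time interval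
(`exists_initial_pinching`), on which only the continuity of the first derivatives of `X` and `ν` is
available; afterwards the flow is smooth and `H`, `H ^ α - φ` and `α H ^ (α - 1)` are bounded by
some `B` (`exists_bound`). At the first time at which positivity fails, the form `h - L g` is still
nonnegative and has a null vector `v`, which is therefore an eigenvector of the Weingarten map with
eigenvalue `L`.

Over an interior point, in normal coordinates, `h_vv` evolves by
`(1 - cos θ ⟪ν, Eₙ₊₁⟫) ∇²_vv (H ^ α)` and lower order terms (`timeDeriv_pinchForm`), where
`∇²_vv (H ^ α) = α H ^ (α - 1) (∇²_vv H + (α - 1) (∇_v H)² / H)`. By Simons' identity, `∇²_vv H` is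
the Laplacian of the form in the direction `v`, up to zero order terms. The bare second derivative
test would only say that this Laplacian is nonnegative, and for `α < 1` the gradient term has the
wrong sign. Testing `h - L g` on vectors `v - τ y` that rotate with the point yields instead
`2 (∇_v (H - L))² / H` as a lower bound (`spaceDeriv_spaceDeriv_meanCurv_ge`), which is enough for
every `α > 0`. The remaining terms are at most a multiple of `L`, so that the rate `K` cannot exceed
`criticalRate θ B` (`rate_le_of_null`).

Over a boundary point the conormal `μ = (Eₙ₊₁ - cos θ ν) / sin θ` is a principal direction, with
curvature `κ ≥ L`. The derivative of `h - L g` along the inward conormal is nonnegative on a null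
vector, while `L` strictly increases in this direction. If the null vector is tangential to the
boundary, then the conormal derivative of `h` on it is `cot θ · L (L - κ) ≤ 0`
(`conormal_derivative`), which is impossible. If the null vector is `μ`, then all tangential
components of `h` have nonnegative conormal derivative, that of `h_μμ` is positive, and so that of
`H` is positive, although the contact angle condition, differentiated in time, says that it vanishes
(`spaceDeriv_meanCurv_eq_zero`). Hence no null vector lies over the boundary (`not_null`).

The computations are carried out in space-time coordinates, where a solution is described by a
`FlowPatch`. The nonlocal term enters only through the fact that it is a function of time alone; it
is smooth in time because it can be read off from the normal component of the evolution equation.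
-/

namespace CapillaryFlow

/-! ### Directional derivatives within a set -/

section Calculus

variable {V W : Type*} [NormedAddCommGroup V] [NormedSpace ℝ V]
  [NormedAddCommGroup W] [NormedSpace ℝ W]

/-- The derivative of `f` within `s` in the direction `v`, as a function of the base point. -/
noncomputable def dirDeriv (s : Set V) (v : V) (f : V → W) : V → W :=
  fun x => fderivWithin ℝ f s x v

/-- The sets within which the usual rules of differential calculus, including the symmetry of
second derivatives, hold: open sets, and relatively open subsets of a half-space. -/
structure IsCalculusDomain (s : Set V) : Prop where
  uniqueDiffOn : UniqueDiffOn ℝ s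
  subset_closure : s ⊆ closure (interior s)

theorem IsCalculusDomain.of_isOpen {s : Set V} (hs : IsOpen s) : IsCalculusDomain s :=
  ⟨hs.uniqueDiffOn, by rw [hs.interior_eq]; exact _root_.subset_closure⟩

theorem IsCalculusDomain.of_convex_inter {O D : Set V} (hO : IsOpen O) (hD : Convex ℝ D)
    (hne : (interior D).Nonempty) : IsCalculusDomain (O ∩ D) := by
  refine ⟨(inter_comm O D) ▸ (uniqueDiffOn_convex hD hne).inter hO, ?_⟩
  rintro x ⟨hxO, hxD⟩
  have hx : x ∈ closure (interior D) := by
    rw [hD.closure_interior_eq_closure_of_nonempty_interior hne]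
    exact _root_.subset_closure hxD
  rw [interior_inter, hO.interior_eq]
  exact hO.inter_closure ⟨hxO, hx⟩

variable {s : Set V} {f g : V → W} {v w x : V}

theorem ContDiffOn.dirDeriv (hs : IsCalculusDomain s) (hf : ContDiffOn ℝ ∞ f s) (v : V) :
    ContDiffOn ℝ ∞ (dirDeriv s v f) s :=
  (hf.fderivWithin hs.uniqueDiffOn (by simp)).clm_apply contDiffOn_const

theorem diffWithinAt (hf : ContDiffOn ℝ ∞ f s) (hx : x ∈ s) : DifferentiableWithinAt ℝ f s x :=
  hf.differentiableOn (by simp) x hx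

theorem contDiffOn_smul {c : V → ℝ} (hc : ContDiffOn ℝ ∞ c s) (hf : ContDiffOn ℝ ∞ f s) :
    ContDiffOn ℝ ∞ (fun y => c y • f y) s := hc.smul hf

theorem dirDeriv_congr (h : EqOn f g s) (hx : x ∈ s) : dirDeriv s v f x = dirDeriv s v g x := by
  unfold dirDeriv
  rw [fderivWithin_congr h (h hx)]

theorem dirDeriv_const (c : W) : dirDeriv s v (fun _ => c) x = 0 := by
  simp [dirDeriv]

theorem dirDeriv_add (hs : IsCalculusDomain s) (hf : ContDiffOn ℝ ∞ f s) (hg : ContDiffOn ℝ ∞ g s)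
    (hx : x ∈ s) :
    dirDeriv s v (fun y => f y + g y) x = dirDeriv s v f x + dirDeriv s v g x := by
  unfold dirDeriv
  rw [fderivWithin_fun_add (hs.uniqueDiffOn x hx) (diffWithinAt hf hx) (diffWithinAt hg hx)]; rfl

theorem dirDeriv_sub (hs : IsCalculusDomain s) (hf : ContDiffOn ℝ ∞ f s) (hg : ContDiffOn ℝ ∞ g s)
    (hx : x ∈ s) :
    dirDeriv s v (fun y => f y - g y) x = dirDeriv s v f x - dirDeriv s v g x := by
  unfold dirDeriv
  rw [fderivWithin_fun_sub (hs.uniqueDiffOn x hx) (diffWithinAt hf hx) (diffWithinAt hg hx)]; rfl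

theorem dirDeriv_neg (hs : IsCalculusDomain s) (hx : x ∈ s) :
    dirDeriv s v (fun y => - f y) x = - dirDeriv s v f x := by
  unfold dirDeriv
  rw [fderivWithin_fun_neg (hs.uniqueDiffOn x hx)]; rfl

theorem dirDeriv_sum (hs : IsCalculusDomain s) {ι : Type*} {t : Finset ι} {F : ι → V → W}
    (hF : ∀ i ∈ t, ContDiffOn ℝ ∞ (F i) s) (hx : x ∈ s) :
    dirDeriv s v (fun y => ∑ i ∈ t, F i y) x = ∑ i ∈ t, dirDeriv s v (F i) x := by
  unfold dirDeriv
  rw [fderivWithin_fun_sum (hs.uniqueDiffOn x hx) (fun i hi => diffWithinAt (hF i hi) hx)]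
  simp

theorem dirDeriv_smul (hs : IsCalculusDomain s) {c : V → ℝ} (hc : ContDiffOn ℝ ∞ c s)
    (hf : ContDiffOn ℝ ∞ f s) (hx : x ∈ s) :
    dirDeriv s v (fun y => c y • f y) x = c x • dirDeriv s v f x + dirDeriv s v c x • f x := by
  unfold dirDeriv
  rw [fderivWithin_fun_smul (hs.uniqueDiffOn x hx) (diffWithinAt hc hx) (diffWithinAt hf hx)]
  simp

theorem dirDeriv_mul (hs : IsCalculusDomain s) {c d : V → ℝ} (hc : ContDiffOn ℝ ∞ c s)
    (hd : ContDiffOn ℝ ∞ d s) (hx : x ∈ s) :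
    dirDeriv s v (fun y => c y * d y) x = c x * dirDeriv s v d x + dirDeriv s v c x * d x := by
  simpa using dirDeriv_smul hs hc hd hx (v := v)

theorem dirDeriv_inner {A : Type*} [NormedAddCommGroup A] [InnerProductSpace ℝ A]
    {f g : V → A} (hs : IsCalculusDomain s) (hf : ContDiffOn ℝ ∞ f s) (hg : ContDiffOn ℝ ∞ g s)
    (hx : x ∈ s) :
    dirDeriv s v (fun y => ⟪f y, g y⟫) x
      = ⟪dirDeriv s v f x, g x⟫ + ⟪f x, dirDeriv s v g x⟫ := by
  unfold dirDeriv
  rw [((diffWithinAt hf hx).hasFDerivWithinAt.inner ℝ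
    (diffWithinAt hg hx).hasFDerivWithinAt).fderivWithin
    (hs.uniqueDiffOn x hx)]
  simp [fderivInnerCLM_apply, add_comm]

/-- Second derivatives commute within a calculus domain. -/
theorem dirDeriv_comm (hs : IsCalculusDomain s) (hf : ContDiffOn ℝ ∞ f s) (v w : V) (hx : x ∈ s) :
    dirDeriv s v (dirDeriv s w f) x = dirDeriv s w (dirDeriv s v f) x := by
  have hsymm : IsSymmSndFDerivWithinAt ℝ f s x :=
    ContDiffWithinAt.isSymmSndFDerivWithinAt (n := ∞) (hf x hx)
      (by simp only [minSmoothness_of_isRCLikeNormedField]; exact ENat.LEInfty.out)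
      hs.uniqueDiffOn (hs.subset_closure hx) hx
  have hd : DifferentiableWithinAt ℝ (fderivWithin ℝ f s) s x :=
    diffWithinAt (hf.fderivWithin hs.uniqueDiffOn (by simp)) hx
  unfold dirDeriv
  rw [fderivWithin_clm_apply (hs.uniqueDiffOn x hx) hd (differentiableWithinAt_const _),
    fderivWithin_clm_apply (hs.uniqueDiffOn x hx) hd (differentiableWithinAt_const _)]
  simpa using hsymm v w

theorem hasDerivWithinAt_dirDeriv (hf : ContDiffOn ℝ ∞ f s) (hx : x ∈ s) {I : Set ℝ}
    (hI : ∀ ε ∈ I, x + ε • v ∈ s) :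
    HasDerivWithinAt (fun ε : ℝ => f (x + ε • v)) (dirDeriv s v f x) I 0 := by
  have h1 : HasFDerivWithinAt f (fderivWithin ℝ f s x) s (x + (0 : ℝ) • v) := by
    simpa using (diffWithinAt hf hx).hasFDerivWithinAt
  have h2 : HasDerivWithinAt (fun ε : ℝ => x + ε • v) v I 0 := by
    simpa using (((hasDerivAt_id (0 : ℝ)).smul_const v).const_add x).hasDerivWithinAt
  exact h1.comp_hasDerivWithinAt 0 h2 hI

/-- A function that vanishes along a segment in the direction `v` has vanishing derivative in this
direction. -/
theorem dirDeriv_eq_zero_of_segment (hf : ContDiffOn ℝ ∞ f s) (hx : x ∈ s)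
    (h : ∀ᶠ ε in 𝓝[>] (0 : ℝ), x + ε • v ∈ s ∧ f (x + ε • v) = 0) (h0 : f x = 0) :
    dirDeriv s v f x = 0 := by
  obtain ⟨δ, hδ, hI⟩ := mem_nhdsGT_iff_exists_Ioo_subset.1 h
  have hmem : ∀ ε ∈ Ico (0 : ℝ) δ, x + ε • v ∈ s ∧ f (x + ε • v) = 0 := by
    intro ε hε
    rcases hε.1.eq_or_lt with h | h
    · subst h; simpa using ⟨hx, h0⟩
    · exact hI ⟨h, hε.2⟩
  have h1 := hasDerivWithinAt_dirDeriv (v := v) hf hx (fun ε hε => (hmem ε hε).1)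
  have h2 : HasDerivWithinAt (fun ε : ℝ => f (x + ε • v)) 0 (Ico 0 δ) 0 :=
    (hasDerivWithinAt_const (0 : ℝ) (Ico 0 δ) (0 : W)).congr (fun ε hε => (hmem ε hε).2)
      (by simpa using h0)
  exact (uniqueDiffOn_Ico (0 : ℝ) δ 0 ⟨le_rfl, hδ⟩).eq_deriv _ h1 h2

/-- At a zero from which a function is nonnegative along a segment in the direction `v`, the
derivative in this direction is nonnegative. -/
theorem dirDeriv_nonneg_of_segment {f : V → ℝ} (hf : ContDiffOn ℝ ∞ f s) (hx : x ∈ s)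
    (h : ∀ᶠ ε in 𝓝[>] (0 : ℝ), x + ε • v ∈ s ∧ 0 ≤ f (x + ε • v)) (h0 : f x = 0) :
    0 ≤ dirDeriv s v f x := by
  obtain ⟨δ, hδ, hI⟩ := mem_nhdsGT_iff_exists_Ioo_subset.1 h
  have h1 := hasDerivWithinAt_dirDeriv (v := v) (I := Ioo 0 δ) hf hx (fun ε hε => (hI hε).1)
  have h2 := hasDerivWithinAt_iff_tendsto_slope.1 h1
  have : (𝓝[Ioo (0 : ℝ) δ \ {0}] 0).NeBot := by
    have : Ioo (0 : ℝ) δ \ {0} = Ioo 0 δ := sdiff_singleton_eq_self (by simp)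
    rw [this, nhdsWithin_Ioo_eq_nhdsGT hδ]; infer_instance
  refine ge_of_tendsto h2 (eventually_nhdsWithin_of_forall ?_)
  rintro ε ⟨hε, -⟩
  have := (hI hε).2
  simp only [slope_def_field, zero_smul, add_zero, h0, sub_zero]
  exact div_nonneg this hε.1.le

/-- The necessary second derivative condition at a local minimum on the real line. -/
theorem second_deriv_nonneg_of_isLocalMin {f f' : ℝ → ℝ} {x c : ℝ}
    (hf : ∀ᶠ y in 𝓝 x, HasDerivAt f (f' y) y) (hf' : HasDerivAt f' c x) (hmin : IsLocalMin f x) :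
    0 ≤ c := by
  by_contra! hc
  have hd : deriv f =ᶠ[𝓝 x] f' := hf.mono fun y hy => hy.deriv
  have h0 : deriv f x = 0 := hmin.deriv_eq_zero
  have h2 : deriv (deriv f) x = c := by rw [hd.deriv_eq, hf'.deriv]
  have hmax := isLocalMax_of_deriv_deriv_neg (f := f) (x₀ := x) (by rw [h2]; exact hc) h0
    hf.self_of_nhds.continuousAt
  have heq : f =ᶠ[𝓝 x] fun _ => f x := by
    filter_upwards [hmin, hmax] with y h1 h2 using le_antisymm h2 h1
  have : deriv f =ᶠ[𝓝 x] fun _ => 0 := by simpa using heq.deriv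
  rw [this.deriv_eq] at h2
  simp at h2
  exact hc.ne h2.symm

theorem dirDeriv_dirDeriv_nonneg_of_isOpen {f : V → ℝ} (hs : IsOpen s) (hf : ContDiffOn ℝ ∞ f s)
    (hx : x ∈ s) (h : ∀ᶠ ε in 𝓝 (0 : ℝ), 0 ≤ f (x + ε • v)) (h0 : f x = 0) :
    0 ≤ dirDeriv s v (dirDeriv s v f) x := by
  have hc : Continuous fun ε : ℝ => x + ε • v := by fun_prop
  have hev : ∀ᶠ ε in 𝓝 (0 : ℝ), x + ε • v ∈ s :=
    hc.continuousAt.eventually_mem (hs.mem_nhds (by simpa using hx))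
  have key : ∀ {g : V → ℝ}, ContDiffOn ℝ ∞ g s → ∀ ε : ℝ, x + ε • v ∈ s →
      HasDerivAt (fun ε : ℝ => g (x + ε • v)) (dirDeriv s v g (x + ε • v)) ε := by
    intro g hg ε hε
    have h1 : HasFDerivAt g (fderivWithin ℝ g s (x + ε • v)) (x + ε • v) :=
      (diffWithinAt hg hε).hasFDerivWithinAt.hasFDerivAt (hs.mem_nhds hε)
    have h2 : HasDerivAt (fun ε : ℝ => x + ε • v) v ε := by
      simpa using (((hasDerivAt_id ε).smul_const v).const_add x)
    exact h1.comp_hasDerivAt ε h2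
  have h2 := key (ContDiffOn.dirDeriv (.of_isOpen hs) hf v) 0 (by simpa using hx)
  rw [zero_smul, add_zero] at h2
  refine second_deriv_nonneg_of_isLocalMin (hev.mono fun ε hε => key hf ε hε) h2 ?_
  filter_upwards [h] with ε hε
  simpa [h0] using hε

end Calculus

/-! ### Flow patches: the flow in local space-time coordinates -/

/-- The space-time `ℝ × ℝⁿ` of local coordinates. -/
abbrev SpaceTime (n : ℕ) : Type := ℝ × EuclideanSpace ℝ (Fin n)

section Patch

variable {n : ℕ} {W : Type*} [NormedAddCommGroup W] [NormedSpace ℝ W]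

/-- The derivative within `s` in the spatial direction `a`. -/
noncomputable abbrev spaceDeriv (s : Set (SpaceTime n)) (a : EuclideanSpace ℝ (Fin n))
    (f : SpaceTime n → W) : SpaceTime n → W := dirDeriv s (0, a) f

/-- The derivative within `s` in the direction of time. -/
noncomputable abbrev timeDeriv (s : Set (SpaceTime n)) (f : SpaceTime n → W) : SpaceTime n → W :=
  dirDeriv s (1, 0) f

/-- The `k`-th coordinate vector of `ℝⁿ`. -/
noncomputable abbrev basisVec (k : Fin n) : EuclideanSpace ℝ (Fin n) := EuclideanSpace.single k 1

theorem dirDeriv_add_dir {s : Set (SpaceTime n)} (v w : SpaceTime n) (f : SpaceTime n → W)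
    (x : SpaceTime n) : dirDeriv s (v + w) f x = dirDeriv s v f x + dirDeriv s w f x :=
  map_add _ _ _

theorem spaceDeriv_add_dir {s : Set (SpaceTime n)} (a b : EuclideanSpace ℝ (Fin n))
    (f : SpaceTime n → W) (x : SpaceTime n) :
    spaceDeriv s (a + b) f x = spaceDeriv s a f x + spaceDeriv s b f x := by
  simp only [spaceDeriv, ← dirDeriv_add_dir, Prod.mk_add_mk, add_zero]

theorem spaceDeriv_smul_dir {s : Set (SpaceTime n)} (c : ℝ) (a : EuclideanSpace ℝ (Fin n))
    (f : SpaceTime n → W) (x : SpaceTime n) :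
    spaceDeriv s (c • a) f x = c • spaceDeriv s a f x := by
  have : ((0 : ℝ), c • a) = c • ((0 : ℝ), a) := by simp
  rw [spaceDeriv, this]
  exact map_smul _ _ _

theorem spaceDeriv_eq_sum {s : Set (SpaceTime n)} (a : EuclideanSpace ℝ (Fin n))
    (f : SpaceTime n → W) (x : SpaceTime n) :
    spaceDeriv s a f x = ∑ k, a k • spaceDeriv s (basisVec k) f x := by
  have h : ∀ t : Finset (Fin n), spaceDeriv s (∑ k ∈ t, a k • basisVec k) f x
      = ∑ k ∈ t, a k • spaceDeriv s (basisVec k) f x := by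
    intro t
    induction t using Finset.induction_on with
    | empty =>
      simp only [Finset.sum_empty]
      exact map_zero (fderivWithin ℝ f s x)
    | insert i t hi ih =>
      rw [Finset.sum_insert hi, Finset.sum_insert hi, spaceDeriv_add_dir, spaceDeriv_smul_dir, ih]
  rw [← h]
  congr 1
  ext i
  simp [Finset.sum_apply, Pi.single_apply]

/-- The capillary flow in local coordinates on a space-time domain `s`: the parametrization `F`,
the unit normal `N`, the matrix `A` of the Weingarten map with its trace `H`, and
`q = H ^ α - φ`. The last two fields say `∂ₜF = -q (N - cos θ Eₙ₊₁)`, and that `q` and `H ^ α`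
have the same spatial derivatives. -/
structure FlowPatch (α θ : ℝ) (s : Set (SpaceTime n)) (F N : SpaceTime n → Ambient n)
    (A : Fin n → Fin n → SpaceTime n → ℝ) (H q : SpaceTime n → ℝ) : Prop where
  domain : IsCalculusDomain s
  smooth_F : ContDiffOn ℝ ∞ F s
  smooth_N : ContDiffOn ℝ ∞ N s
  smooth_A : ∀ k l, ContDiffOn ℝ ∞ (A k l) s
  smooth_H : ContDiffOn ℝ ∞ H s
  smooth_q : ContDiffOn ℝ ∞ q s
  unit : ∀ x ∈ s, ⟪N x, N x⟫ = 1
  normal : ∀ a, ∀ x ∈ s, ⟪spaceDeriv s a F x, N x⟫ = 0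
  weingarten : ∀ k, ∀ x ∈ s, spaceDeriv s (basisVec k) N x
    = ∑ l, A k l x • spaceDeriv s (basisVec l) F x
  trace : ∀ x ∈ s, H x = ∑ k, A k k x
  H_pos : ∀ x ∈ s, 0 < H x
  evolution : ∀ x ∈ s, timeDeriv s F x = -(q x • (N x - Real.cos θ • vertical n))
  space_q : ∀ a, ∀ x ∈ s, spaceDeriv s a q x = α * H x ^ (α - 1) * spaceDeriv s a H x

namespace FlowPatch

variable {α θ : ℝ} {s : Set (SpaceTime n)} {F N : SpaceTime n → Ambient n}
  {A : Fin n → Fin n → SpaceTime n → ℝ} {H q : SpaceTime n → ℝ} {x : SpaceTime n}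
  (hp : FlowPatch α θ s F N A H q)
include hp

theorem smooth_dF (v : SpaceTime n) : ContDiffOn ℝ ∞ (dirDeriv s v F) s :=
  ContDiffOn.dirDeriv hp.domain hp.smooth_F v

theorem smooth_dN (v : SpaceTime n) : ContDiffOn ℝ ∞ (dirDeriv s v N) s :=
  ContDiffOn.dirDeriv hp.domain hp.smooth_N v

theorem smooth_ddF (v w : SpaceTime n) : ContDiffOn ℝ ∞ (dirDeriv s v (dirDeriv s w F)) s :=
  ContDiffOn.dirDeriv hp.domain (hp.smooth_dF w) v

theorem smooth_ddN (v w : SpaceTime n) : ContDiffOn ℝ ∞ (dirDeriv s v (dirDeriv s w N)) s :=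
  ContDiffOn.dirDeriv hp.domain (hp.smooth_dN w) v

theorem inner_dirDeriv_unit (v : SpaceTime n) (hx : x ∈ s) : ⟪dirDeriv s v N x, N x⟫ = 0 := by
  have h : dirDeriv s v (fun y => ⟪N y, N y⟫) x = dirDeriv s v (fun _ => (1 : ℝ)) x :=
    dirDeriv_congr (fun y hy => hp.unit y hy) hx
  rw [dirDeriv_inner hp.domain hp.smooth_N hp.smooth_N hx, dirDeriv_const] at h
  linarith [real_inner_comm (dirDeriv s v N x) (N x)]

theorem inner_dirDeriv_dirDeriv_unit (v : SpaceTime n) (hx : x ∈ s) :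
    ⟪dirDeriv s v (dirDeriv s v N) x, N x⟫ = -⟪dirDeriv s v N x, dirDeriv s v N x⟫ := by
  have h : dirDeriv s v (fun y => ⟪dirDeriv s v N y, N y⟫) x = dirDeriv s v (fun _ => (0 : ℝ)) x :=
    dirDeriv_congr (fun y hy => hp.inner_dirDeriv_unit v hy) hx
  rw [dirDeriv_inner hp.domain (hp.smooth_dN v) hp.smooth_N hx, dirDeriv_const] at h
  linarith

theorem inner_dirDeriv_normal (v : SpaceTime n) (b : EuclideanSpace ℝ (Fin n)) (hx : x ∈ s) :
    ⟪dirDeriv s v N x, spaceDeriv s b F x⟫ = -⟪N x, dirDeriv s v (spaceDeriv s b F) x⟫ := by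
  have h : dirDeriv s v (fun y => ⟪spaceDeriv s b F y, N y⟫) x
      = dirDeriv s v (fun _ => (0 : ℝ)) x :=
    dirDeriv_congr (fun y hy => hp.normal b y hy) hx
  rw [dirDeriv_inner hp.domain (hp.smooth_dF _) hp.smooth_N hx, dirDeriv_const] at h
  have h1 := real_inner_comm (dirDeriv s v N x) (spaceDeriv s b F x)
  have h2 := real_inner_comm (dirDeriv s v (spaceDeriv s b F) x) (N x)
  linarith

theorem secondForm_symm (a b : EuclideanSpace ℝ (Fin n)) (hx : x ∈ s) :
    ⟪spaceDeriv s a N x, spaceDeriv s b F x⟫ = ⟪spaceDeriv s b N x, spaceDeriv s a F x⟫ := by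
  rw [hp.inner_dirDeriv_normal _ b hx, hp.inner_dirDeriv_normal _ a hx,
    dirDeriv_comm hp.domain hp.smooth_F _ _ hx]

/-- The once differentiated symmetry of the second fundamental form. -/
theorem dirDeriv_secondForm_symm (v : SpaceTime n) (a b : EuclideanSpace ℝ (Fin n)) (hx : x ∈ s) :
    ⟪dirDeriv s v (spaceDeriv s a N) x, spaceDeriv s b F x⟫
        + ⟪spaceDeriv s a N x, dirDeriv s v (spaceDeriv s b F) x⟫
      = ⟪dirDeriv s v (spaceDeriv s b N) x, spaceDeriv s a F x⟫
        + ⟪spaceDeriv s b N x, dirDeriv s v (spaceDeriv s a F) x⟫ := by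
  have h : dirDeriv s v (fun y => ⟪spaceDeriv s a N y, spaceDeriv s b F y⟫) x
      = dirDeriv s v (fun y => ⟪spaceDeriv s b N y, spaceDeriv s a F y⟫) x :=
    dirDeriv_congr (fun y hy => hp.secondForm_symm a b hy) hx
  rwa [dirDeriv_inner hp.domain (hp.smooth_dN _) (hp.smooth_dF _) hx,
    dirDeriv_inner hp.domain (hp.smooth_dN _) (hp.smooth_dF _) hx] at h

/-- Simons' identity in coordinates: the symmetry of the second fundamental form, differentiated
once in each of its two arguments. -/
theorem simons_identity (a b : EuclideanSpace ℝ (Fin n)) (hx : x ∈ s) :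
    (⟪spaceDeriv s b (spaceDeriv s b (spaceDeriv s a N)) x, spaceDeriv s a F x⟫
        - ⟪spaceDeriv s b (spaceDeriv s b (spaceDeriv s a F)) x, spaceDeriv s a N x⟫)
      - (⟪spaceDeriv s a (spaceDeriv s a (spaceDeriv s b N)) x, spaceDeriv s b F x⟫
        - ⟪spaceDeriv s a (spaceDeriv s a (spaceDeriv s b F)) x, spaceDeriv s b N x⟫)
      = ⟪spaceDeriv s a (spaceDeriv s a N) x, spaceDeriv s b (spaceDeriv s b F) x⟫
        - ⟪spaceDeriv s b (spaceDeriv s b N) x, spaceDeriv s a (spaceDeriv s a F) x⟫ := by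
  have hD := hp.domain
  have h : dirDeriv s (0, a) (fun y => ⟪spaceDeriv s b (spaceDeriv s a N) y, spaceDeriv s b F y⟫
        + ⟪spaceDeriv s a N y, spaceDeriv s b (spaceDeriv s b F) y⟫) x
      = dirDeriv s (0, a) (fun y => ⟪spaceDeriv s b (spaceDeriv s b N) y, spaceDeriv s a F y⟫
        + ⟪spaceDeriv s b N y, spaceDeriv s b (spaceDeriv s a F) y⟫) x :=
    dirDeriv_congr (fun y hy => hp.dirDeriv_secondForm_symm _ a b hy) hx
  rw [dirDeriv_add hD ((hp.smooth_ddN _ _).inner ℝ (hp.smooth_dF _))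
      ((hp.smooth_dN _).inner ℝ (hp.smooth_ddF _ _)) hx,
    dirDeriv_add hD ((hp.smooth_ddN _ _).inner ℝ (hp.smooth_dF _))
      ((hp.smooth_dN _).inner ℝ (hp.smooth_ddF _ _)) hx,
    dirDeriv_inner hD (hp.smooth_ddN _ _) (hp.smooth_dF _) hx, dirDeriv_inner hD (hp.smooth_dN _)
      (hp.smooth_ddF _ _) hx,
    dirDeriv_inner hD (hp.smooth_ddN _ _) (hp.smooth_dF _) hx, dirDeriv_inner hD (hp.smooth_dN _)
      (hp.smooth_ddF _ _) hx] at h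
  have e1 : ∀ G : SpaceTime n → Ambient n, ContDiffOn ℝ ∞ G s →
      dirDeriv s (0, a) (spaceDeriv s b (spaceDeriv s a G)) x
        = spaceDeriv s a (spaceDeriv s a (spaceDeriv s b G)) x := fun G hG =>
    dirDeriv_congr (fun y hy => dirDeriv_comm hD hG _ _ hy) hx
  have e2 : ∀ G : SpaceTime n → Ambient n, ContDiffOn ℝ ∞ G s →
      dirDeriv s (0, a) (spaceDeriv s b (spaceDeriv s b G)) x
        = spaceDeriv s b (spaceDeriv s b (spaceDeriv s a G)) x := fun G hG => by
    rw [dirDeriv_comm hD (ContDiffOn.dirDeriv hD hG _) _ _ hx]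
    exact dirDeriv_congr (fun y hy => dirDeriv_comm hD hG _ _ hy) hx
  have e3 : dirDeriv s (0, a) (spaceDeriv s b N) x = spaceDeriv s b (spaceDeriv s a N) x :=
    dirDeriv_comm hD hp.smooth_N _ _ hx
  have e4 : dirDeriv s (0, a) (spaceDeriv s b F) x = spaceDeriv s b (spaceDeriv s a F) x :=
    dirDeriv_comm hD hp.smooth_F _ _ hx
  rw [e1 N hp.smooth_N, e2 F hp.smooth_F, e2 N hp.smooth_N, e1 F hp.smooth_F, e3, e4] at h
  have c1 := real_inner_comm (spaceDeriv s a N x)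
    (spaceDeriv s b (spaceDeriv s b (spaceDeriv s a F)) x)
  have c2 := real_inner_comm (spaceDeriv s b N x)
    (spaceDeriv s a (spaceDeriv s a (spaceDeriv s b F)) x)
  linarith

/-- At a point with an orthonormal coordinate frame, the Weingarten matrix is the matrix of the
second fundamental form. -/
theorem weingarten_eq_inner (hx : x ∈ s)
    (hon : ∀ a b, ⟪spaceDeriv s a F x, spaceDeriv s b F x⟫ = ⟪a, b⟫) (k l : Fin n) :
    A k l x = ⟪spaceDeriv s (basisVec k) N x, spaceDeriv s (basisVec l) F x⟫ := by
  rw [hp.weingarten k x hx, sum_inner]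
  simp [inner_smul_left, hon, EuclideanSpace.inner_single_left]

theorem weingarten_symm (hx : x ∈ s)
    (hon : ∀ a b, ⟪spaceDeriv s a F x, spaceDeriv s b F x⟫ = ⟪a, b⟫) (k l : Fin n) :
    A k l x = A l k x := by
  rw [hp.weingarten_eq_inner hx hon, hp.weingarten_eq_inner hx hon, hp.secondForm_symm _ _ hx]

theorem sum_sum_inner_weingarten (hx : x ∈ s)
    (hon : ∀ a b, ⟪spaceDeriv s a F x, spaceDeriv s b F x⟫ = ⟪a, b⟫) (z : Fin n → Ambient n) :
    ∑ k, ∑ l, A k l x * ⟪z l, spaceDeriv s (basisVec k) F x⟫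
      = ∑ k, ⟪z k, spaceDeriv s (basisVec k) N x⟫ := by
  rw [Finset.sum_comm]
  refine Finset.sum_congr rfl fun l _ => ?_
  rw [hp.weingarten l x hx, inner_sum]
  refine Finset.sum_congr rfl fun k _ => ?_
  rw [inner_smul_right, hp.weingarten_symm hx hon k l]

theorem dirDeriv_weingarten (v : SpaceTime n) (k : Fin n) (hx : x ∈ s) :
    dirDeriv s v (spaceDeriv s (basisVec k) N) x
      = ∑ l, (A k l x • dirDeriv s v (spaceDeriv s (basisVec l) F) x
        + dirDeriv s v (A k l) x • spaceDeriv s (basisVec l) F x) := by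
  have hD := hp.domain
  rw [dirDeriv_congr (fun y hy => hp.weingarten k y hy) hx,
    dirDeriv_sum (F := fun l y => A k l y • spaceDeriv s (basisVec l) F y) hD
      (fun l _ => (hp.smooth_A k l).smul (hp.smooth_dF _)) hx]
  exact Finset.sum_congr rfl fun l _ => dirDeriv_smul hD (hp.smooth_A k l) (hp.smooth_dF _) hx

theorem dirDeriv_meanCurv (v : SpaceTime n) (hx : x ∈ s)
    (hon : ∀ a b, ⟪spaceDeriv s a F x, spaceDeriv s b F x⟫ = ⟪a, b⟫) :
    dirDeriv s v H x
      = ∑ k, (⟪dirDeriv s v (spaceDeriv s (basisVec k) N) x, spaceDeriv s (basisVec k) F x⟫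
        - ⟪dirDeriv s v (spaceDeriv s (basisVec k) F) x, spaceDeriv s (basisVec k) N x⟫) := by
  have hD := hp.domain
  rw [dirDeriv_congr (fun y hy => hp.trace y hy) hx,
    dirDeriv_sum hD (fun k _ => hp.smooth_A k k) hx, Finset.sum_sub_distrib,
    ← hp.sum_sum_inner_weingarten hx hon, ← Finset.sum_sub_distrib]
  refine Finset.sum_congr rfl fun k _ => ?_
  rw [hp.dirDeriv_weingarten v k hx, sum_inner]
  simp only [inner_add_left, inner_smul_left, hon, Finset.sum_add_distrib]
  simp [EuclideanSpace.inner_single_left]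

/-- The second derivative of the mean curvature at the centre of normal coordinates. -/
theorem dirDeriv_dirDeriv_meanCurv (v : SpaceTime n) (hx : x ∈ s)
    (hon : ∀ a b, ⟪spaceDeriv s a F x, spaceDeriv s b F x⟫ = ⟪a, b⟫)
    (hnormal : ∀ k l, ⟪dirDeriv s v (spaceDeriv s (basisVec l) F) x,
      spaceDeriv s (basisVec k) F x⟫ = 0) :
    dirDeriv s v (dirDeriv s v H) x
      = ∑ k, (⟪dirDeriv s v (dirDeriv s v (spaceDeriv s (basisVec k) N)) x,
            spaceDeriv s (basisVec k) F x⟫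
        - ⟪dirDeriv s v (dirDeriv s v (spaceDeriv s (basisVec k) F)) x,
            spaceDeriv s (basisVec k) N x⟫) := by
  have hD := hp.domain
  have sA := fun k l => ContDiffOn.dirDeriv hD (hp.smooth_A k l) v
  have h1 : EqOn (dirDeriv s v H) (fun y => ∑ k, dirDeriv s v (A k k) y) s := fun y hy => by
    rw [dirDeriv_congr (fun y hy => hp.trace y hy) hy,
      dirDeriv_sum hD (fun k _ => hp.smooth_A k k) hy]
  rw [dirDeriv_congr h1 hx, dirDeriv_sum hD (fun k _ => sA k k) hx, Finset.sum_sub_distrib,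
    ← hp.sum_sum_inner_weingarten hx hon, ← Finset.sum_sub_distrib]
  refine Finset.sum_congr rfl fun k _ => ?_
  rw [dirDeriv_congr (fun y hy => hp.dirDeriv_weingarten v k hy) hx,
    dirDeriv_sum (F := fun l y => A k l y • dirDeriv s v (spaceDeriv s (basisVec l) F) y
        + dirDeriv s v (A k l) y • spaceDeriv s (basisVec l) F y) hD
      (fun l _ => ((hp.smooth_A k l).smul (hp.smooth_ddF _ _)).add
        ((sA k l).smul (hp.smooth_dF _))) hx,
    sum_inner]
  have h2 : ∀ l, ⟪dirDeriv s v (fun y => A k l y • dirDeriv s v (spaceDeriv s (basisVec l) F) y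
        + dirDeriv s v (A k l) y • spaceDeriv s (basisVec l) F y) x,
          spaceDeriv s (basisVec k) F x⟫
      = A k l x * ⟪dirDeriv s v (dirDeriv s v (spaceDeriv s (basisVec l) F)) x,
          spaceDeriv s (basisVec k) F x⟫
        + dirDeriv s v (dirDeriv s v (A k l)) x * ⟪basisVec l, basisVec k⟫ := fun l => by
    rw [dirDeriv_add hD (contDiffOn_smul (hp.smooth_A k l) (hp.smooth_ddF _ _))
      (contDiffOn_smul (sA k l) (hp.smooth_dF _)) hx,
      dirDeriv_smul hD (hp.smooth_A k l) (hp.smooth_ddF _ _) hx, dirDeriv_smul hD (sA k l)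
        (hp.smooth_dF _) hx]
    simp only [inner_add_left, inner_smul_left, hon, hnormal]
    simp
  simp only [h2, Finset.sum_add_distrib]
  simp [EuclideanSpace.inner_single_left]

/-- A null vector `v` of the nonnegative form `h - c g` is an eigenvector of the Weingarten map: the
tangential vector `N_v - c F_v` is orthogonal to the coordinate frame. -/
theorem null_direction {c : ℝ} {v : EuclideanSpace ℝ (Fin n)} (hx : x ∈ s)
    (hpos : ∀ w, 0 ≤ ⟪spaceDeriv s w N x - c • spaceDeriv s w F x, spaceDeriv s w F x⟫)
    (hv : ⟪spaceDeriv s v N x - c • spaceDeriv s v F x, spaceDeriv s v F x⟫ = 0) :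
    spaceDeriv s v N x = c • spaceDeriv s v F x := by
  have horth : ∀ w, ⟪spaceDeriv s v N x - c • spaceDeriv s v F x, spaceDeriv s w F x⟫ = 0 := by
    intro w
    set b := ⟪spaceDeriv s v N x - c • spaceDeriv s v F x, spaceDeriv s w F x⟫ with hb
    set d := ⟪spaceDeriv s w N x - c • spaceDeriv s w F x, spaceDeriv s w F x⟫ with hd
    have hsymm : ⟪spaceDeriv s w N x - c • spaceDeriv s w F x, spaceDeriv s v F x⟫ = b := by
      rw [hb, inner_sub_left, inner_sub_left, hp.secondForm_symm w v hx, inner_smul_left,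
        inner_smul_left, real_inner_comm (spaceDeriv s w F x) (spaceDeriv s v F x)]
    -- the quadratic polynomial `t ↦ 2 t b + t ^ 2 d` is nonnegative
    have key : ∀ t : ℝ, 0 ≤ 2 * t * b + t ^ 2 * d := by
      intro t
      have h := hpos (v + t • w)
      have e : spaceDeriv s (v + t • w) N x - c • spaceDeriv s (v + t • w) F x
          = (spaceDeriv s v N x - c • spaceDeriv s v F x)
            + t • (spaceDeriv s w N x - c • spaceDeriv s w F x) := by
        rw [spaceDeriv_add_dir, spaceDeriv_add_dir, spaceDeriv_smul_dir, spaceDeriv_smul_dir]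
        module
      rw [e, spaceDeriv_add_dir, spaceDeriv_smul_dir, inner_add_left, inner_add_right,
        inner_add_right, hv, inner_smul_left, inner_smul_left, inner_smul_right, inner_smul_right,
        ← hb, ← hd, hsymm] at h
      simp only [conj_trivial] at h
      linarith
    have hdn : 0 ≤ d := hpos w
    by_contra hb0
    have h := key (-b / (d + 1))
    have hd1 : 0 < d + 1 := by linarith
    have e : 2 * (-b / (d + 1)) * b + (-b / (d + 1)) ^ 2 * d
        = -(b ^ 2 * (d + 2)) / (d + 1) ^ 2 := by field_simp; ring
    rw [e] at h
    have : 0 < b ^ 2 * (d + 2) / (d + 1) ^ 2 := by positivity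
    rw [neg_div] at h
    linarith
  -- the vector is tangential, being a combination of the coordinate frame
  have htan : spaceDeriv s v N x - c • spaceDeriv s v F x
      = ∑ k, v k • ∑ l, A k l x • spaceDeriv s (basisVec l) F x - c • spaceDeriv s v F x := by
    rw [spaceDeriv_eq_sum v N]
    simp only [hp.weingarten _ x hx]
  rw [← sub_eq_zero, ← inner_self_eq_zero (𝕜 := ℝ)]
  nth_rewrite 2 [htan]
  simp only [inner_sub_right, inner_sum, inner_smul_right, horth]
  simp

end FlowPatch

end Patch

/-! ### The pinching form and its first null vector -/

section Pinch

variable {n : ℕ}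

/-- The time factor `ε e^{-K t}` of the barrier. -/
noncomputable def barrierRate (ε K : ℝ) (x : SpaceTime n) : ℝ := ε * Real.exp (-K * x.1)

/-- The barrier `ε e^{-K t} (1 + ⟪F, Eₙ₊₁⟫)` for the smallest principal curvature. The height
`⟪F, Eₙ₊₁⟫` makes it strictly increasing in the inward conormal direction at the boundary. -/
noncomputable def barrier (ε K : ℝ) (F : SpaceTime n → Ambient n) (x : SpaceTime n) : ℝ :=
  barrierRate ε K x * (1 + ⟪F x, vertical n⟫)

/-- The pinching form `h - L g` of the second fundamental form against a multiple of the metric. -/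
noncomputable def pinchForm (s : Set (SpaceTime n)) (F N : SpaceTime n → Ambient n)
    (L : SpaceTime n → ℝ) (a b : EuclideanSpace ℝ (Fin n)) (x : SpaceTime n) : ℝ :=
  ⟪spaceDeriv s a N x - L x • spaceDeriv s a F x, spaceDeriv s b F x⟫

variable {α θ : ℝ} {s : Set (SpaceTime n)} {F N : SpaceTime n → Ambient n}
  {A : Fin n → Fin n → SpaceTime n → ℝ} {H q : SpaceTime n → ℝ} {x : SpaceTime n}
  {ε K : ℝ}

theorem contDiff_barrierRate : ContDiff ℝ ∞ (barrierRate ε K : SpaceTime n → ℝ) := by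
  unfold barrierRate
  fun_prop

theorem dirDeriv_barrierRate (hs : IsCalculusDomain s) (v : SpaceTime n) (hx : x ∈ s) :
    dirDeriv s v (barrierRate ε K) x = -K * v.1 * barrierRate ε K x := by
  have h1 : HasFDerivAt (fun y : SpaceTime n => -K * y.1)
      ((-K) • ContinuousLinearMap.fst ℝ ℝ (EuclideanSpace ℝ (Fin n))) x := by
    exact (hasFDerivAt_fst (𝕜 := ℝ) (p := x)).const_mul (-K)
  have h2 := (h1.exp.const_mul ε).hasFDerivWithinAt (s := s)
  unfold dirDeriv
  have h3 : fderivWithin ℝ (barrierRate ε K) s x = _ := h2.fderivWithin (hs.uniqueDiffOn x hx)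
  rw [h3]
  simp [barrierRate]
  ring

namespace FlowPatch

variable (hp : FlowPatch α θ s F N A H q)
include hp

theorem smooth_height : ContDiffOn ℝ ∞ (fun y => 1 + ⟪F y, vertical n⟫) s :=
  contDiffOn_const.add (hp.smooth_F.inner ℝ contDiffOn_const)

theorem smooth_barrier : ContDiffOn ℝ ∞ (barrier ε K F) s :=
  contDiff_barrierRate.contDiffOn.mul hp.smooth_height

theorem dirDeriv_inner_const {G : SpaceTime n → Ambient n} (hG : ContDiffOn ℝ ∞ G s)
    (c : Ambient n) (v : SpaceTime n) (hx : x ∈ s) :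
    dirDeriv s v (fun y => ⟪G y, c⟫) x = ⟪dirDeriv s v G x, c⟫ := by
  rw [dirDeriv_inner hp.domain hG contDiffOn_const hx, dirDeriv_const, inner_zero_right, add_zero]

theorem dirDeriv_barrier (v : SpaceTime n) (hx : x ∈ s) :
    dirDeriv s v (barrier ε K F) x
      = barrierRate ε K x * ⟪dirDeriv s v F x, vertical n⟫ - K * v.1 * barrier ε K F x := by
  have hD := hp.domain
  have h : dirDeriv s v (barrier ε K F) x = _ :=
    dirDeriv_mul hD contDiff_barrierRate.contDiffOn hp.smooth_height hx
  rw [h, dirDeriv_add hD contDiffOn_const (hp.smooth_F.inner ℝ contDiffOn_const) hx,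
    dirDeriv_const, hp.dirDeriv_inner_const hp.smooth_F _ _ hx, dirDeriv_barrierRate hD v hx]
  unfold barrier
  ring

theorem spaceDeriv_barrier (b : EuclideanSpace ℝ (Fin n)) (hx : x ∈ s) :
    spaceDeriv s b (barrier ε K F) x
      = barrierRate ε K x * ⟪spaceDeriv s b F x, vertical n⟫ := by
  rw [spaceDeriv, hp.dirDeriv_barrier _ hx]
  simp

theorem spaceDeriv_spaceDeriv_barrier (b : EuclideanSpace ℝ (Fin n)) (hx : x ∈ s) :
    spaceDeriv s b (spaceDeriv s b (barrier ε K F)) x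
      = barrierRate ε K x * ⟪spaceDeriv s b (spaceDeriv s b F) x, vertical n⟫ := by
  have hD := hp.domain
  have h : spaceDeriv s b (spaceDeriv s b (barrier ε K F)) x
      = dirDeriv s (0, b) (fun y => barrierRate ε K y * ⟪spaceDeriv s b F y, vertical n⟫) x :=
    dirDeriv_congr (fun y hy => hp.spaceDeriv_barrier b hy) hx
  rw [h, dirDeriv_mul hD contDiff_barrierRate.contDiffOn
    ((hp.smooth_dF _).inner ℝ contDiffOn_const) hx,
    hp.dirDeriv_inner_const (hp.smooth_dF _) _ _ hx, dirDeriv_barrierRate hD _ hx]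
  simp

variable {L : SpaceTime n → ℝ} (hL : ContDiffOn ℝ ∞ L s) {v : EuclideanSpace ℝ (Fin n)}
include hL

theorem smooth_pinchVec (v : EuclideanSpace ℝ (Fin n)) :
    ContDiffOn ℝ ∞ (fun y => spaceDeriv s v N y - L y • spaceDeriv s v F y) s :=
  (hp.smooth_dN _).sub (hL.smul (hp.smooth_dF _))

theorem smooth_pinchForm (v w : EuclideanSpace ℝ (Fin n)) :
    ContDiffOn ℝ ∞ (pinchForm s F N L v w) s :=
  (hp.smooth_pinchVec hL v).inner ℝ (hp.smooth_dF _)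

theorem dirDeriv_pinchVec (u : SpaceTime n) (v : EuclideanSpace ℝ (Fin n)) (hx : x ∈ s) :
    dirDeriv s u (fun y => spaceDeriv s v N y - L y • spaceDeriv s v F y) x
      = dirDeriv s u (spaceDeriv s v N) x
        - (L x • dirDeriv s u (spaceDeriv s v F) x + dirDeriv s u L x • spaceDeriv s v F x) := by
  have hD := hp.domain
  rw [dirDeriv_sub hD (hp.smooth_dN _) (contDiffOn_smul hL (hp.smooth_dF _)) hx, dirDeriv_smul hD
    hL (hp.smooth_dF _) hx]

theorem dirDeriv_pinchForm (u : SpaceTime n) (w : EuclideanSpace ℝ (Fin n)) (hx : x ∈ s)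
    (hnull : spaceDeriv s v N x = L x • spaceDeriv s v F x) :
    dirDeriv s u (pinchForm s F N L v w) x
      = ⟪dirDeriv s u (spaceDeriv s v N) x, spaceDeriv s w F x⟫
        - L x * ⟪dirDeriv s u (spaceDeriv s v F) x, spaceDeriv s w F x⟫
        - dirDeriv s u L x * ⟪spaceDeriv s v F x, spaceDeriv s w F x⟫ := by
  have hD := hp.domain
  have h : dirDeriv s u (pinchForm s F N L v w) x = _ :=
    dirDeriv_inner hD (hp.smooth_pinchVec hL v) (hp.smooth_dF (0, w)) hx
  rw [h, hp.dirDeriv_pinchVec hL u v hx, hnull, sub_self, inner_zero_left, add_zero,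
    inner_sub_left, inner_add_left, inner_smul_left, inner_smul_left]
  simp only [conj_trivial]
  ring

/-- The second derivative of the pinching form on a null vector, at the centre of normal
coordinates. -/
theorem spaceDeriv_spaceDeriv_pinchForm (e : EuclideanSpace ℝ (Fin n)) (hx : x ∈ s)
    (hnull : spaceDeriv s v N x = L x • spaceDeriv s v F x)
    (hunit : ⟪spaceDeriv s v F x, spaceDeriv s v F x⟫ = 1)
    (hnormal : ∀ a b, spaceDeriv s a (spaceDeriv s b F) x
      = -⟪spaceDeriv s a N x, spaceDeriv s b F x⟫ • N x) :
    spaceDeriv s e (spaceDeriv s e (pinchForm s F N L v v)) x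
      = ⟪spaceDeriv s e (spaceDeriv s e (spaceDeriv s v N)) x, spaceDeriv s v F x⟫
        - ⟪spaceDeriv s e (spaceDeriv s e (spaceDeriv s v F)) x, spaceDeriv s v N x⟫
        - spaceDeriv s e (spaceDeriv s e L) x := by
  have hD := hp.domain
  set Y : SpaceTime n → Ambient n := fun y => spaceDeriv s v N y - L y • spaceDeriv s v F y with hY
  have sY : ContDiffOn ℝ ∞ Y s := hp.smooth_pinchVec hL v
  have sY1 : ∀ u, ContDiffOn ℝ ∞ (dirDeriv s u Y) s := fun u => ContDiffOn.dirDeriv hD sY u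
  have sL1 := ContDiffOn.dirDeriv hD hL (0, e)
  have hY0 : Y x = 0 := by simp only [hY, hnull, sub_self]
  have h1 : EqOn (spaceDeriv s e (pinchForm s F N L v v))
      (fun y => ⟪spaceDeriv s e Y y, spaceDeriv s v F y⟫
        + ⟪Y y, spaceDeriv s e (spaceDeriv s v F) y⟫) s :=
    fun y hy => dirDeriv_inner hD sY (hp.smooth_dF _) hy
  have h2 : spaceDeriv s e (spaceDeriv s e (pinchForm s F N L v v)) x = _ := dirDeriv_congr h1 hx
  rw [h2, dirDeriv_add hD ((sY1 _).inner ℝ (hp.smooth_dF _)) (sY.inner ℝ (hp.smooth_ddF _ _)) hx,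
    dirDeriv_inner hD (sY1 _) (hp.smooth_dF _) hx, dirDeriv_inner hD sY (hp.smooth_ddF _ _) hx, hY0,
    inner_zero_left, add_zero]
  have hYe : EqOn (spaceDeriv s e Y) (fun y => spaceDeriv s e (spaceDeriv s v N) y
      - (L y • spaceDeriv s e (spaceDeriv s v F) y + spaceDeriv s e L y • spaceDeriv s v F y)) s :=
    fun y hy => hp.dirDeriv_pinchVec hL _ v hy
  -- the first derivative of the vector `N_v - L F_v` is tangential
  have hYN : ⟪spaceDeriv s e Y x, N x⟫ = 0 := by
    have e1 : ⟪spaceDeriv s e (spaceDeriv s v N) x, N x⟫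
        = -⟪spaceDeriv s v N x, spaceDeriv s e N x⟫ := by
      have h : dirDeriv s (0, e) (fun y => ⟪spaceDeriv s v N y, N y⟫) x
          = dirDeriv s (0, e) (fun _ => (0 : ℝ)) x :=
        dirDeriv_congr (fun y hy => hp.inner_dirDeriv_unit _ hy) hx
      rw [dirDeriv_inner hD (hp.smooth_dN _) hp.smooth_N hx, dirDeriv_const] at h
      linarith
    rw [hYe hx]
    simp only [inner_sub_left, inner_add_left, inner_smul_left, conj_trivial, e1, hp.normal v x hx,
      hnormal e v, hp.unit x hx, hnull]
    rw [real_inner_comm (spaceDeriv s e N x)]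
    ring
  have hYFF : ⟪spaceDeriv s e Y x, spaceDeriv s e (spaceDeriv s v F) x⟫ = 0 := by
    rw [hnormal e v, inner_smul_right, hYN, mul_zero]
  have hFvF : ⟪spaceDeriv s e (spaceDeriv s v F) x, spaceDeriv s v F x⟫ = 0 := by
    have := hp.normal v x hx
    rw [real_inner_comm] at this
    rw [hnormal e v, inner_smul_left, this, mul_zero]
  have hYee : dirDeriv s (0, e) (spaceDeriv s e Y) x
      = spaceDeriv s e (spaceDeriv s e (spaceDeriv s v N)) x
        - ((L x • spaceDeriv s e (spaceDeriv s e (spaceDeriv s v F)) x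
            + spaceDeriv s e L x • spaceDeriv s e (spaceDeriv s v F) x)
          + (spaceDeriv s e L x • spaceDeriv s e (spaceDeriv s v F) x
            + spaceDeriv s e (spaceDeriv s e L) x • spaceDeriv s v F x)) := by
    rw [dirDeriv_congr hYe hx, dirDeriv_sub hD (hp.smooth_ddN _ _)
      ((contDiffOn_smul hL (hp.smooth_ddF _ _)).add (contDiffOn_smul sL1 (hp.smooth_dF _))) hx,
      dirDeriv_add hD (contDiffOn_smul hL (hp.smooth_ddF _ _))
        (contDiffOn_smul sL1 (hp.smooth_dF _)) hx,
      dirDeriv_smul hD hL (hp.smooth_ddF _ _) hx, dirDeriv_smul hD sL1 (hp.smooth_dF _) hx]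
  rw [hYFF, hYee]
  simp only [inner_sub_left, inner_add_left, inner_smul_left, conj_trivial, hFvF, hunit, hnull,
    inner_smul_right]
  ring

/-- The second derivative test along a rotating vector: if the pinching form is nonnegative on the
line through `x` in the direction of the `k`-th coordinate, it is tested on the vectors
`v - τ y eₖ`, where `y` is the `k`-th coordinate centred at `x`. -/
theorem second_derivative_test (hs : IsOpen s) (k : Fin n) (τ : ℝ) (hx : x ∈ s)
    (hnull : spaceDeriv s v N x = L x • spaceDeriv s v F x)
    (hpos : ∀ y ∈ s, y.1 = x.1 → ∀ w, 0 ≤ pinchForm s F N L w w y) :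
    0 ≤ spaceDeriv s (basisVec k) (spaceDeriv s (basisVec k) (pinchForm s F N L v v)) x
      - 4 * τ * spaceDeriv s (basisVec k) (pinchForm s F N L v (basisVec k)) x
      + 2 * τ ^ 2 * pinchForm s F N L (basisVec k) (basisVec k) x := by
  have hD := hp.domain
  set e : EuclideanSpace ℝ (Fin n) := basisVec k with he
  set ℓ : SpaceTime n → ℝ := fun y => y.2 k - x.2 k with hℓ
  have sℓ : ContDiffOn ℝ ∞ ℓ s := by
    have : ContDiff ℝ ∞ ℓ := by simp only [hℓ]; fun_prop
    exact this.contDiffOn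
  have dℓ : ∀ y ∈ s, spaceDeriv s e ℓ y = 1 := by
    intro y hy
    have h1 : HasFDerivAt ℓ ((EuclideanSpace.proj k : EuclideanSpace ℝ (Fin n) →L[ℝ] ℝ).comp
        (ContinuousLinearMap.snd ℝ ℝ (EuclideanSpace ℝ (Fin n)))) y :=
      (ContinuousLinearMap.hasFDerivAt ((EuclideanSpace.proj k :
        EuclideanSpace ℝ (Fin n) →L[ℝ] ℝ).comp
          (ContinuousLinearMap.snd ℝ ℝ (EuclideanSpace ℝ (Fin n))))).sub_const (x.2 k)
    rw [spaceDeriv, dirDeriv, h1.hasFDerivWithinAt.fderivWithin (hD.uniqueDiffOn y hy)]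
    simp [he]
  have ℓ0 : ℓ x = 0 := by simp [hℓ]
  have dmul : ∀ g : SpaceTime n → ℝ, ContDiffOn ℝ ∞ g s → ∀ y ∈ s,
      spaceDeriv s e (fun y => ℓ y * g y) y = ℓ y * spaceDeriv s e g y + g y := by
    intro g hg y hy
    rw [spaceDeriv, dirDeriv_mul hD sℓ hg hy, ← spaceDeriv, ← spaceDeriv, dℓ y hy, one_mul]
  have ddmul : ∀ g : SpaceTime n → ℝ, ContDiffOn ℝ ∞ g s →
      spaceDeriv s e (spaceDeriv s e (fun y => ℓ y * g y)) x = 2 * spaceDeriv s e g x := by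
    intro g hg
    have sg := ContDiffOn.dirDeriv hD hg (0, e)
    have h : spaceDeriv s e (spaceDeriv s e (fun y => ℓ y * g y)) x
        = dirDeriv s (0, e) (fun y => ℓ y * spaceDeriv s e g y + g y) x :=
      dirDeriv_congr (fun y hy => dmul g hg y hy) hx
    rw [h, dirDeriv_add hD (sℓ.mul sg) hg hx, ← spaceDeriv, dmul _ sg x hx, ℓ0]
    ring
  have s1 := hp.smooth_pinchForm hL v v
  have s2 := hp.smooth_pinchForm hL v e
  have s3 := hp.smooth_pinchForm hL e e
  set g : SpaceTime n → ℝ := fun y => (-2 * τ) * pinchForm s F N L v e y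
    + τ ^ 2 * (ℓ y * pinchForm s F N L e e y) with hg
  have sg : ContDiffOn ℝ ∞ g s :=
    (contDiffOn_const.mul s2).add (contDiffOn_const.mul (sℓ.mul s3))
  have dg : spaceDeriv s e g x = -2 * τ * spaceDeriv s e (pinchForm s F N L v e) x
      + τ ^ 2 * pinchForm s F N L e e x := by
    rw [spaceDeriv, hg, dirDeriv_add hD (contDiffOn_const.mul s2)
      (contDiffOn_const.mul (sℓ.mul s3)) hx, dirDeriv_mul hD contDiffOn_const s2 hx,
      dirDeriv_mul hD contDiffOn_const (sℓ.mul s3) hx, dirDeriv_const, dirDeriv_const,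
      ← spaceDeriv, ← spaceDeriv, dmul _ s3 x hx, ℓ0]
    ring
  set Z : SpaceTime n → ℝ := fun y => pinchForm s F N L v v y + ℓ y * g y with hZ
  have sZ : ContDiffOn ℝ ∞ Z s := s1.add (sℓ.mul sg)
  have ddZ : spaceDeriv s e (spaceDeriv s e Z) x
      = spaceDeriv s e (spaceDeriv s e (pinchForm s F N L v v)) x + 2 * spaceDeriv s e g x := by
    have h : spaceDeriv s e (spaceDeriv s e Z) x = dirDeriv s (0, e)
        (fun y => spaceDeriv s e (pinchForm s F N L v v) y
          + spaceDeriv s e (fun y => ℓ y * g y) y) x :=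
      dirDeriv_congr (fun y hy => dirDeriv_add hD s1 (sℓ.mul sg) hy) hx
    rw [h, dirDeriv_add hD (ContDiffOn.dirDeriv hD s1 _)
      (ContDiffOn.dirDeriv hD (sℓ.mul sg) _) hx, ← ddmul g sg]
  have hZeq : ∀ y ∈ s, Z y = pinchForm s F N L (v - (τ * ℓ y) • e) (v - (τ * ℓ y) • e) y := by
    intro y hy
    have hsymm := hp.secondForm_symm e v hy
    have hc := real_inner_comm (spaceDeriv s e F y) (spaceDeriv s v F y)
    have e1 : ∀ G : SpaceTime n → Ambient n, spaceDeriv s (v - (τ * ℓ y) • e) G y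
        = spaceDeriv s v G y - (τ * ℓ y) • spaceDeriv s e G y := fun G => by
      rw [sub_eq_add_neg, ← neg_smul, spaceDeriv_add_dir, spaceDeriv_smul_dir, neg_smul,
        sub_eq_add_neg]
    simp only [hZ, hg, pinchForm, e1, inner_sub_left, inner_sub_right, inner_smul_left,
      inner_smul_right, conj_trivial, hsymm, hc]
    ring
  have hZ0 : Z x = 0 := by
    simp only [hZ, ℓ0, pinchForm, hnull, sub_self, inner_zero_left, zero_mul, add_zero]
  have hcont : Continuous fun η : ℝ => x + η • ((0 : ℝ), e) := by fun_prop
  have hev : ∀ᶠ η in 𝓝 (0 : ℝ), x + η • ((0 : ℝ), e) ∈ s :=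
    hcont.continuousAt.eventually_mem (hs.mem_nhds (by simpa using hx))
  have := dirDeriv_dirDeriv_nonneg_of_isOpen (v := ((0 : ℝ), e)) hs sZ hx
    (hev.mono fun η hη => by
      rw [hZeq _ hη]
      exact hpos _ hη (by simp) _) hZ0
  rw [← spaceDeriv, ← spaceDeriv, ddZ, dg] at this
  linarith

/-- The time derivative of the pinching form on a null vector. -/
theorem timeDeriv_pinchForm (hx : x ∈ s)
    (hnull : spaceDeriv s v N x = L x • spaceDeriv s v F x)
    (hunit : ⟪spaceDeriv s v F x, spaceDeriv s v F x⟫ = 1)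
    (hnormal : spaceDeriv s v (spaceDeriv s v F) x
      = -⟪spaceDeriv s v N x, spaceDeriv s v F x⟫ • N x) :
    timeDeriv s (pinchForm s F N L v v) x
      = (1 - Real.cos θ * ⟪N x, vertical n⟫) * spaceDeriv s v (spaceDeriv s v q) x
        + q x * L x ^ 2
        - 2 * L x * Real.cos θ * spaceDeriv s v q x * ⟪spaceDeriv s v F x, vertical n⟫
        - timeDeriv s L x := by
  have hD := hp.domain
  set Wt : SpaceTime n → Ambient n := fun y => N y - Real.cos θ • vertical n with hWt
  have sW : ContDiffOn ℝ ∞ Wt s := hp.smooth_N.sub contDiffOn_const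
  have dW : ∀ y ∈ s, ∀ u, dirDeriv s u Wt y = dirDeriv s u N y := fun y hy u => by
    rw [hWt, dirDeriv_sub hD hp.smooth_N contDiffOn_const hy, dirDeriv_const, sub_zero]
  have sq1 := ContDiffOn.dirDeriv hD hp.smooth_q (0, v)
  have hFt1 : ∀ y ∈ s, spaceDeriv s v (timeDeriv s F) y
      = -(q y • spaceDeriv s v N y + spaceDeriv s v q y • Wt y) := fun y hy => by
    rw [spaceDeriv, dirDeriv_congr (fun y hy => hp.evolution y hy) hy, dirDeriv_neg hD hy,
      dirDeriv_smul hD hp.smooth_q sW hy, dW y hy]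
  have hFt2 : spaceDeriv s v (spaceDeriv s v (timeDeriv s F)) x
      = -((q x • spaceDeriv s v (spaceDeriv s v N) x + spaceDeriv s v q x • spaceDeriv s v N x)
        + (spaceDeriv s v q x • spaceDeriv s v N x
          + spaceDeriv s v (spaceDeriv s v q) x • Wt x)) := by
    have h : spaceDeriv s v (spaceDeriv s v (timeDeriv s F)) x
        = dirDeriv s (0, v) (fun y => -(q y • spaceDeriv s v N y + spaceDeriv s v q y • Wt y)) x :=
      dirDeriv_congr (fun y hy => hFt1 y hy) hx
    rw [h, dirDeriv_neg hD hx, dirDeriv_add hD (contDiffOn_smul hp.smooth_q (hp.smooth_dN _))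
      (contDiffOn_smul sq1 sW) hx,
      dirDeriv_smul hD hp.smooth_q (hp.smooth_dN _) hx, dirDeriv_smul hD sq1 sW hx, dW x hx]
  have c1 : timeDeriv s (spaceDeriv s v F) x = spaceDeriv s v (timeDeriv s F) x :=
    dirDeriv_comm hD hp.smooth_F _ _ hx
  have c2 : timeDeriv s (spaceDeriv s v (spaceDeriv s v F)) x
      = spaceDeriv s v (spaceDeriv s v (timeDeriv s F)) x := by
    rw [timeDeriv, dirDeriv_comm hD (hp.smooth_dF _) _ _ hx]
    exact dirDeriv_congr (fun y hy => dirDeriv_comm hD hp.smooth_F _ _ hy) hx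
  have hT : ⟪timeDeriv s (spaceDeriv s v N) x, spaceDeriv s v F x⟫
      + ⟪spaceDeriv s v N x, timeDeriv s (spaceDeriv s v F) x⟫
      = -(⟪timeDeriv s N x, spaceDeriv s v (spaceDeriv s v F) x⟫
        + ⟪N x, timeDeriv s (spaceDeriv s v (spaceDeriv s v F)) x⟫) := by
    have h : timeDeriv s (fun y => ⟪spaceDeriv s v N y, spaceDeriv s v F y⟫) x
        = dirDeriv s (1, 0) (fun y => -⟪N y, spaceDeriv s v (spaceDeriv s v F) y⟫) x :=
      dirDeriv_congr (fun y hy => hp.inner_dirDeriv_normal _ v hy) hx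
    rwa [timeDeriv, dirDeriv_inner hD (hp.smooth_dN _) (hp.smooth_dF _) hx, dirDeriv_neg hD hx,
      dirDeriv_inner hD hp.smooth_N (hp.smooth_ddF _ _) hx] at h
  have hNt : ⟪timeDeriv s N x, spaceDeriv s v (spaceDeriv s v F) x⟫ = 0 := by
    rw [hnormal, inner_smul_right, hp.inner_dirDeriv_unit _ hx, mul_zero]
  have hNv : ⟪N x, spaceDeriv s v N x⟫ = 0 := by
    rw [real_inner_comm]; exact hp.inner_dirDeriv_unit _ hx
  have hNvv : ⟪N x, spaceDeriv s v (spaceDeriv s v N) x⟫ = -L x ^ 2 := by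
    have := hp.inner_dirDeriv_dirDeriv_unit (0, v) hx
    rw [real_inner_comm, this]
    change -⟪spaceDeriv s v N x, spaceDeriv s v N x⟫ = _
    rw [hnull, inner_smul_left, inner_smul_right, hunit]
    simp only [conj_trivial]
    ring
  have hNF : ⟪N x, spaceDeriv s v F x⟫ = 0 := by
    rw [real_inner_comm]; exact hp.normal v x hx
  have hN1 := hp.unit x hx
  have h0 : timeDeriv s (pinchForm s F N L v v) x = _ :=
    hp.dirDeriv_pinchForm hL _ v hx hnull
  rw [h0, hunit]
  rw [hNt, c2, c1, hFt2, hFt1 x hx, hnull] at hT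
  rw [show dirDeriv s (1, 0) (spaceDeriv s v F) x = _ from c1, hFt1 x hx, hnull]
  have hcm := real_inner_comm (spaceDeriv s v F x) (vertical n)
  have hcm2 := real_inner_comm (N x) (vertical n)
  simp only [hWt, inner_neg_left, inner_neg_right, inner_add_left, inner_add_right, inner_sub_left,
    inner_sub_right, inner_smul_left, inner_smul_right, conj_trivial, hunit, hNF, hN1, hNvv,
    hp.normal v x hx, hcm] at hT ⊢
  linear_combination hT

end FlowPatch

end Pinch

/-! ### No first null vector in the interior -/

section Interior

/-- The decay rate beyond which the barrier cannot be touched at an interior point, where `B` bounds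
the mean curvature `H`, the speed `H ^ α - φ` and the factor `α H ^ (α - 1)`. -/
noncomputable def criticalRate (θ B : ℝ) : ℝ :=
  2 * B ^ 2 * (1 + B) + 12 * B + 2 * B ^ 3 / (1 - Real.cos θ) + B ^ 2 + 2 * B

/-- The absorption estimate: all terms of the evolution inequality at a touching point are bounded
by a multiple of the barrier `L`, since the square `x ^ 2` of the gradient of the mean curvature
has a good sign. -/
theorem rate_le_of_evolution {α δ B u q L K c x l r H a₀ e w hvv : ℝ} (hα : 0 < α) (hδ : 0 < δ)
    (hδu : δ ≤ u) (hu2 : u ≤ 2) (hr : 0 < r) (hrL : r ≤ L) (hLH : L ≤ H) (hHB : H ≤ B)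
    (hqB : |q| ≤ B) (ha0 : 0 < a₀) (haB : a₀ ≤ B) (he : |e| ≤ 1) (hw : |w| ≤ 1) (hc : |c| ≤ 1)
    (hl : l = r * e) (hh : 2 * (x - l) ^ 2 / H - r * H - H * L ^ 2 ≤ hvv)
    (hev : u * (a₀ * (hvv + (α - 1) * x ^ 2 / H)) + q * L ^ 2 - 2 * L * c * (a₀ * x) * e
      - (r * (-(q * (w - c))) - K * L) ≤ 0) :
    K ≤ 2 * B ^ 2 * (1 + B) + 12 * B + 2 * B ^ 3 / δ + B ^ 2 + 2 * B := by
  have hL : 0 < L := hr.trans_le hrL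
  have hH : 0 < H := hL.trans_le hLH
  have hB : 0 < B := hH.trans_le hHB
  have hLB : L ≤ B := hLH.trans hHB
  have hu : 0 < u := hδ.trans_le hδu
  have hl2 : l ^ 2 ≤ L ^ 2 := by
    have h1 : |l| ≤ L := by
      rw [hl, abs_mul, abs_of_pos hr]
      nlinarith [abs_nonneg e]
    exact sq_le_sq' (by linarith [neg_abs_le l]) (by linarith [le_abs_self l])
  have hgrad : x ^ 2 / (2 * H) - 6 * L ≤ 2 * (x - l) ^ 2 / H + (α - 1) * x ^ 2 / H := by
    have h1 : x ^ 2 / 2 - 6 * L ^ 2 ≤ 2 * (x - l) ^ 2 + (α - 1) * x ^ 2 := by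
      nlinarith [sq_nonneg (x - 4 * l), mul_nonneg hα.le (sq_nonneg x)]
    have h2 : L ^ 2 / H ≤ L := by
      rw [div_le_iff₀ hH]; nlinarith
    have h3 := div_le_div_of_nonneg_right h1 hH.le
    have e1 : (x ^ 2 / 2 - 6 * L ^ 2) / H = x ^ 2 / (2 * H) - 6 * (L ^ 2 / H) := by
      field_simp
    rw [e1, add_div] at h3
    linarith
  have hmain : x ^ 2 / (2 * H) - 6 * L - r * H - H * L ^ 2 ≤ hvv + (α - 1) * x ^ 2 / H := by
    linarith
  have hrH : r * H + H * L ^ 2 ≤ (B + B ^ 2) * L := by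
    have e1 : r * H ≤ L * B := by gcongr
    have e2 : H * L ^ 2 ≤ B * B * L := by
      calc H * L ^ 2 = H * L * L := by ring
        _ ≤ B * B * L := by gcongr
    linarith
  have h1 : u * (a₀ * (x ^ 2 / (2 * H))) - 2 * (B * ((6 + B + B ^ 2) * L))
      ≤ u * (a₀ * (hvv + (α - 1) * x ^ 2 / H)) := by
    have e1 : a₀ * (x ^ 2 / (2 * H)) - B * ((6 + B + B ^ 2) * L)
        ≤ a₀ * (hvv + (α - 1) * x ^ 2 / H) := by
      have : a₀ * ((6 + B + B ^ 2) * L) ≤ B * ((6 + B + B ^ 2) * L) := by gcongr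
      have e2 := mul_le_mul_of_nonneg_left
        (show x ^ 2 / (2 * H) - (6 + B + B ^ 2) * L ≤ hvv + (α - 1) * x ^ 2 / H by linarith) ha0.le
      linarith
    have e3 := mul_le_mul_of_nonneg_left e1 hu.le
    have e4 : u * (B * ((6 + B + B ^ 2) * L)) ≤ 2 * (B * ((6 + B + B ^ 2) * L)) := by gcongr
    linarith
  -- the first order term from the motion along the surface is absorbed by the gradient square
  have h2 : 2 * L * c * (a₀ * x) * e ≤ u * (a₀ * (x ^ 2 / (2 * H))) + 2 * B ^ 3 / δ * L := by
    have hce : |c * e| ≤ 1 := by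
      rw [abs_mul]; nlinarith [abs_nonneg c, abs_nonneg e]
    have e1 : c * e * x ≤ |x| := by
      calc c * e * x ≤ |c * e * x| := le_abs_self _
        _ = |c * e| * |x| := abs_mul _ _
        _ ≤ |x| := by nlinarith [abs_nonneg x]
    have e2 : 2 * L * |x| ≤ δ * (x ^ 2 / (2 * H)) + 2 * L ^ 2 * H / δ := by
      have : δ * (x ^ 2 / (2 * H)) + 2 * L ^ 2 * H / δ - 2 * L * |x|
          = (δ * |x| - 2 * L * H) ^ 2 / (2 * H * δ) := by
        rw [← sq_abs x]; field_simp; ring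
      have h' : 0 ≤ (δ * |x| - 2 * L * H) ^ 2 / (2 * H * δ) := by positivity
      linarith
    have e3 : δ * (x ^ 2 / (2 * H)) ≤ u * (x ^ 2 / (2 * H)) := by gcongr
    have e4 : a₀ * (2 * L ^ 2 * H / δ) ≤ 2 * B ^ 3 / δ * L := by
      have : a₀ * (2 * L ^ 2 * H) ≤ 2 * B ^ 3 * L := by
        calc a₀ * (2 * L ^ 2 * H) = 2 * a₀ * H * L * L := by ring
          _ ≤ 2 * B * B * B * L := by gcongr
          _ = 2 * B ^ 3 * L := by ring
      calc a₀ * (2 * L ^ 2 * H / δ) = a₀ * (2 * L ^ 2 * H) / δ := by ring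
        _ ≤ 2 * B ^ 3 * L / δ := by gcongr
        _ = 2 * B ^ 3 / δ * L := by ring
    have e5 : 2 * L * (c * e * x) ≤ u * (x ^ 2 / (2 * H)) + 2 * L ^ 2 * H / δ := by
      have := mul_le_mul_of_nonneg_left e1 (show 0 ≤ 2 * L by positivity)
      linarith
    have e6 := mul_le_mul_of_nonneg_left e5 ha0.le
    have e7 : 2 * L * c * (a₀ * x) * e = a₀ * (2 * L * (c * e * x)) := by ring
    have e8 : u * (a₀ * (x ^ 2 / (2 * H))) = a₀ * (u * (x ^ 2 / (2 * H))) := by ring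
    rw [e7, e8]
    linarith
  have h3 : -(B ^ 2 * L) ≤ q * L ^ 2 := by
    have : |q * L ^ 2| ≤ B ^ 2 * L := by
      rw [abs_mul, abs_of_pos (by positivity : 0 < L ^ 2)]
      calc |q| * L ^ 2 = |q| * L * L := by ring
        _ ≤ B * B * L := by gcongr
        _ = B ^ 2 * L := by ring
    linarith [neg_abs_le (q * L ^ 2)]
  have h4 : -(2 * B * L) ≤ r * (q * (w - c)) := by
    have : |r * (q * (w - c))| ≤ 2 * B * L := by
      rw [abs_mul, abs_mul, abs_of_pos hr]
      have hwc : |w - c| ≤ 2 := (abs_sub _ _).trans (by linarith)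
      calc r * (|q| * |w - c|) ≤ L * (B * 2) := by gcongr
        _ = 2 * B * L := by ring
    linarith [neg_abs_le (r * (q * (w - c)))]
  have h5 : K * L ≤ (2 * B ^ 2 * (1 + B) + 12 * B + 2 * B ^ 3 / δ + B ^ 2 + 2 * B) * L := by
    linarith
  exact le_of_mul_le_mul_right h5 hL

variable {n : ℕ} {α θ : ℝ} {s : Set (SpaceTime n)} {F N : SpaceTime n → Ambient n}
  {A : Fin n → Fin n → SpaceTime n → ℝ} {H q : SpaceTime n → ℝ} {x : SpaceTime n}
  {ε K : ℝ}

theorem norm_vertical : ‖vertical n‖ = 1 := by simp [vertical]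

theorem abs_inner_vertical_le {y : Ambient n} (hy : ⟪y, y⟫ = 1) : |⟪y, vertical n⟫| ≤ 1 := by
  have h : ‖y‖ = 1 := by
    rw [real_inner_self_eq_norm_sq] at hy
    exact (pow_eq_one_iff_of_nonneg (norm_nonneg y) two_ne_zero).1 hy
  simpa [h, norm_vertical] using abs_real_inner_le_norm y (vertical n)

theorem dirDeriv_rpow (hs : IsCalculusDomain s) (hH : ContDiffOn ℝ ∞ H s) (hpos : 0 < H x) (p : ℝ)
    (v : SpaceTime n) (hx : x ∈ s) :
    dirDeriv s v (fun y => H y ^ p) x = p * H x ^ (p - 1) * dirDeriv s v H x := by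
  have h := (diffWithinAt hH hx).hasFDerivWithinAt.rpow_const (p := p) (Or.inl hpos.ne')
  unfold dirDeriv
  rw [h.fderivWithin (hs.uniqueDiffOn x hx)]
  simp

namespace FlowPatch

variable (hp : FlowPatch α θ s F N A H q)
include hp

theorem spaceDeriv_spaceDeriv_speed (v : EuclideanSpace ℝ (Fin n)) (hx : x ∈ s) :
    spaceDeriv s v (spaceDeriv s v q) x
      = α * H x ^ (α - 1) * (spaceDeriv s v (spaceDeriv s v H) x
        + (α - 1) * spaceDeriv s v H x ^ 2 / H x) := by
  have hD := hp.domain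
  have hH := hp.H_pos x hx
  have sp : ContDiffOn ℝ ∞ (fun y => H y ^ (α - 1)) s :=
    hp.smooth_H.rpow_const_of_ne fun y hy => (hp.H_pos y hy).ne'
  have sH := ContDiffOn.dirDeriv hD hp.smooth_H (0, v)
  have h : spaceDeriv s v (spaceDeriv s v q) x
      = dirDeriv s (0, v) (fun y => α * H y ^ (α - 1) * spaceDeriv s v H y) x :=
    dirDeriv_congr (fun y hy => hp.space_q v y hy) hx
  rw [h, dirDeriv_mul hD (contDiffOn_const.mul sp) sH hx, dirDeriv_mul hD contDiffOn_const sp hx,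
    dirDeriv_const, dirDeriv_rpow hD hp.smooth_H hH _ _ hx, Real.rpow_sub_one hH.ne' (α - 1)]
  simp only [spaceDeriv]
  field_simp
  ring

theorem sum_inner_weingarten (hx : x ∈ s)
    (hon : ∀ a b, ⟪spaceDeriv s a F x, spaceDeriv s b F x⟫ = ⟪a, b⟫) :
    ∑ k, ⟪spaceDeriv s (basisVec k) N x, spaceDeriv s (basisVec k) F x⟫ = H x := by
  rw [hp.trace x hx]
  exact Finset.sum_congr rfl fun k _ => (hp.weingarten_eq_inner hx hon k k).symm

/-- The lower bound for the second derivative of the mean curvature in a null direction `v` of the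
pinching form. Simons' identity turns it into the Laplacian of the form, for which the second
derivative test along `v - τ y`, with the optimal `τ`, yields the gradient square. -/
theorem spaceDeriv_spaceDeriv_meanCurv_ge [NeZero n] (hs : IsOpen s) (hx : x ∈ s) (hε : 0 < ε)
    (hon : ∀ a b, ⟪spaceDeriv s a F x, spaceDeriv s b F x⟫ = ⟪a, b⟫)
    (hnormal : ∀ a b, spaceDeriv s a (spaceDeriv s b F) x
      = -⟪spaceDeriv s a N x, spaceDeriv s b F x⟫ • N x)
    {v : EuclideanSpace ℝ (Fin n)} (hv : ⟪v, v⟫ = 1) (hL0 : 0 ≤ barrier ε K F x)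
    (hnull : spaceDeriv s v N x = barrier ε K F x • spaceDeriv s v F x)
    (hpos : ∀ y ∈ s, y.1 ≤ x.1 → ∀ w, 0 ≤ pinchForm s F N (barrier ε K F) w w y) :
    2 * (spaceDeriv s v H x - spaceDeriv s v (barrier ε K F) x) ^ 2 / H x
        - barrierRate ε K x * H x - H x * barrier ε K F x ^ 2
      ≤ spaceDeriv s v (spaceDeriv s v H) x := by
  set L := barrier ε K F with hLdef
  have hL : ContDiffOn ℝ ∞ L s := hp.smooth_barrier
  have hD := hp.domain
  have hH := hp.H_pos x hx
  have hr : 0 < barrierRate ε K x := by unfold barrierRate; positivity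
  have hFN : ∀ b, ⟪N x, spaceDeriv s b F x⟫ = 0 := fun b => by
    rw [real_inner_comm]; exact hp.normal b x hx
  have hvv : ⟪spaceDeriv s v F x, spaceDeriv s v F x⟫ = 1 := by rw [hon, hv]
  set h : Fin n → ℝ := fun k => ⟪spaceDeriv s (basisVec k) N x, spaceDeriv s (basisVec k) F x⟫
    with hh
  have hsum : ∑ k, h k = H x := hp.sum_inner_weingarten hx hon
  set d : Fin n → ℝ := fun k =>
    spaceDeriv s (basisVec k) (spaceDeriv s (basisVec k) (pinchForm s F N L v v)) x with hd
  set g : Fin n → ℝ := fun k => spaceDeriv s (basisVec k) (pinchForm s F N L v (basisVec k)) x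
    with hg
  have hk1 : ∀ k : Fin n, ⟪(basisVec k : EuclideanSpace ℝ (Fin n)), basisVec k⟫ = (1 : ℝ) :=
    fun k => by simp
  have hpk : ∀ k, pinchForm s F N L (basisVec k) (basisVec k) x = h k - L x := fun k => by
    simp only [pinchForm, inner_sub_left, inner_smul_left, hon, hk1, hh]
    simp
  have htest : ∀ τ k, 0 ≤ d k - 4 * τ * g k + 2 * τ ^ 2 * (h k - L x) := fun τ k => by
    rw [← hpk]
    exact hp.second_derivative_test hL hs k τ hx hnull fun y hy hyx => hpos y hy hyx.le
  have hgsum : ∑ k, g k = spaceDeriv s v H x - spaceDeriv s v L x := by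
    have hHv : spaceDeriv s v H x = _ := hp.dirDeriv_meanCurv (0, v) hx hon
    have hLv : spaceDeriv s v L x = ∑ k, spaceDeriv s (basisVec k) L x * v k := by
      rw [spaceDeriv_eq_sum v L]
      exact Finset.sum_congr rfl fun k _ => by rw [smul_eq_mul, mul_comm]
    rw [hHv, hLv, ← Finset.sum_sub_distrib]
    refine Finset.sum_congr rfl fun k _ => ?_
    have h1 : g k = _ := hp.dirDeriv_pinchForm hL (0, basisVec k) (basisVec k) hx hnull
    have h2 : dirDeriv s (0, basisVec k) (spaceDeriv s v N) x
        = dirDeriv s (0, v) (spaceDeriv s (basisVec k) N) x :=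
      dirDeriv_comm hD hp.smooth_N _ _ hx
    have h3 : ⟪spaceDeriv s (basisVec k) (spaceDeriv s v F) x, spaceDeriv s (basisVec k) F x⟫
        = 0 := by
      rw [hnormal, inner_smul_left, hFN, mul_zero]
    have h4 : ⟪spaceDeriv s v (spaceDeriv s (basisVec k) F) x, spaceDeriv s (basisVec k) N x⟫
        = 0 := by
      rw [hnormal, inner_smul_left, real_inner_comm (spaceDeriv s (basisVec k) N x) (N x),
        hp.inner_dirDeriv_unit _ hx, mul_zero]
    rw [h1, h2, h3, h4, hon]
    simp [EuclideanSpace.inner_single_right]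
  have hsimons : spaceDeriv s v (spaceDeriv s v H) x
      = ∑ k, (d k - barrierRate ε K x * h k * ⟪N x, vertical n⟫
        + L x * ⟪spaceDeriv s (basisVec k) N x, spaceDeriv s (basisVec k) N x⟫
        - h k * L x ^ 2) := by
    have hHvv : spaceDeriv s v (spaceDeriv s v H) x = _ :=
      hp.dirDeriv_dirDeriv_meanCurv (0, v) hx hon fun k l => by
        rw [show dirDeriv s (0, v) (spaceDeriv s (basisVec l) F) x = _ from hnormal v _,
          inner_smul_left, hFN, mul_zero]
    rw [hHvv]
    refine Finset.sum_congr rfl fun k _ => ?_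
    have h1 := hp.simons_identity (basisVec k) v hx
    have h2 : d k = _ := hp.spaceDeriv_spaceDeriv_pinchForm hL (basisVec k) hx hnull hvv hnormal
    have h3 := hp.spaceDeriv_spaceDeriv_barrier (ε := ε) (K := K) (basisVec k) hx
    rw [hnormal, inner_smul_left] at h3
    have h4 := hp.inner_dirDeriv_dirDeriv_unit (0, basisVec k) hx
    have h5 := hp.inner_dirDeriv_dirDeriv_unit (0, v) hx
    have hNv : ⟪spaceDeriv s v N x, spaceDeriv s v F x⟫ = L x := by
      rw [hnull, inner_smul_left, hvv]; simp
    have hNN : ⟪spaceDeriv s v N x, spaceDeriv s v N x⟫ = L x ^ 2 := by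
      rw [hnull, inner_smul_left, inner_smul_right, hvv]; simp [sq]
    rw [hnormal v v, hnormal (basisVec k) (basisVec k), inner_smul_right, inner_smul_right,
      show ⟪spaceDeriv s (basisVec k) (spaceDeriv s (basisVec k) N) x, N x⟫ = _ from h4,
      show ⟪spaceDeriv s v (spaceDeriv s v N) x, N x⟫ = _ from h5, hNv] at h1
    change (_ - _) - _ = _ at h1
    rw [show ⟪dirDeriv s (0, v) N x, dirDeriv s (0, v) N x⟫ = _ from hNN] at h1
    rw [h3] at h2
    simp only [conj_trivial] at h2
    change _ = d k - barrierRate ε K x * h k * ⟪N x, vertical n⟫ + _ - h k * L x ^ 2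
    simp only [hh] at h1 h2 ⊢
    linear_combination h1 - h2
  have hDsum : 2 * (spaceDeriv s v H x - spaceDeriv s v L x) ^ 2 / H x ≤ ∑ k, d k := by
    set G := spaceDeriv s v H x - spaceDeriv s v L x with hG
    -- the choice `τ = G / H` is the optimal one
    have h1 : 0 ≤ ∑ k, (d k - 4 * (G / H x) * g k + 2 * (G / H x) ^ 2 * (h k - L x)) :=
      Finset.sum_nonneg fun k _ => htest _ k
    rw [Finset.sum_add_distrib, Finset.sum_sub_distrib, ← Finset.mul_sum, ← Finset.mul_sum,
      Finset.sum_sub_distrib, hgsum, hsum, Finset.sum_const, Finset.card_univ, Fintype.card_fin,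
      nsmul_eq_mul] at h1
    have h2 : 0 ≤ 2 * (G / H x) ^ 2 * ((n : ℝ) * L x) := by positivity
    have h3 : 4 * (G / H x) * G - 2 * (G / H x) ^ 2 * H x = 2 * G ^ 2 / H x := by
      field_simp; ring
    linarith
  have hw : ⟪N x, vertical n⟫ ≤ 1 := (abs_le.1 (abs_inner_vertical_le (hp.unit x hx))).2
  have hA : 0 ≤ ∑ k, L x * ⟪spaceDeriv s (basisVec k) N x, spaceDeriv s (basisVec k) N x⟫ :=
    Finset.sum_nonneg fun k _ => mul_nonneg hL0 real_inner_self_nonneg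
  rw [hsimons, Finset.sum_sub_distrib, Finset.sum_add_distrib, Finset.sum_sub_distrib,
    ← Finset.sum_mul, ← Finset.sum_mul, ← Finset.mul_sum, hsum]
  have : barrierRate ε K x * H x * ⟪N x, vertical n⟫ ≤ barrierRate ε K x * H x :=
    mul_le_of_le_one_right (by positivity) hw
  linarith

/-- At a point where the pinching form first acquires a null vector, in the centre of normal
coordinates, the decay rate of the barrier is at most the critical one. -/
theorem rate_le_of_null [NeZero n] (hα : 0 < α) (hθ : θ ∈ Ioo 0 (Real.pi / 2)) (hs : IsOpen s)
    (hx : x ∈ s) (hε : 0 < ε)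
    (hon : ∀ a b, ⟪spaceDeriv s a F x, spaceDeriv s b F x⟫ = ⟪a, b⟫)
    (hnormal : ∀ a b, spaceDeriv s a (spaceDeriv s b F) x
      = -⟪spaceDeriv s a N x, spaceDeriv s b F x⟫ • N x)
    {v : EuclideanSpace ℝ (Fin n)} (hv : ⟪v, v⟫ = 1) (hF : 0 ≤ ⟪F x, vertical n⟫)
    (hnull : spaceDeriv s v N x = barrier ε K F x • spaceDeriv s v F x)
    (hpos : ∀ y ∈ s, y.1 ≤ x.1 → ∀ w, 0 ≤ pinchForm s F N (barrier ε K F) w w y)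
    {B : ℝ} (hHB : H x ≤ B) (hqB : |q x| ≤ B) (hB : α * H x ^ (α - 1) ≤ B) :
    K ≤ criticalRate θ B := by
  have hD := hp.domain
  have hH := hp.H_pos x hx
  have hr : 0 < barrierRate ε K x := by unfold barrierRate; positivity
  have hrL : barrierRate ε K x ≤ barrier ε K F x := by
    unfold barrier; nlinarith
  have hcos : Real.cos θ < 1 := by
    rw [← Real.cos_zero]
    exact Real.cos_lt_cos_of_nonneg_of_le_pi_div_two le_rfl hθ.2.le hθ.1
  have hcos0 : 0 < Real.cos θ := Real.cos_pos_of_mem_Ioo ⟨by linarith [hθ.1, Real.pi_pos], hθ.2⟩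
  have hvv : ⟪spaceDeriv s v F x, spaceDeriv s v F x⟫ = 1 := by rw [hon, hv]
  have hw := abs_inner_vertical_le (hp.unit x hx)
  have hw' := abs_le.1 hw
  have hLH : barrier ε K F x ≤ H x := by
    rw [← hp.sum_inner_weingarten hx hon]
    have h1 : ∀ k, barrier ε K F x
        ≤ ⟪spaceDeriv s (basisVec k) N x, spaceDeriv s (basisVec k) F x⟫ := fun k => by
      have := hpos x hx le_rfl (basisVec k)
      simp only [pinchForm, inner_sub_left, inner_smul_left, hon] at this
      simpa [EuclideanSpace.inner_single_left] using this
    refine (h1 0).trans (Finset.single_le_sum (f := fun k => ⟪spaceDeriv s (basisVec k) N x,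
      spaceDeriv s (basisVec k) F x⟫) (fun k _ => ?_) (Finset.mem_univ 0))
    exact (hr.le.trans hrL).trans (h1 k)
  have hderiv : timeDeriv s (pinchForm s F N (barrier ε K F) v v) x ≤ 0 := by
    have hcont : Continuous fun η : ℝ => x + η • ((-1 : ℝ), (0 : EuclideanSpace ℝ (Fin n))) := by
      fun_prop
    have hev : ∀ᶠ η in 𝓝[>] (0 : ℝ), x + η • ((-1 : ℝ), (0 : EuclideanSpace ℝ (Fin n))) ∈ s :=
      nhdsWithin_le_nhds
        (hcont.continuousAt.eventually_mem (hs.mem_nhds (by simpa using hx)))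
    have h := dirDeriv_nonneg_of_segment (v := ((-1 : ℝ), (0 : EuclideanSpace ℝ (Fin n))))
      (hp.smooth_pinchForm hp.smooth_barrier v v) hx
      (by
        filter_upwards [hev, self_mem_nhdsWithin] with η hη hη0
        refine ⟨hη, hpos _ hη ?_ v⟩
        have : (0 : ℝ) < η := hη0
        simp [this.le])
      (by simp [pinchForm, hnull])
    have e1 : ((-1 : ℝ), (0 : EuclideanSpace ℝ (Fin n))) = -((1 : ℝ), 0) := by simp
    rw [e1] at h
    have e2 : dirDeriv s (-((1 : ℝ), (0 : EuclideanSpace ℝ (Fin n))))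
        (pinchForm s F N (barrier ε K F) v v) x
        = - timeDeriv s (pinchForm s F N (barrier ε K F) v v) x := map_neg _ _
    rw [e2] at h
    linarith
  have hLt : timeDeriv s (barrier ε K F) x = barrierRate ε K x
      * (-(q x * (⟪N x, vertical n⟫ - Real.cos θ))) - K * barrier ε K F x := by
    have hE : ⟪vertical n, vertical n⟫ = 1 := by
      rw [real_inner_self_eq_norm_sq, norm_vertical, one_pow]
    rw [timeDeriv, hp.dirDeriv_barrier _ hx, show dirDeriv s (1, 0) F x = _ from
      hp.evolution x hx, inner_neg_left, inner_smul_left, inner_sub_left, inner_smul_left, hE]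
    simp
  have hF2 := hp.timeDeriv_pinchForm hp.smooth_barrier hx hnull hvv (hnormal v v)
  rw [hF2, hLt, hp.spaceDeriv_spaceDeriv_speed v hx, hp.space_q v x hx] at hderiv
  refine rate_le_of_evolution hα (sub_pos.2 hcos) ?_ ?_ hr hrL hLH hHB hqB
    (mul_pos hα (Real.rpow_pos_of_pos hH _)) hB (abs_inner_vertical_le hvv) hw
    (Real.abs_cos_le_one θ) (hp.spaceDeriv_barrier v hx)
    (hp.spaceDeriv_spaceDeriv_meanCurv_ge hs hx hε hon hnormal hv (hr.le.trans hrL) hnull hpos)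
    hderiv
  · nlinarith
  · nlinarith

end FlowPatch

end Interior

/-! ### No null vector at the boundary -/

section Boundary

variable {n : ℕ} [NeZero n] {α θ : ℝ} {s : Set (SpaceTime n)} {F N : SpaceTime n → Ambient n}
  {A : Fin n → Fin n → SpaceTime n → ℝ} {H q : SpaceTime n → ℝ} {x : SpaceTime n}
  {ε K : ℝ}

/-- A flow patch at the capillary boundary, in coordinates in which the surface corresponds to the
half-space `{y₀ ≥ 0}` and its boundary, where the contact angle is `θ`, to `{y₀ = 0}`. -/
structure BoundaryFlowPatch (α θ : ℝ) (s : Set (SpaceTime n)) (F N : SpaceTime n → Ambient n)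
    (A : Fin n → Fin n → SpaceTime n → ℝ) (H q : SpaceTime n → ℝ) : Prop
    extends FlowPatch α θ s F N A H q where
  halfSpace : ∃ O : Set (SpaceTime n), IsOpen O ∧ s = O ∩ {y | 0 ≤ y.2 0}
  height_eq : ∀ y ∈ s, y.2 0 = 0 → ⟪F y, vertical n⟫ = 0
  contact_angle : ∀ y ∈ s, y.2 0 = 0 → ⟪N y, vertical n⟫ = Real.cos θ

namespace BoundaryFlowPatch

variable (hp : BoundaryFlowPatch α θ s F N A H q)
include hp

theorem eventually_mem {v : SpaceTime n} (hv : 0 ≤ v.2 0) (hx : x ∈ s) :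
    ∀ᶠ η in 𝓝[>] (0 : ℝ), x + η • v ∈ s := by
  obtain ⟨O, hO, rfl⟩ := hp.halfSpace
  have hcont : Continuous fun η : ℝ => x + η • v := by fun_prop
  have hev : ∀ᶠ η in 𝓝[>] (0 : ℝ), x + η • v ∈ O :=
    nhdsWithin_le_nhds (hcont.continuousAt.eventually_mem (hO.mem_nhds (by simpa using hx.1)))
  filter_upwards [hev, self_mem_nhdsWithin] with η hη hη0
  refine ⟨hη, ?_⟩
  have h1 : (0 : ℝ) < η := hη0
  have h2 : 0 ≤ x.2 0 := hx.2
  have : 0 ≤ x.2 0 + η * v.2 0 := by positivity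
  simpa using this

/-- A function vanishing along the boundary has vanishing tangential derivatives there. -/
theorem dirDeriv_eq_zero_of_tangential {f : SpaceTime n → ℝ} (hf : ContDiffOn ℝ ∞ f s)
    (h : ∀ y ∈ s, y.2 0 = 0 → f y = 0) {v : SpaceTime n} (hv : v.2 0 = 0) (hx : x ∈ s)
    (hx0 : x.2 0 = 0) : dirDeriv s v f x = 0 := by
  refine dirDeriv_eq_zero_of_segment hf hx ?_ (h x hx hx0)
  filter_upwards [hp.eventually_mem hv.ge hx] with η hη
  exact ⟨hη, h _ hη (by simp [hx0, hv])⟩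

theorem inner_spaceDeriv_vertical {e : EuclideanSpace ℝ (Fin n)} (he : e 0 = 0) (hx : x ∈ s)
    (hx0 : x.2 0 = 0) : ⟪spaceDeriv s e F x, vertical n⟫ = 0 := by
  rw [← hp.dirDeriv_inner_const hp.smooth_F _ _ hx]
  exact hp.dirDeriv_eq_zero_of_tangential (hp.smooth_F.inner ℝ contDiffOn_const) hp.height_eq
    he hx hx0

theorem inner_dirDeriv_normal_vertical {v : SpaceTime n} (hv : v.2 0 = 0) (hx : x ∈ s)
    (hx0 : x.2 0 = 0) : ⟪dirDeriv s v N x, vertical n⟫ = 0 := by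
  have sf := hp.smooth_N.inner ℝ (contDiffOn_const (c := vertical n))
  have h := hp.dirDeriv_eq_zero_of_tangential (f := fun y => ⟪N y, vertical n⟫ - Real.cos θ)
    (sf.sub contDiffOn_const)
    (fun y hy hy0 => sub_eq_zero.2 (hp.contact_angle y hy hy0)) hv hx hx0
  rwa [dirDeriv_sub hp.domain sf contDiffOn_const hx, dirDeriv_const, sub_zero,
    hp.dirDeriv_inner_const hp.smooth_N _ _ hx] at h

theorem inner_spaceDeriv_spaceDeriv_vertical {e : EuclideanSpace ℝ (Fin n)} (he : e 0 = 0)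
    (hx : x ∈ s) (hx0 : x.2 0 = 0) :
    ⟪spaceDeriv s e (spaceDeriv s e F) x, vertical n⟫ = 0 := by
  rw [← hp.dirDeriv_inner_const (hp.smooth_dF _) _ _ hx]
  exact hp.dirDeriv_eq_zero_of_tangential ((hp.smooth_dF _).inner ℝ contDiffOn_const)
    (fun y hy hy0 => hp.inner_spaceDeriv_vertical he hy hy0) he hx hx0

theorem inner_spaceDeriv_spaceDeriv_normal_vertical {e : EuclideanSpace ℝ (Fin n)} (he : e 0 = 0)
    (hx : x ∈ s) (hx0 : x.2 0 = 0) :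
    ⟪spaceDeriv s e (spaceDeriv s e N) x, vertical n⟫ = 0 := by
  rw [← hp.dirDeriv_inner_const (hp.smooth_dN _) _ _ hx]
  exact hp.dirDeriv_eq_zero_of_tangential ((hp.smooth_dN _).inner ℝ contDiffOn_const)
    (fun y hy hy0 => hp.inner_dirDeriv_normal_vertical he hy hy0) he hx hx0

variable (hθ : θ ∈ Ioo 0 (Real.pi / 2)) (hx : x ∈ s) (hx0 : x.2 0 = 0)
  (hon : ∀ a b, ⟪spaceDeriv s a F x, spaceDeriv s b F x⟫ = ⟪a, b⟫)
  (hconormal : vertical n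
    = Real.cos θ • N x + Real.sin θ • spaceDeriv s (basisVec 0) F x)
include hθ hx hx0 hconormal

omit hp hθ hx hx0 in
theorem inner_conormal (y : Ambient n) :
    Real.sin θ * ⟪y, spaceDeriv s (basisVec 0) F x⟫
      = ⟪y, vertical n⟫ - Real.cos θ * ⟪y, N x⟫ := by
  rw [hconormal, inner_add_right, inner_smul_right, inner_smul_right]
  ring

omit hp hx hx0 hconormal in
theorem _root_.CapillaryFlow.sin_pos_of_acute : 0 < Real.sin θ :=
  Real.sin_pos_of_pos_of_lt_pi hθ.1 (by linarith [hθ.2, Real.pi_pos])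

/-- The conormal is a principal direction along the boundary. -/
theorem secondForm_conormal {e : EuclideanSpace ℝ (Fin n)} (he : e 0 = 0) :
    ⟪spaceDeriv s (basisVec 0) N x, spaceDeriv s e F x⟫ = 0 := by
  rw [hp.secondForm_symm _ _ hx]
  have h := inner_conormal hconormal (spaceDeriv s e N x)
  rw [show ⟪spaceDeriv s e N x, vertical n⟫ = 0 from
      hp.inner_dirDeriv_normal_vertical (v := (0, e)) he hx hx0,
    show ⟪spaceDeriv s e N x, N x⟫ = 0 from hp.inner_dirDeriv_unit _ hx] at h
  have := sin_pos_of_acute hθ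
  simpa [this.ne'] using h

/-- The mean curvature satisfies the homogeneous Neumann condition along the boundary: this is the
time derivative of the contact angle condition. -/
theorem spaceDeriv_meanCurv_eq_zero (hα : 0 < α) : spaceDeriv s (basisVec 0) H x = 0 := by
  have hD := hp.domain
  have hsin := sin_pos_of_acute hθ
  have h1 := inner_conormal hconormal (timeDeriv s N x)
  rw [show ⟪timeDeriv s N x, vertical n⟫ = 0 from
      hp.inner_dirDeriv_normal_vertical (v := (1, 0)) (by simp) hx hx0,
    show ⟪timeDeriv s N x, N x⟫ = 0 from hp.inner_dirDeriv_unit _ hx] at h1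
  have h2 : ⟪timeDeriv s N x, spaceDeriv s (basisVec 0) F x⟫ = 0 := by
    simpa [hsin.ne'] using h1
  have h3 : ⟪timeDeriv s N x, spaceDeriv s (basisVec 0) F x⟫ = _ :=
    hp.inner_dirDeriv_normal (1, 0) (basisVec 0) hx
  have sW : ContDiffOn ℝ ∞ (fun y => N y - Real.cos θ • vertical n) s :=
    hp.smooth_N.sub contDiffOn_const
  rw [h2, dirDeriv_comm hD hp.smooth_F _ _ hx, dirDeriv_congr (fun y hy => hp.evolution y hy) hx,
    dirDeriv_neg hD hx, dirDeriv_smul hD hp.smooth_q sW hx,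
    dirDeriv_sub hD hp.smooth_N contDiffOn_const hx, dirDeriv_const, sub_zero, inner_neg_right,
    inner_add_right, inner_smul_right, inner_smul_right, inner_sub_right, inner_smul_right,
    real_inner_comm (dirDeriv s (0, basisVec 0) N x) (N x), hp.inner_dirDeriv_unit _ hx,
    hp.unit x hx, hp.contact_angle x hx hx0] at h3
  have h4 : spaceDeriv s (basisVec 0) q x * Real.sin θ ^ 2 = 0 := by
    rw [Real.sin_sq]
    linear_combination -h3
  have h5 : spaceDeriv s (basisVec 0) q x = 0 := by
    simpa [hsin.ne'] using h4
  rw [hp.space_q _ x hx] at h5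
  have h6 : 0 < α * H x ^ (α - 1) := mul_pos hα (Real.rpow_pos_of_pos (hp.H_pos x hx) _)
  simpa [h6.ne'] using h5

include hon

/-- The conormal is an eigenvector of the Weingarten map. -/
theorem spaceDeriv_normal_conormal : spaceDeriv s (basisVec 0) N x
    = ⟪spaceDeriv s (basisVec 0) N x, spaceDeriv s (basisVec 0) F x⟫
      • spaceDeriv s (basisVec 0) F x := by
  nth_rewrite 1 [hp.weingarten 0 x hx]
  rw [Finset.sum_eq_single 0]
  · rw [hp.weingarten_eq_inner hx hon]
  · intro l _ hl
    rw [hp.weingarten_eq_inner hx hon,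
      hp.secondForm_conormal hθ hx hx0 hconormal (by simp [hl]), zero_smul]
  · simp

/-- The conormal derivative of the second fundamental form in a direction tangential to the
boundary, expressed through its value. -/
theorem conormal_derivative {e : EuclideanSpace ℝ (Fin n)} (he : e 0 = 0) :
    Real.sin θ * (⟪spaceDeriv s (basisVec 0) (spaceDeriv s e N) x, spaceDeriv s e F x⟫
        - ⟪spaceDeriv s (basisVec 0) (spaceDeriv s e F) x, spaceDeriv s e N x⟫)
      = Real.cos θ * (⟪spaceDeriv s e N x, spaceDeriv s e N x⟫
        - ⟪spaceDeriv s (basisVec 0) N x, spaceDeriv s (basisVec 0) F x⟫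
          * ⟪spaceDeriv s e N x, spaceDeriv s e F x⟫) := by
  have hD := hp.domain
  have h := hp.dirDeriv_secondForm_symm (0, e) (basisVec 0) e hx
  rw [dirDeriv_comm hD hp.smooth_N (0, e) (0, basisVec 0) hx,
    dirDeriv_comm hD hp.smooth_F (0, e) (0, basisVec 0) hx,
    hp.spaceDeriv_normal_conormal hθ hx hx0 hon hconormal, inner_smul_left] at h
  have h1 := inner_conormal hconormal (spaceDeriv s e (spaceDeriv s e N) x)
  rw [hp.inner_spaceDeriv_spaceDeriv_normal_vertical he hx hx0,
    show ⟪spaceDeriv s e (spaceDeriv s e N) x, N x⟫ = _ from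
      hp.inner_dirDeriv_dirDeriv_unit (0, e) hx] at h1
  have h2 := inner_conormal hconormal (spaceDeriv s e (spaceDeriv s e F) x)
  rw [hp.inner_spaceDeriv_spaceDeriv_vertical he hx hx0] at h2
  have h3 : ⟪spaceDeriv s e N x, spaceDeriv s e F x⟫ = _ := hp.inner_dirDeriv_normal (0, e) e hx
  have c1 := real_inner_comm (spaceDeriv s e (spaceDeriv s e F) x) (N x)
  have c2 := real_inner_comm (spaceDeriv s e (spaceDeriv s e F) x) (spaceDeriv s (basisVec 0) F x)
  have c3 := real_inner_comm (spaceDeriv s (basisVec 0) (spaceDeriv s e F) x) (spaceDeriv s e N x)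
  simp only [conj_trivial] at h
  rw [← c3]
  rw [← c1, ← c2] at h2
  set κ := ⟪spaceDeriv s (basisVec 0) N x, spaceDeriv s (basisVec 0) F x⟫
  linear_combination Real.sin θ * h + h1 - κ * h2 + κ * Real.cos θ * h3

/-- The pinching form has no null vector at the boundary. On a null vector its inward conormal
derivative is nonnegative, while the barrier strictly increases. For a null vector tangential to the
boundary this contradicts `conormal_derivative`, the contact angle being acute; for the conormal it
contradicts the Neumann condition for the mean curvature. -/
theorem not_null (hα : 0 < α) (hε : 0 < ε) (hF : 0 ≤ ⟪F x, vertical n⟫)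
    (hpos : ∀ y ∈ s, y.1 = x.1 → ∀ w, 0 ≤ pinchForm s F N (barrier ε K F) w w y)
    {v : EuclideanSpace ℝ (Fin n)} (hv : v ≠ 0) :
    pinchForm s F N (barrier ε K F) v v x ≠ 0 := by
  intro hzero
  have hD := hp.domain
  have hsin := sin_pos_of_acute hθ
  have hcos : 0 < Real.cos θ :=
    Real.cos_pos_of_mem_Ioo ⟨by linarith [hθ.1, Real.pi_pos], hθ.2⟩
  have hr : 0 < barrierRate ε K x := by unfold barrierRate; positivity
  have hL0 : 0 < barrier ε K F x := by unfold barrier; positivity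
  have hLs : ContDiffOn ℝ ∞ (barrier ε K F) s := hp.smooth_barrier
  have hL1 : spaceDeriv s (basisVec 0) (barrier ε K F) x = barrierRate ε K x * Real.sin θ := by
    have h0 : ⟪spaceDeriv s (basisVec 0) F x, spaceDeriv s (basisVec 0) F x⟫ = 1 := by
      rw [hon]; simp
    rw [hp.spaceDeriv_barrier _ hx, hconormal, inner_add_right, inner_smul_right,
      inner_smul_right, hp.normal _ x hx, h0]
    ring
  set L := barrier ε K F with hL
  have hnullvec : ∀ {w}, pinchForm s F N L w w x = 0 →
      spaceDeriv s w N x = L x • spaceDeriv s w F x := fun hw =>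
    hp.null_direction hx (fun w => hpos x hx rfl w) hw
  have hderiv : ∀ {w}, pinchForm s F N L w w x = 0 →
      0 ≤ ⟪spaceDeriv s (basisVec 0) (spaceDeriv s w N) x, spaceDeriv s w F x⟫
        - ⟪spaceDeriv s (basisVec 0) (spaceDeriv s w F) x, spaceDeriv s w N x⟫
        - barrierRate ε K x * Real.sin θ * ⟪w, w⟫ := by
    intro w hw
    have h := dirDeriv_nonneg_of_segment (v := ((0 : ℝ), (basisVec 0 : EuclideanSpace ℝ (Fin n))))
      (hp.smooth_pinchForm hLs w w) hx (by
        filter_upwards [hp.eventually_mem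
          (v := ((0 : ℝ), (basisVec 0 : EuclideanSpace ℝ (Fin n)))) (by simp) hx] with η hη
        exact ⟨hη, hpos _ hη (by simp) w⟩) hw
    rw [hp.dirDeriv_pinchForm hLs _ w hx (hnullvec hw), hon] at h
    rw [hnullvec hw, inner_smul_right, ← hL1]
    exact h
  set κ := ⟪spaceDeriv s (basisVec 0) N x, spaceDeriv s (basisVec 0) F x⟫ with hκ
  have hκL : pinchForm s F N L (basisVec 0) (basisVec 0) x = κ - L x := by
    simp only [pinchForm, inner_sub_left, inner_smul_left, hon, hκ]
    simp
  have hκ0 : 0 ≤ κ - L x := hκL ▸ hpos x hx rfl _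
  rcases hκ0.eq_or_lt with hκ0 | hκ0
  · -- the conormal is a null vector: the Neumann condition for the mean curvature applies
    have hnull := hκL.trans hκ0.symm
    have h0 := hderiv hnull
    have hH := hp.spaceDeriv_meanCurv_eq_zero hθ hx hx0 hconormal hα
    rw [spaceDeriv, hp.dirDeriv_meanCurv (0, basisVec 0) hx hon] at hH
    have hterm : ∀ k : Fin n,
        0 ≤ ⟪dirDeriv s (0, basisVec 0) (spaceDeriv s (basisVec k) N) x,
            spaceDeriv s (basisVec k) F x⟫
          - ⟪dirDeriv s (0, basisVec 0) (spaceDeriv s (basisVec k) F) x,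
            spaceDeriv s (basisVec k) N x⟫ := by
      intro k
      by_cases hk : k = 0
      · subst hk
        have : 0 ≤ barrierRate ε K x * Real.sin θ
          * ⟪(basisVec 0 : EuclideanSpace ℝ (Fin n)), basisVec 0⟫ :=
          mul_nonneg (by positivity) real_inner_self_nonneg
        exact this.trans (sub_nonneg.1 h0)
      · have h1 := hp.conormal_derivative hθ hx hx0 hon hconormal
          (e := basisVec k) (by simp [hk])
        refine nonneg_of_mul_nonneg_right (h1.symm ▸ ?_) hsin
        refine mul_nonneg hcos.le ?_
        have hkk := hpos x hx rfl (basisVec k)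
        simp only [pinchForm, inner_sub_left, inner_smul_left, hon] at hkk
        have hFk : ‖spaceDeriv s (basisVec k) F x‖ = 1 := by
          have : ⟪spaceDeriv s (basisVec k) F x, spaceDeriv s (basisVec k) F x⟫ = 1 := by
            rw [hon]; simp
          rw [real_inner_self_eq_norm_sq] at this
          exact (pow_eq_one_iff_of_nonneg (norm_nonneg _) two_ne_zero).1 this
        have hcs := abs_real_inner_le_norm (spaceDeriv s (basisVec k) N x)
          (spaceDeriv s (basisVec k) F x)
        rw [hFk, mul_one] at hcs
        set hk' := ⟪spaceDeriv s (basisVec k) N x, spaceDeriv s (basisVec k) F x⟫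
        have hkL : L x ≤ hk' := by simpa using hkk
        have hκe : κ = L x := by linarith
        rw [real_inner_self_eq_norm_sq, ← hκ, hκe]
        have : hk' ^ 2 ≤ ‖spaceDeriv s (basisVec k) N x‖ ^ 2 := by
          rw [← sq_abs hk']; gcongr
        nlinarith
    have h00 := (Finset.sum_eq_zero_iff_of_nonneg (fun k _ => hterm k)).1 hH 0 (Finset.mem_univ 0)
    rw [show ⟪(basisVec 0 : EuclideanSpace ℝ (Fin n)), basisVec 0⟫ = (1 : ℝ) by simp] at h0
    have : 0 < barrierRate ε K x * Real.sin θ := by positivity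
    simp only [spaceDeriv] at h0 h00
    linarith
  · -- otherwise the null vector is tangential to the boundary
    set e : EuclideanSpace ℝ (Fin n) := v - v 0 • basisVec 0 with he
    have he0 : e 0 = 0 := by simp [he]
    have hve : v = e + v 0 • basisVec 0 := by simp [he]
    have hsplit : pinchForm s F N L v v x
        = pinchForm s F N L e e x + v 0 ^ 2 * (κ - L x) := by
      have h1 := hp.secondForm_conormal hθ hx hx0 hconormal he0
      have h2 := h1
      rw [hp.secondForm_symm _ _ hx] at h2
      have h3 : ⟪e, (basisVec 0 : EuclideanSpace ℝ (Fin n))⟫ = (0 : ℝ) := by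
        simp [EuclideanSpace.inner_single_right, he0]
      have h4 : ⟪(basisVec 0 : EuclideanSpace ℝ (Fin n)), e⟫ = (0 : ℝ) := by
        simp [EuclideanSpace.inner_single_left, he0]
      have h5 : ∀ t : ℝ, pinchForm s F N L (e + t • basisVec 0) (e + t • basisVec 0) x
          = pinchForm s F N L e e x + t ^ 2 * pinchForm s F N L (basisVec 0) (basisVec 0) x := by
        intro t
        simp only [pinchForm, spaceDeriv_add_dir, spaceDeriv_smul_dir, inner_add_left,
          inner_add_right, inner_sub_left, inner_smul_left, inner_smul_right, hon, h1, h2, h3, h4,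
          conj_trivial]
        ring
      rw [← hκL, ← h5, ← hve]
    have hee := hpos x hx rfl e
    have hv0 : v 0 = 0 := by
      by_contra h
      have : 0 < v 0 ^ 2 * (κ - L x) := by positivity
      linarith
    have hnull := hnullvec hzero
    have h0 := hderiv hzero
    have h1 := hp.conormal_derivative hθ hx hx0 hon hconormal hv0
    have hvv : 0 < ⟪v, v⟫ := real_inner_self_pos.2 hv
    have h2 : Real.cos θ * (⟪spaceDeriv s v N x, spaceDeriv s v N x⟫
        - κ * ⟪spaceDeriv s v N x, spaceDeriv s v F x⟫) ≤ 0 := by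
      rw [hnull, inner_smul_left, inner_smul_left, inner_smul_right, hon]
      simp only [conj_trivial]
      have : Real.cos θ * (L x * (L x * ⟪v, v⟫) - κ * (L x * ⟪v, v⟫))
          = -(Real.cos θ * L x * ⟪v, v⟫ * (κ - L x)) := by ring
      rw [this]
      have : 0 ≤ Real.cos θ * L x * ⟪v, v⟫ * (κ - L x) := by positivity
      linarith
    have h3 := mul_le_mul_of_nonneg_left (sub_nonneg.1 h0) hsin.le
    rw [h1] at h3
    have : 0 < Real.sin θ * (barrierRate ε K x * Real.sin θ * ⟪v, v⟫) := by positivity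
    linarith

end BoundaryFlowPatch

end Boundary

/-! ### The Weingarten map -/

section Weingarten

variable {n : ℕ}

/-- The range of the differential of a parametrization is the orthogonal complement of the
normal. -/
theorem range_eq_orthogonal {dF : EuclideanSpace ℝ (Fin n) →ₗ[ℝ] Ambient n} {ν : Ambient n}
    (hF : Function.Injective dF) (hν : ‖ν‖ = 1) (hFν : ∀ v, ⟪dF v, ν⟫ = 0) :
    LinearMap.range dF = (ℝ ∙ ν)ᗮ := by
  have hle : LinearMap.range dF ≤ (ℝ ∙ ν)ᗮ := by
    rintro _ ⟨v, rfl⟩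
    rw [Submodule.mem_orthogonal_singleton_iff_inner_left]
    exact hFν v
  have hν0 : ν ≠ 0 := by
    intro h; simp [h] at hν
  have : Fact (Module.finrank ℝ (Ambient n) = n + 1) := ⟨by simp⟩
  refine Submodule.eq_of_le_of_finrank_eq hle ?_
  rw [LinearMap.finrank_range_of_inj hF, Submodule.finrank_orthogonal_span_singleton (n := n) hν0]
  simp

/-- The Weingarten map: the differential of the unit normal factors through the differential of the
parametrization. -/
theorem exists_weingarten {dF dN : EuclideanSpace ℝ (Fin n) →ₗ[ℝ] Ambient n} {ν : Ambient n}
    (hF : Function.Injective dF) (hν : ‖ν‖ = 1) (hFν : ∀ v, ⟪dF v, ν⟫ = 0)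
    (hNν : ∀ v, ⟪dN v, ν⟫ = 0) :
    ∃ w : EuclideanSpace ℝ (Fin n) →ₗ[ℝ] EuclideanSpace ℝ (Fin n), ∀ v, dN v = dF (w v) := by
  have hmem : ∀ v, dN v ∈ LinearMap.range dF := fun v => by
    rw [range_eq_orthogonal hF hν hFν, Submodule.mem_orthogonal_singleton_iff_inner_left]
    exact hNν v
  refine ⟨(LinearEquiv.ofInjective dF hF).symm.toLinearMap ∘ₗ dN.codRestrict _ hmem, fun v => ?_⟩
  have := LinearEquiv.apply_symm_apply (LinearEquiv.ofInjective dF hF)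
    (dN.codRestrict _ hmem v)
  exact (congrArg Subtype.val this).symm

variable {dF dN : EuclideanSpace ℝ (Fin n) →ₗ[ℝ] Ambient n}
  {w : EuclideanSpace ℝ (Fin n) →ₗ[ℝ] EuclideanSpace ℝ (Fin n)}

theorem det_gram_ne_zero (hF : Function.Injective dF)
    (b : Module.Basis (Fin n) ℝ (EuclideanSpace ℝ (Fin n))) :
    (Matrix.of fun i j => ⟪dF (b i), dF (b j)⟫).det ≠ 0 := by
  intro h
  obtain ⟨v, hv, hGv⟩ := Matrix.exists_mulVec_eq_zero_iff.2 h
  have h1 : dF (∑ j, v j • b j) = 0 := by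
    rw [← inner_self_eq_zero (𝕜 := ℝ)]
    nth_rewrite 1 [map_sum]
    rw [sum_inner]
    refine Finset.sum_eq_zero fun i _ => ?_
    have h2 := congrFun hGv i
    simp only [Matrix.mulVec, dotProduct, Matrix.of_apply, Pi.zero_apply] at h2
    rw [map_smul, inner_smul_left, map_sum, inner_sum]
    simp only [map_smul, inner_smul_right]
    have h3 : ∑ x, v x * ⟪dF (b i), dF (b x)⟫ = 0 := by
      rw [← h2]; exact Finset.sum_congr rfl fun j _ => mul_comm _ _
    rw [h3, mul_zero]
  have h2 : ∑ j, v j • b j = 0 := hF (by rw [h1, map_zero])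
  exact hv (funext fun j => by
    have := Fintype.linearIndependent_iff.1 b.linearIndependent v h2 j
    simpa using this)

/-- In any basis, the matrix of the Weingarten map is the product of the matrices of the second
fundamental form and of the inverse metric. -/
theorem weingarten_matrix (hF : Function.Injective dF) (hw : ∀ v, dN v = dF (w v))
    (b : Module.Basis (Fin n) ℝ (EuclideanSpace ℝ (Fin n))) :
    (Matrix.of fun i j => ⟪dN (b i), dF (b j)⟫) * (Matrix.of fun i j => ⟪dF (b i), dF (b j)⟫)⁻¹
      = (LinearMap.toMatrix b b w).transpose := by
  have hdet := det_gram_ne_zero hF b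
  have h : (Matrix.of fun i j => ⟪dN (b i), dF (b j)⟫)
      = (LinearMap.toMatrix b b w).transpose * (Matrix.of fun i j => ⟪dF (b i), dF (b j)⟫) := by
    ext i j
    rw [Matrix.mul_apply]
    simp only [Matrix.of_apply, Matrix.transpose_apply, LinearMap.toMatrix_apply]
    rw [hw, ← b.sum_repr (w (b i)), map_sum, sum_inner]
    simp [inner_smul_left]
  rw [h, Matrix.mul_assoc, Matrix.mul_nonsing_inv _ (isUnit_iff_ne_zero.2 hdet), Matrix.mul_one]

theorem weingarten_apply_basis (hF : Function.Injective dF) (hw : ∀ v, dN v = dF (w v))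
    (b : Module.Basis (Fin n) ℝ (EuclideanSpace ℝ (Fin n))) (k : Fin n) :
    dN (b k) = ∑ l, ((Matrix.of fun i j => ⟪dN (b i), dF (b j)⟫)
      * (Matrix.of fun i j => ⟪dF (b i), dF (b j)⟫)⁻¹) k l • dF (b l) := by
  rw [weingarten_matrix hF hw b, hw, ← b.sum_repr (w (b k)), map_sum]
  simp [LinearMap.toMatrix_apply]

theorem trace_weingarten (hF : Function.Injective dF) (hw : ∀ v, dN v = dF (w v))
    (b : Module.Basis (Fin n) ℝ (EuclideanSpace ℝ (Fin n))) :
    ((Matrix.of fun i j => ⟪dN (b i), dF (b j)⟫)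
      * (Matrix.of fun i j => ⟪dF (b i), dF (b j)⟫)⁻¹).trace = LinearMap.trace ℝ _ w := by
  rw [weingarten_matrix hF hw b, Matrix.trace_transpose, ← LinearMap.trace_eq_matrix_trace]

end Weingarten

section MatrixInverse

variable {V : Type*} [NormedAddCommGroup V] [NormedSpace ℝ V] {s : Set V} {n : ℕ}

theorem contDiffOn_det {G : V → Matrix (Fin n) (Fin n) ℝ}
    (hG : ∀ i j, ContDiffOn ℝ ∞ (fun x => G x i j) s) :
    ContDiffOn ℝ ∞ (fun x => (G x).det) s := by
  simp only [Matrix.det_apply]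
  exact ContDiffOn.sum fun σ _ => ContDiffOn.const_smul _ (contDiffOn_prod fun i _ => hG _ _)

theorem contDiffOn_matrix_inv {G : V → Matrix (Fin n) (Fin n) ℝ}
    (hG : ∀ i j, ContDiffOn ℝ ∞ (fun x => G x i j) s) (hdet : ∀ x ∈ s, (G x).det ≠ 0)
    (i j : Fin n) : ContDiffOn ℝ ∞ (fun x => (G x)⁻¹ i j) s := by
  have h : (fun x => (G x)⁻¹ i j) = fun x => (G x).det⁻¹ * (G x).adjugate i j := by
    funext x
    rw [Matrix.inv_def, Matrix.smul_apply, Ring.inverse_eq_inv', smul_eq_mul]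
  rw [h]
  refine ((contDiffOn_det hG).inv hdet).mul ?_
  simp only [Matrix.adjugate_apply]
  refine contDiffOn_det fun k l => ?_
  simp only [Matrix.updateRow_apply]
  split_ifs
  · exact contDiffOn_const
  · exact hG k l

theorem contDiffOn_mul_matrix_inv {G h : V → Matrix (Fin n) (Fin n) ℝ}
    (hG : ∀ i j, ContDiffOn ℝ ∞ (fun x => G x i j) s)
    (hh : ∀ i j, ContDiffOn ℝ ∞ (fun x => h x i j) s) (hdet : ∀ x ∈ s, (G x).det ≠ 0)
    (i j : Fin n) : ContDiffOn ℝ ∞ (fun x => (h x * (G x)⁻¹) i j) s := by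
  simp only [Matrix.mul_apply]
  exact ContDiffOn.sum fun k _ => (hh i k).mul (contDiffOn_matrix_inv hG hdet k j)

end MatrixInverse

section MeanCurvature

variable {n : ℕ} [NeZero n] {M : Type*} [TopologicalSpace M]
  [ChartedSpace (EuclideanHalfSpace n) M] {X ν : M → Ambient n} {p : M}

theorem coordVec_eq (i : Fin n) :
    coordVec p i = (EuclideanSpace.basisFun (Fin n) ℝ).toBasis i := by
  rw [OrthonormalBasis.coe_toBasis, EuclideanSpace.basisFun_apply]
  rfl

/-- The mean curvature is the trace of the Weingarten map, and so can be computed in any basis of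
the tangent space. -/
theorem meanCurv_eq_trace (hinj : Function.Injective (diff X p))
    {w : EuclideanSpace ℝ (Fin n) →ₗ[ℝ] EuclideanSpace ℝ (Fin n)}
    (hw : ∀ v : EuclideanSpace ℝ (Fin n), diff ν p v = diff X p (w v)) :
    meanCurv X ν p = LinearMap.trace ℝ _ w := by
  let dF : EuclideanSpace ℝ (Fin n) →ₗ[ℝ] Ambient n :=
    (mfderiv (𝓡∂ n) 𝓘(ℝ, Ambient n) X p).toLinearMap
  let dN : EuclideanSpace ℝ (Fin n) →ₗ[ℝ] Ambient n :=
    (mfderiv (𝓡∂ n) 𝓘(ℝ, Ambient n) ν p).toLinearMap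
  rw [← trace_weingarten (dF := dF) (dN := dN) hinj hw (EuclideanSpace.basisFun (Fin n) ℝ).toBasis,
    Matrix.trace_mul_comm]
  simp only [meanCurv, firstForm, secondForm, coordVec_eq]
  rfl

end MeanCurvature

/-! ### Flow patches of a solution -/

section LocalChart

variable {n : ℕ} [NeZero n] {M : Type*} [TopologicalSpace M]
  [ChartedSpace (EuclideanHalfSpace n) M]

/-- The local parametrization of `M` obtained from the inverse of the chart at `p₀` by a change of
coordinates `ψ`. -/
noncomputable def chartParam (p₀ : M) (ψ : EuclideanSpace ℝ (Fin n) → EuclideanSpace ℝ (Fin n))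
    (z : EuclideanSpace ℝ (Fin n)) : M :=
  (extChartAt (𝓡∂ n) p₀).symm (ψ z)

/-- The differential of a local parametrization. -/
noncomputable def chartParamDeriv (p₀ : M)
    (ψ : EuclideanSpace ℝ (Fin n) → EuclideanSpace ℝ (Fin n)) (z : EuclideanSpace ℝ (Fin n)) :
    EuclideanSpace ℝ (Fin n) →L[ℝ] EuclideanSpace ℝ (Fin n) :=
  ContinuousLinearMap.comp (mfderivWithin 𝓘(ℝ, EuclideanSpace ℝ (Fin n)) (𝓡∂ n)
    (extChartAt (𝓡∂ n) p₀).symm (range (𝓡∂ n)) (ψ z)) (fderiv ℝ ψ z)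

/-- `ψ` is an admissible change of coordinates on `U` for the chart at `p₀`. -/
structure IsChartChange (p₀ : M) (ψ : EuclideanSpace ℝ (Fin n) → EuclideanSpace ℝ (Fin n))
    (U : Set (EuclideanSpace ℝ (Fin n))) : Prop where
  smooth : ContDiff ℝ ∞ ψ
  mem_target : ∀ z ∈ U, ψ z ∈ (extChartAt (𝓡∂ n) p₀).target
  injective : ∀ z ∈ U, Function.Injective (fderiv ℝ ψ z)
  uniqueDiffOn : UniqueDiffOn ℝ U

variable {p₀ : M} {ψ : EuclideanSpace ℝ (Fin n) → EuclideanSpace ℝ (Fin n)}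
  {U : Set (EuclideanSpace ℝ (Fin n))}

variable [IsManifold (𝓡∂ n) ∞ M]

namespace IsChartChange

variable (hc : IsChartChange p₀ ψ U)
include hc

theorem hasMFDerivWithinAt {z : EuclideanSpace ℝ (Fin n)} (hz : z ∈ U) :
    HasMFDerivWithinAt 𝓘(ℝ, EuclideanSpace ℝ (Fin n)) (𝓡∂ n) (chartParam p₀ ψ) U z
      (chartParamDeriv p₀ ψ z) := by
  have : IsManifold (𝓡∂ n) 1 M := .of_le (n := ∞) (by simp)
  have h1 := (mdifferentiableWithinAt_extChartAt_symm (hc.mem_target z hz)).hasMFDerivWithinAt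
  have h2 : HasMFDerivWithinAt 𝓘(ℝ, EuclideanSpace ℝ (Fin n)) 𝓘(ℝ, EuclideanSpace ℝ (Fin n)) ψ U z
      (fderiv ℝ ψ z) :=
    (((hc.smooth.differentiable (by simp)) z).hasFDerivAt.hasFDerivWithinAt).hasMFDerivWithinAt
  exact h1.comp z h2 fun y hy => extChartAt_target_subset_range p₀ (hc.mem_target y hy)

theorem injective_chartParamDeriv {z : EuclideanSpace ℝ (Fin n)} (hz : z ∈ U) :
    Function.Injective (chartParamDeriv p₀ ψ z) := by
  have : IsManifold (𝓡∂ n) 1 M := .of_le (n := ∞) (by simp)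
  have h1 := isInvertible_mfderivWithin_extChartAt_symm (hc.mem_target z hz)
  exact h1.injective.comp (hc.injective z hz)

theorem contMDiffOn_chartParam :
    ContMDiffOn 𝓘(ℝ, EuclideanSpace ℝ (Fin n)) (𝓡∂ n) ∞ (chartParam p₀ ψ) U :=
  (contMDiffOn_extChartAt_symm p₀).comp hc.smooth.contMDiff.contMDiffOn hc.mem_target

/-- The basis of the tangent space given by a local parametrization. -/
theorem exists_basis {z : EuclideanSpace ℝ (Fin n)} (hz : z ∈ U) :
    ∃ b : Module.Basis (Fin n) ℝ (EuclideanSpace ℝ (Fin n)),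
      ∀ i, b i = chartParamDeriv p₀ ψ z (basisVec i) := by
  let e : EuclideanSpace ℝ (Fin n) ≃ₗ[ℝ] EuclideanSpace ℝ (Fin n) :=
    LinearEquiv.ofInjectiveEndo
      (chartParamDeriv p₀ ψ z).toLinearMap (hc.injective_chartParamDeriv hz)
  refine ⟨(EuclideanSpace.basisFun (Fin n) ℝ).toBasis.map e, fun i => ?_⟩
  rw [Module.Basis.map_apply, OrthonormalBasis.coe_toBasis, EuclideanSpace.basisFun_apply]
  rfl

theorem exists_chartParamDeriv_eq {z : EuclideanSpace ℝ (Fin n)} (hz : z ∈ U)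
    (v : EuclideanSpace ℝ (Fin n)) : ∃ w, chartParamDeriv p₀ ψ z w = v :=
  (LinearMap.injective_iff_surjective (f := (chartParamDeriv p₀ ψ z).toLinearMap)).1
    (hc.injective_chartParamDeriv hz) v

variable {J : Set ℝ} {G : ℝ → M → Ambient n}

theorem contDiffOn_comp
    (hG : ContMDiffOn (𝓘(ℝ, ℝ).prod (𝓡∂ n)) 𝓘(ℝ, Ambient n) ∞ (fun q : ℝ × M => G q.1 q.2)
      (J ×ˢ univ)) :
    ContDiffOn ℝ ∞ (fun x : SpaceTime n => G x.1 (chartParam p₀ ψ x.2)) (J ×ˢ U) := by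
  rw [← contMDiffOn_iff_contDiffOn]
  refine hG.comp (t := J ×ˢ univ) (f := fun x : SpaceTime n => (x.1, chartParam p₀ ψ x.2)) ?_ ?_
  · exact contDiff_fst.contMDiff.contMDiffOn.prodMk
      (hc.contMDiffOn_chartParam.comp contDiff_snd.contMDiff.contMDiffOn fun x hx => hx.2)
  · exact fun x hx => ⟨hx.1, mem_univ _⟩

theorem spaceDeriv_comp {t : ℝ} {z : EuclideanSpace ℝ (Fin n)} (ht : t ∈ J) (hz : z ∈ U)
    (hd : DifferentiableWithinAt ℝ (fun x : SpaceTime n => G x.1 (chartParam p₀ ψ x.2)) (J ×ˢ U)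
      (t, z))
    (hG : MDifferentiableAt (𝓡∂ n) 𝓘(ℝ, Ambient n) (G t) (chartParam p₀ ψ z))
    (v : EuclideanSpace ℝ (Fin n)) :
    spaceDeriv (J ×ˢ U) v (fun x : SpaceTime n => G x.1 (chartParam p₀ ψ x.2)) (t, z)
      = diff (G t) (chartParam p₀ ψ z) (chartParamDeriv p₀ ψ z v) := by
  have h1 : HasMFDerivWithinAt 𝓘(ℝ, EuclideanSpace ℝ (Fin n)) 𝓘(ℝ, Ambient n)
      (fun y => G t (chartParam p₀ ψ y)) U z _ :=
    hG.hasMFDerivAt.comp_hasMFDerivWithinAt z (hc.hasMFDerivWithinAt hz)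
  have h1' := h1.hasFDerivWithinAt
  have h2 : HasFDerivWithinAt (fun y : EuclideanSpace ℝ (Fin n) => ((t, y) : SpaceTime n))
      (ContinuousLinearMap.inr ℝ ℝ _) U z := (hasFDerivAt_prodMk_right t z).hasFDerivWithinAt
  have h3 := (hd.hasFDerivWithinAt).comp z h2 fun y hy => ⟨ht, hy⟩
  have h4 := (hc.uniqueDiffOn z hz).eq h3 h1'
  have h5 := DFunLike.congr_fun h4 v
  have h6 : spaceDeriv (J ×ˢ U) v (fun x : SpaceTime n => G x.1 (chartParam p₀ ψ x.2)) (t, z)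
      = fderivWithin ℝ (fun x : SpaceTime n => G x.1 (chartParam p₀ ψ x.2)) (J ×ˢ U) (t, z)
        (ContinuousLinearMap.inr ℝ ℝ _ v) := rfl
  exact h6.trans h5

end IsChartChange

end LocalChart

section SolutionPatch

/-- The positive times of the interval `[0, T)`. -/
def positiveTimes (T : EReal) : Set ℝ := {t | t ∈ timeInterval T ∧ 0 < t}

theorem isOpen_positiveTimes (T : EReal) : IsOpen (positiveTimes T) := by
  have h : positiveTimes T = {t : ℝ | 0 < t} ∩ {t : ℝ | (t : EReal) < T} := by
    ext t
    simp only [positiveTimes, timeInterval, mem_ofPred_eq, mem_inter_iff]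
    exact ⟨fun h => ⟨h.2, h.1.2⟩, fun h => ⟨⟨h.1.le, h.2⟩, h.1⟩⟩
  rw [h]
  exact (isOpen_lt continuous_const continuous_id).inter
    (isOpen_lt continuous_coe_real_ereal continuous_const)

/-- The matrix `h g⁻¹` of the Weingarten map in the coordinate frame. -/
noncomputable def patchWeingarten {n : ℕ} (s : Set (SpaceTime n)) (F N : SpaceTime n → Ambient n)
    (k l : Fin n) (x : SpaceTime n) : ℝ :=
  ((Matrix.of fun i j => ⟪spaceDeriv s (basisVec i) N x, spaceDeriv s (basisVec j) F x⟫)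
    * (Matrix.of fun i j =>
      ⟪spaceDeriv s (basisVec i) F x, spaceDeriv s (basisVec j) F x⟫)⁻¹) k l

variable {n : ℕ} [NeZero n] {M : Type*} [TopologicalSpace M]
  [ChartedSpace (EuclideanHalfSpace n) M]
  [IsManifold (𝓡∂ n) ∞ M] [MeasurableSpace M] {c : Constraint} {α θ : ℝ} {T : EReal}
  {X ν : ℝ → M → Ambient n}
  {p₀ : M} {ψ : EuclideanSpace ℝ (Fin n) → EuclideanSpace ℝ (Fin n)}
  {U : Set (EuclideanSpace ℝ (Fin n))}

omit [IsManifold (𝓡∂ n) ∞ M] [MeasurableSpace M] in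
theorem inner_diff_unit_normal {N : M → Ambient n} {p : M}
    (hN : MDifferentiableAt (𝓡∂ n) 𝓘(ℝ, Ambient n) N p) (h1 : ∀ p, ‖N p‖ = 1)
    (v : TangentSpace (𝓡∂ n) p) : ⟪diff N p v, N p⟫ = 0 := by
  have h2 : HasMFDerivAt (𝓡∂ n) 𝓘(ℝ, ℝ) (fun y => ⟪N y, N y⟫) p
      ((fderivInnerCLM ℝ (N p, N p)).comp
        ((mfderiv (𝓡∂ n) 𝓘(ℝ, Ambient n) N p).prod (mfderiv (𝓡∂ n) 𝓘(ℝ, Ambient n) N p))) := by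
    have h3 : HasFDerivAt (fun y : Ambient n => ⟪y, y⟫) ((fderivInnerCLM ℝ (N p, N p)).comp
        ((ContinuousLinearMap.id ℝ _).prod (ContinuousLinearMap.id ℝ _))) (N p) :=
      (hasFDerivAt_id (𝕜 := ℝ) (N p)).inner ℝ (hasFDerivAt_id (𝕜 := ℝ) (N p))
    exact h3.hasMFDerivAt.comp p hN.hasMFDerivAt
  have h4 : (fun y => ⟪N y, N y⟫) = fun _ => (1 : ℝ) := by
    funext y; rw [real_inner_self_eq_norm_sq, h1, one_pow]
  rw [h4] at h2
  have h5 := DFunLike.congr_fun (hasMFDerivAt_unique h2 (hasMFDerivAt_const (1 : ℝ) p)) v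
  have h6 : ⟪N p, diff N p v⟫ + ⟪diff N p v, N p⟫ = 0 := by
    exact h5
  rw [real_inner_comm] at h6
  linarith

namespace IsSolution

variable (hX : IsSolution c α θ T X ν)
include hX

theorem mdifferentiable {t : ℝ} (ht : t ∈ timeInterval T) (p : M) :
    MDifferentiableAt (𝓡∂ n) 𝓘(ℝ, Ambient n) (X t) p :=
  (hX.capillary t ht).smooth.mdifferentiable (by simp) p

theorem mdifferentiable_normal {t : ℝ} (ht : t ∈ timeInterval T) (p : M) :
    MDifferentiableAt (𝓡∂ n) 𝓘(ℝ, Ambient n) (ν t) p :=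
  (hX.capillary t ht).outwardNormal.smooth.mdifferentiable (by simp) p

theorem exists_weingarten_map {t : ℝ} (ht : t ∈ timeInterval T) (p : M) :
    ∃ w : EuclideanSpace ℝ (Fin n) →ₗ[ℝ] EuclideanSpace ℝ (Fin n),
      ∀ v : EuclideanSpace ℝ (Fin n), diff (ν t) p v = diff (X t) p (w v) := by
  have hcap := hX.capillary t ht
  exact exists_weingarten (ν := ν t p)
    (dF := (mfderiv (𝓡∂ n) 𝓘(ℝ, Ambient n) (X t) p).toLinearMap)
    (dN := (mfderiv (𝓡∂ n) 𝓘(ℝ, Ambient n) (ν t) p).toLinearMap)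
    (hcap.immersion p) (hcap.outwardNormal.unit p) (hcap.outwardNormal.normal p)
    (inner_diff_unit_normal (hX.mdifferentiable_normal ht p) hcap.outwardNormal.unit)

variable (hc : IsChartChange p₀ ψ U) (hdom : IsCalculusDomain (positiveTimes T ×ˢ U))
include hc

theorem smooth_patch : ContDiffOn ℝ ∞ (fun x : SpaceTime n => X x.1 (chartParam p₀ ψ x.2))
    (positiveTimes T ×ˢ U) := hc.contDiffOn_comp hX.smooth.smooth

theorem smooth_patch_normal :
    ContDiffOn ℝ ∞ (fun x : SpaceTime n => ν x.1 (chartParam p₀ ψ x.2))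
      (positiveTimes T ×ˢ U) := hc.contDiffOn_comp hX.smooth_normal.smooth

theorem spaceDeriv_patch {x : SpaceTime n} (hx : x ∈ positiveTimes T ×ˢ U)
    (v : EuclideanSpace ℝ (Fin n)) :
    spaceDeriv (positiveTimes T ×ˢ U) v (fun x : SpaceTime n => X x.1 (chartParam p₀ ψ x.2)) x
      = diff (X x.1) (chartParam p₀ ψ x.2) (chartParamDeriv p₀ ψ x.2 v) :=
  hc.spaceDeriv_comp hx.1 hx.2 (diffWithinAt (hX.smooth_patch hc) hx)
    (hX.mdifferentiable hx.1.1 _) v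

theorem spaceDeriv_patch_normal {x : SpaceTime n} (hx : x ∈ positiveTimes T ×ˢ U)
    (v : EuclideanSpace ℝ (Fin n)) :
    spaceDeriv (positiveTimes T ×ˢ U) v (fun x : SpaceTime n => ν x.1 (chartParam p₀ ψ x.2)) x
      = diff (ν x.1) (chartParam p₀ ψ x.2) (chartParamDeriv p₀ ψ x.2 v) :=
  hc.spaceDeriv_comp hx.1 hx.2 (diffWithinAt (hX.smooth_patch_normal hc) hx)
    (hX.mdifferentiable_normal hx.1.1 _) v

theorem timeDeriv_patch {x : SpaceTime n} (hx : x ∈ positiveTimes T ×ˢ U) :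
    timeDeriv (positiveTimes T ×ˢ U) (fun x : SpaceTime n => X x.1 (chartParam p₀ ψ x.2)) x
      = -((meanCurv (X x.1) (ν x.1) (chartParam p₀ ψ x.2) ^ α
          - nonlocalTerm α θ (X x.1) (ν x.1) c) •
        (ν x.1 (chartParam p₀ ψ x.2) - Real.cos θ • vertical n)) := by
  obtain ⟨t, z⟩ := x
  have h1 := hX.evolution t hx.1.1 (chartParam p₀ ψ z)
  have h2 : HasDerivAt (fun s => X s (chartParam p₀ ψ z)) _ t := h1.hasDerivAt (Ici_mem_nhds hx.1.2)
  have hev : ∀ᶠ η in 𝓝[>] (0 : ℝ), t + η ∈ positiveTimes T := by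
    refine nhdsWithin_le_nhds ?_
    have hcont : Continuous fun η : ℝ => t + η := by fun_prop
    exact hcont.continuousAt.eventually_mem
      ((isOpen_positiveTimes T).mem_nhds (by simpa using hx.1))
  obtain ⟨δ, hδ, hI⟩ := mem_nhdsGT_iff_exists_Ioo_subset.1 hev
  have hmem : ∀ η ∈ Ico (0 : ℝ) δ, t + η ∈ positiveTimes T := by
    intro η hη
    rcases hη.1.eq_or_lt with h | h
    · subst h; simpa using hx.1
    · exact hI ⟨h, hη.2⟩
  have h3 := hasDerivWithinAt_dirDeriv (v := ((1 : ℝ), (0 : EuclideanSpace ℝ (Fin n))))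
    (I := Ico 0 δ) (hX.smooth_patch hc) hx (fun η hη => ⟨by simpa using hmem η hη, by
      simpa using hx.2⟩)
  have h4 : HasDerivAt (fun η : ℝ => X (t + η) (chartParam p₀ ψ z)) _ 0 :=
    HasDerivAt.comp_const_add t 0 (by simpa using h2)
  have h5 : (fun η : ℝ => X (((t, z) : SpaceTime n) + η • ((1 : ℝ),
        (0 : EuclideanSpace ℝ (Fin n)))).1 (chartParam p₀ ψ (((t, z) : SpaceTime n)
          + η • ((1 : ℝ), (0 : EuclideanSpace ℝ (Fin n)))).2))
      = fun η : ℝ => X (t + η) (chartParam p₀ ψ z) := by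
    funext η; simp
  rw [h5] at h3
  rw [timeDeriv, (uniqueDiffOn_Ico (0 : ℝ) δ 0 ⟨le_rfl, hδ⟩).eq_deriv _ h3 h4.hasDerivWithinAt]
  rw [← neg_smul, neg_sub]

include hdom

/-- A solution of the flow defines a flow patch in any admissible coordinates. -/
theorem flowPatch (hθ : θ ∈ Ioo 0 (Real.pi / 2)) :
    FlowPatch α θ (positiveTimes T ×ˢ U) (fun x => X x.1 (chartParam p₀ ψ x.2))
      (fun x => ν x.1 (chartParam p₀ ψ x.2))
      (patchWeingarten (positiveTimes T ×ˢ U) (fun x => X x.1 (chartParam p₀ ψ x.2))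
        (fun x => ν x.1 (chartParam p₀ ψ x.2)))
      (fun x => meanCurv (X x.1) (ν x.1) (chartParam p₀ ψ x.2))
      (fun x => meanCurv (X x.1) (ν x.1) (chartParam p₀ ψ x.2) ^ α
        - nonlocalTerm α θ (X x.1) (ν x.1) c) := by
  set s : Set (SpaceTime n) := positiveTimes T ×ˢ U with hs
  set F : SpaceTime n → Ambient n := fun x => X x.1 (chartParam p₀ ψ x.2) with hFdef
  set N : SpaceTime n → Ambient n := fun x => ν x.1 (chartParam p₀ ψ x.2) with hNdef
  set H : SpaceTime n → ℝ := fun x => meanCurv (X x.1) (ν x.1) (chartParam p₀ ψ x.2) with hHdef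
  set q : SpaceTime n → ℝ := fun x => H x ^ α - nonlocalTerm α θ (X x.1) (ν x.1) c with hqdef
  have sF : ContDiffOn ℝ ∞ F s := hX.smooth_patch hc
  have sN : ContDiffOn ℝ ∞ N s := hX.smooth_patch_normal hc
  have dF : ∀ x ∈ s, ∀ v, spaceDeriv s v F x = _ := fun x hx v => hX.spaceDeriv_patch hc hx v
  have dN : ∀ x ∈ s, ∀ v, spaceDeriv s v N x = _ := fun x hx v => hX.spaceDeriv_patch_normal hc hx v
  have hframe : ∀ x ∈ s,
      (∀ k, spaceDeriv s (basisVec k) N x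
        = ∑ l, patchWeingarten s F N k l x • spaceDeriv s (basisVec l) F x)
      ∧ H x = ∑ k, patchWeingarten s F N k k x
      ∧ (Matrix.of fun i j =>
          ⟪spaceDeriv s (basisVec i) F x, spaceDeriv s (basisVec j) F x⟫).det ≠ 0 := by
    intro x hx
    obtain ⟨w, hw⟩ := hX.exists_weingarten_map hx.1.1 (chartParam p₀ ψ x.2)
    obtain ⟨b, hb⟩ := hc.exists_basis hx.2
    have hinj := (hX.capillary x.1 hx.1.1).immersion (chartParam p₀ ψ x.2)
    have eF : ∀ i, spaceDeriv s (basisVec i) F x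
        = (mfderiv (𝓡∂ n) 𝓘(ℝ, Ambient n) (X x.1) (chartParam p₀ ψ x.2)).toLinearMap (b i) :=
      fun i => by rw [dF x hx, hb]; rfl
    have eN : ∀ i, spaceDeriv s (basisVec i) N x
        = (mfderiv (𝓡∂ n) 𝓘(ℝ, Ambient n) (ν x.1) (chartParam p₀ ψ x.2)).toLinearMap (b i) :=
      fun i => by rw [dN x hx, hb]; rfl
    refine ⟨fun k => ?_, ?_, ?_⟩
    · simp only [patchWeingarten, eF, eN]
      exact weingarten_apply_basis (dF := (mfderiv (𝓡∂ n) 𝓘(ℝ, Ambient n) (X x.1)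
        (chartParam p₀ ψ x.2)).toLinearMap) (dN := (mfderiv (𝓡∂ n) 𝓘(ℝ, Ambient n) (ν x.1)
        (chartParam p₀ ψ x.2)).toLinearMap) hinj hw b k
    · simp only [patchWeingarten, eF, eN, hHdef]
      rw [meanCurv_eq_trace hinj hw]
      exact (trace_weingarten (dF := (mfderiv (𝓡∂ n) 𝓘(ℝ, Ambient n) (X x.1)
        (chartParam p₀ ψ x.2)).toLinearMap) (dN := (mfderiv (𝓡∂ n) 𝓘(ℝ, Ambient n) (ν x.1)
        (chartParam p₀ ψ x.2)).toLinearMap) hinj hw b).symm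
    · simp only [eF]
      exact det_gram_ne_zero (dF := (mfderiv (𝓡∂ n) 𝓘(ℝ, Ambient n) (X x.1)
        (chartParam p₀ ψ x.2)).toLinearMap) hinj b
  have sF1 := fun v => ContDiffOn.dirDeriv hdom sF v
  have sN1 := fun v => ContDiffOn.dirDeriv hdom sN v
  have sA : ∀ k l, ContDiffOn ℝ ∞ (patchWeingarten s F N k l) s := fun k l =>
    contDiffOn_mul_matrix_inv
      (G := fun x => Matrix.of fun i j =>
        ⟪spaceDeriv s (basisVec i) F x, spaceDeriv s (basisVec j) F x⟫)
      (h := fun x => Matrix.of fun i j =>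
        ⟪spaceDeriv s (basisVec i) N x, spaceDeriv s (basisVec j) F x⟫)
      (fun i j => (sF1 _).inner ℝ (sF1 _)) (fun i j => (sN1 _).inner ℝ (sF1 _))
      (fun x hx => (hframe x hx).2.2) k l
  have sH : ContDiffOn ℝ ∞ H s :=
    (ContDiffOn.sum fun k _ => sA k k).congr fun x hx => (hframe x hx).2.1
  have hHpos : ∀ x ∈ s, 0 < H x := fun x hx => hX.meanCurv_pos x.1 hx.1.1 _
  have hunit : ∀ x ∈ s, ⟪N x, N x⟫ = 1 := fun x hx => by
    rw [real_inner_self_eq_norm_sq, (hX.capillary x.1 hx.1.1).outwardNormal.unit, one_pow]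
  have hevol : ∀ x ∈ s, timeDeriv s F x = -(q x • (N x - Real.cos θ • vertical n)) :=
    fun x hx => hX.timeDeriv_patch hc hx
  have sP : ContDiffOn ℝ ∞ (fun x => H x ^ α) s :=
    sH.rpow_const_of_ne fun x hx => (hHpos x hx).ne'
  have hcos : Real.cos θ < 1 := by
    rw [← Real.cos_zero]
    exact Real.cos_lt_cos_of_nonneg_of_le_pi_div_two le_rfl hθ.2.le hθ.1
  have hcos0 : 0 < Real.cos θ := Real.cos_pos_of_mem_Ioo ⟨by linarith [hθ.1, Real.pi_pos], hθ.2⟩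
  have hu : ∀ x ∈ s, 1 - Real.cos θ * ⟪N x, vertical n⟫ ≠ 0 := fun x hx => by
    have := (abs_le.1 (abs_inner_vertical_le (hunit x hx))).2
    nlinarith
  -- the speed is smooth, being determined by the normal component of the evolution equation
  have sq : ContDiffOn ℝ ∞ q s := by
    have h1 : ContDiffOn ℝ ∞ (fun x => -⟪timeDeriv s F x, N x⟫
        / (1 - Real.cos θ * ⟪N x, vertical n⟫)) s :=
      (((ContDiffOn.dirDeriv hdom sF _).inner ℝ sN).neg).div
        (contDiffOn_const.sub (contDiffOn_const.mul (sN.inner ℝ contDiffOn_const))) hu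
    refine h1.congr fun x hx => ?_
    rw [hevol x hx, eq_div_iff (hu x hx), inner_neg_left, inner_smul_left, inner_sub_left,
      inner_smul_left, hunit x hx, real_inner_comm]
    simp
  refine ⟨hdom, sF, sN, sA, sH, sq, hunit, fun a x hx => ?_, fun k x hx => (hframe x hx).1 k,
    fun x hx => (hframe x hx).2.1, hHpos, hevol, fun a x hx => ?_⟩
  · rw [dF x hx]
    exact (hX.capillary x.1 hx.1.1).outwardNormal.normal _ _
  · -- the nonlocal term is smooth in time and does not depend on the space variable
    set φ : ℝ → ℝ := fun t => nonlocalTerm α θ (X t) (ν t) c with hφ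
    have hφx : DifferentiableWithinAt ℝ φ (positiveTimes T) x.1 := by
      have h1 : DifferentiableWithinAt ℝ (fun t => H (t, x.2) ^ α - q (t, x.2))
          (positiveTimes T) x.1 := by
        have h2 : DifferentiableWithinAt ℝ (fun y => H y ^ α - q y) s (x.1, x.2) :=
          diffWithinAt (sP.sub sq) hx
        exact h2.comp x.1 (f := fun t : ℝ => ((t, x.2) : SpaceTime n)) (by fun_prop)
          fun t ht => ⟨ht, hx.2⟩
      refine h1.congr (fun t _ => ?_) ?_ <;> simp [hqdef, hφ]
    have h3 : HasFDerivWithinAt (fun y : SpaceTime n => φ y.1)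
        ((fderivWithin ℝ φ (positiveTimes T) x.1).comp (ContinuousLinearMap.fst ℝ ℝ _)) s x :=
      hφx.hasFDerivWithinAt.comp x hasFDerivWithinAt_fst fun y hy => hy.1
    have h4 := ((diffWithinAt sP hx).hasFDerivWithinAt.sub h3).fderivWithin (hdom.uniqueDiffOn x hx)
    have h5 : spaceDeriv s a q x = spaceDeriv s a (fun y => H y ^ α) x := by
      have h6 : spaceDeriv s a q x = (fderivWithin ℝ (fun x => H x ^ α) s x -
          (fderivWithin ℝ φ (positiveTimes T) x.1).comp
            (ContinuousLinearMap.fst ℝ ℝ (EuclideanSpace ℝ (Fin n)))) ((0 : ℝ), a) :=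
        DFunLike.congr_fun h4 ((0 : ℝ), a)
      rw [h6]
      simp [spaceDeriv, dirDeriv]
    rw [h5]
    exact dirDeriv_rpow hdom sH (hHpos x hx) α _ hx

end IsSolution

end SolutionPatch

/-! ### Adapted coordinates -/

section Coordinates

variable {n : ℕ}

/-- Linear coordinates in which an injective linear map becomes isometric, with a prescribed image
of the first coordinate vector. -/
theorem exists_isometric_coordinates [NeZero n] {dX : EuclideanSpace ℝ (Fin n) →ₗ[ℝ] Ambient n}
    (hinj : Function.Injective dX) {m : Ambient n} (hm : m ∈ LinearMap.range dX) (hm1 : ‖m‖ = 1) :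
    ∃ L : EuclideanSpace ℝ (Fin n) →L[ℝ] EuclideanSpace ℝ (Fin n), Function.Injective L
      ∧ (∀ a b, ⟪dX (L a), dX (L b)⟫ = ⟪a, b⟫) ∧ dX (L (basisVec 0)) = m := by
  have hfin : Module.finrank ℝ (LinearMap.range dX) = Fintype.card (Fin n) := by
    rw [LinearMap.finrank_range_of_inj hinj]; simp
  have hon : Orthonormal ℝ (({0} : Set (Fin n)).domRestrict
      fun _ => (⟨m, hm⟩ : LinearMap.range dX)) := by
    rw [orthonormal_iff_ite]
    rintro ⟨i, hi⟩ ⟨j, hj⟩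
    obtain rfl : i = 0 := hi
    obtain rfl : j = 0 := hj
    simp [hm1]
  obtain ⟨b, hb⟩ := hon.exists_orthonormalBasis_extension_of_card_eq hfin
  let e := LinearEquiv.ofInjective dX hinj
  let L : EuclideanSpace ℝ (Fin n) →ₗ[ℝ] EuclideanSpace ℝ (Fin n) :=
    e.symm.toLinearMap ∘ₗ b.repr.symm.toLinearEquiv.toLinearMap
  have hL : ∀ a, dX (L a) = (b.repr.symm a : LinearMap.range dX) := fun a => by
    have := LinearEquiv.apply_symm_apply e (b.repr.symm a)
    exact congrArg Subtype.val this
  refine ⟨LinearMap.toContinuousLinearMap L, ?_, fun a c => ?_, ?_⟩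
  · exact e.symm.injective.comp b.repr.symm.injective
  · rw [LinearMap.coe_toContinuousLinearMap', hL, hL, ← Submodule.coe_inner,
      LinearIsometryEquiv.inner_map_map]
  · rw [LinearMap.coe_toContinuousLinearMap', hL, b.repr_symm_single, hb 0 rfl]

/-- A vector orthogonal to the range of the differential is a multiple of the normal. -/
theorem eq_inner_smul_normal {dF : EuclideanSpace ℝ (Fin n) →ₗ[ℝ] Ambient n} {ν y : Ambient n}
    (hF : Function.Injective dF) (hν : ‖ν‖ = 1) (hFν : ∀ v, ⟪dF v, ν⟫ = 0)
    (hy : ∀ v, ⟪y, dF v⟫ = 0) : y = ⟪y, ν⟫ • ν := by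
  have hmem : y - ⟪y, ν⟫ • ν ∈ LinearMap.range dF := by
    rw [range_eq_orthogonal hF hν hFν, Submodule.mem_orthogonal_singleton_iff_inner_left,
      inner_sub_left, inner_smul_left, real_inner_self_eq_norm_sq, hν]
    simp
  obtain ⟨v, hv⟩ := hmem
  have h : ⟪y - ⟪y, ν⟫ • ν, y - ⟪y, ν⟫ • ν⟫ = 0 := by
    nth_rewrite 2 [← hv]
    have h' : ⟪ν, dF v⟫ = 0 := by rw [real_inner_comm]; exact hFν v
    rw [inner_sub_left, inner_smul_left, hy, h']
    simp
  exact sub_eq_zero.1 (inner_self_eq_zero.1 h)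

section NormalCoordinates

/-- The quadratic change of coordinates `z ↦ z - Γ(z, z) / 2`. -/
noncomputable def quadraticChange
    (Γ : EuclideanSpace ℝ (Fin n) →L[ℝ] EuclideanSpace ℝ (Fin n) →L[ℝ] EuclideanSpace ℝ (Fin n))
    (z : EuclideanSpace ℝ (Fin n)) : EuclideanSpace ℝ (Fin n) := z - (2 : ℝ)⁻¹ • Γ z z

variable {Γ : EuclideanSpace ℝ (Fin n) →L[ℝ] EuclideanSpace ℝ (Fin n) →L[ℝ]
    EuclideanSpace ℝ (Fin n)}

theorem contDiff_quadraticChange : ContDiff ℝ ∞ (quadraticChange Γ) := by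
  unfold quadraticChange
  fun_prop

theorem hasFDerivAt_quadraticChange (z : EuclideanSpace ℝ (Fin n)) :
    HasFDerivAt (quadraticChange Γ)
      (ContinuousLinearMap.id ℝ _ - (2 : ℝ)⁻¹ • (Γ z + Γ.flip z)) z := by
  have h1 : HasFDerivAt (fun z => Γ z z) (Γ z + Γ.flip z) z := by
    have h := (Γ.hasFDerivAt (x := z)).clm_apply (hasFDerivAt_id z)
    refine h.congr_fderiv ?_
    ext
    simp
  exact (hasFDerivAt_id z).sub (h1.const_smul (2 : ℝ)⁻¹)

variable {F₀ : SpaceTime n → Ambient n} {s₀ s : Set (SpaceTime n)}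

/-- In the coordinates obtained from a suitable quadratic change, the second derivatives of a
parametrization that is isometric at the origin become normal there; the first derivatives do not
change. -/
theorem exists_normal_coordinates (hs₀ : IsOpen s₀) (hF₀ : ContDiffOn ℝ ∞ F₀ s₀) {t : ℝ}
    (ht : ((t, 0) : SpaceTime n) ∈ s₀)
    (hon : ∀ a b, ⟪spaceDeriv s₀ a F₀ (t, 0), spaceDeriv s₀ b F₀ (t, 0)⟫ = ⟪a, b⟫) :
    ∃ Γ : EuclideanSpace ℝ (Fin n) →L[ℝ] EuclideanSpace ℝ (Fin n) →L[ℝ] EuclideanSpace ℝ (Fin n),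
      ∀ s : Set (SpaceTime n), IsOpen s → ((t, 0) : SpaceTime n) ∈ s →
        (∀ x ∈ s, ((x.1, quadraticChange Γ x.2) : SpaceTime n) ∈ s₀) →
        (∀ a, spaceDeriv s a (fun x => F₀ (x.1, quadraticChange Γ x.2)) (t, 0)
            = spaceDeriv s₀ a F₀ (t, 0)) ∧
        ∀ a b w, ⟪spaceDeriv s a (spaceDeriv s b (fun x => F₀ (x.1, quadraticChange Γ x.2))) (t, 0),
          spaceDeriv s w (fun x => F₀ (x.1, quadraticChange Γ x.2)) (t, 0)⟫ = 0 := by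
  set inr := ContinuousLinearMap.inr ℝ ℝ (EuclideanSpace ℝ (Fin n)) with hinr
  set D1 : SpaceTime n → SpaceTime n →L[ℝ] Ambient n := fderiv ℝ F₀ with hD1
  have hd0 : ∀ x ∈ s₀, HasFDerivAt F₀ (D1 x) x := fun x hx =>
    ((diffWithinAt hF₀ hx).differentiableAt (hs₀.mem_nhds hx)).hasFDerivAt
  have sD1 : ContDiffOn ℝ ∞ D1 s₀ := hF₀.fderiv_of_isOpen hs₀ (by simp)
  set D2 : SpaceTime n →L[ℝ] SpaceTime n →L[ℝ] Ambient n := fderiv ℝ D1 (t, 0) with hD2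
  have hd1 : HasFDerivAt D1 D2 (t, 0) :=
    ((diffWithinAt sD1 ht).differentiableAt (hs₀.mem_nhds ht)).hasFDerivAt
  have hsymm : ∀ v w, D2 v w = D2 w v := fun v w =>
    second_derivative_symmetric_of_eventually
      (Filter.eventually_of_mem (hs₀.mem_nhds ht) hd0) hd1 v w
  have hsp : ∀ a, spaceDeriv s₀ a F₀ (t, 0) = D1 (t, 0) (inr a) := fun a => by
    rw [spaceDeriv, dirDeriv, (hd0 _ ht).hasFDerivWithinAt.fderivWithin
      (hs₀.uniqueDiffOn _ ht)]
    rfl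
  -- the tangential projection, read in the orthonormal frame
  let P : Ambient n →L[ℝ] EuclideanSpace ℝ (Fin n) :=
    ∑ k, ((innerSL ℝ (D1 (t, 0) (inr (basisVec k)))).smulRight (basisVec k))
  let Γ : EuclideanSpace ℝ (Fin n) →L[ℝ] EuclideanSpace ℝ (Fin n) →L[ℝ] EuclideanSpace ℝ (Fin n) :=
    (ContinuousLinearMap.compL ℝ _ _ _ P).comp (D2.bilinearComp inr inr)
  have hΓ : ∀ a b, Γ a b = P (D2 (inr a) (inr b)) := fun a b => rfl
  have hΓsymm : ∀ a b, Γ a b = Γ b a := fun a b => by rw [hΓ, hΓ, hsymm]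
  refine ⟨Γ, fun s hs hts hmaps => ?_⟩
  have hχ0 : quadraticChange Γ 0 = 0 := by simp [quadraticChange]
  set Ψ : SpaceTime n → SpaceTime n := fun x => (x.1, quadraticChange Γ x.2) with hΨ
  have hΨ0 : Ψ (t, 0) = (t, 0) := by simp [hΨ, hχ0]
  -- the derivative of the change of coordinates
  set DΨ : SpaceTime n → SpaceTime n →L[ℝ] SpaceTime n := fun x =>
    (ContinuousLinearMap.fst ℝ ℝ _).prod ((ContinuousLinearMap.id ℝ _
      - (2 : ℝ)⁻¹ • (Γ x.2 + Γ.flip x.2)).comp (ContinuousLinearMap.snd ℝ ℝ _)) with hDΨ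
  have hdΨ : ∀ x, HasFDerivAt Ψ (DΨ x) x := fun x =>
    hasFDerivAt_fst.prodMk ((hasFDerivAt_quadraticChange x.2).comp x hasFDerivAt_snd)
  have hDΨinr : ∀ x b, DΨ x (inr b) = inr (b - Γ.flip b x.2) := fun x b => by
    have h2 : (2 : ℝ)⁻¹ • (Γ x.2 b + Γ b x.2) = Γ x.2 b := by
      rw [hΓsymm b, ← two_smul ℝ, smul_smul]; norm_num
    rw [smul_add] at h2
    simp [hDΨ, hinr, h2]
  have hfirst : ∀ x ∈ s, ∀ b, spaceDeriv s b (fun x => F₀ (Ψ x)) x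
      = D1 (Ψ x) (inr (b - Γ.flip b x.2)) := fun x hx b => by
    have h := (hd0 _ (hmaps x hx)).comp x (hdΨ x)
    have h' : fderivWithin ℝ (fun x => F₀ (Ψ x)) s x = _ :=
      h.hasFDerivWithinAt.fderivWithin (hs.uniqueDiffOn x hx)
    rw [spaceDeriv, dirDeriv, h', ← hDΨinr]
    rfl
  have hfirst0 : ∀ b, spaceDeriv s b (fun x => F₀ (Ψ x)) (t, 0) = D1 (t, 0) (inr b) := fun b => by
    rw [hfirst _ hts, hΨ0]; simp
  refine ⟨fun a => by rw [hsp]; exact hfirst0 a, fun a b w => ?_⟩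
  have hsecond : spaceDeriv s a (spaceDeriv s b (fun x => F₀ (Ψ x))) (t, 0)
      = D2 (inr a) (inr b) - D1 (t, 0) (inr (Γ a b)) := by
    have h1 : HasFDerivAt (fun x => D1 (Ψ x)) (D2.comp (DΨ (t, 0))) (t, 0) := by
      have hd1' : HasFDerivAt D1 D2 (Ψ (t, 0)) := by rw [hΨ0]; exact hd1
      exact hd1'.comp (t, 0) (hdΨ (t, 0))
    have h2 : HasFDerivAt (fun x : SpaceTime n => inr (b - Γ.flip b x.2))
        (inr.comp (-((Γ.flip b).comp (ContinuousLinearMap.snd ℝ ℝ _)))) (t, 0) := by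
      have h3 : HasFDerivAt (fun x : SpaceTime n => b - Γ.flip b x.2)
          (-((Γ.flip b).comp (ContinuousLinearMap.snd ℝ ℝ _))) (t, 0) :=
        (((Γ.flip b).hasFDerivAt).comp (t, (0 : EuclideanSpace ℝ (Fin n)))
          hasFDerivAt_snd).const_sub b
      exact inr.hasFDerivAt.comp (t, (0 : EuclideanSpace ℝ (Fin n))) h3
    have h4 := h1.clm_apply h2
    have h5 := ((h4.hasFDerivWithinAt (s := s)).congr (fun x hx => hfirst x hx b)
      (hfirst _ hts b)).fderivWithin (hs.uniqueDiffOn _ hts)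
    refine (DFunLike.congr_fun h5 ((0 : ℝ), a)).trans ?_
    have h6 : DΨ (t, 0) (0, a) = inr a := by
      have := hDΨinr (t, 0) a
      simpa [hinr] using this
    simp only [add_apply, ContinuousLinearMap.comp_apply,
      ContinuousLinearMap.flip_apply, h6, hΨ0, neg_apply, map_zero, sub_zero,
      ContinuousLinearMap.coe_snd', map_neg]
    abel
  have hP : ∀ y : Ambient n, ⟪D1 (t, 0) (inr (P y)), D1 (t, 0) (inr w)⟫
      = ⟪y, D1 (t, 0) (inr w)⟫ := fun y => by
    have h1 : inr w = ∑ k, w k • inr (basisVec k) := by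
      simp only [← map_smul, ← map_sum]
      congr 1
      ext i
      simp [Finset.sum_apply, Pi.single_apply]
    have h2 := hon (P y) w
    rw [hsp, hsp] at h2
    rw [h2, h1, map_sum, inner_sum]
    simp only [map_smul, inner_smul_right, P, sum_apply,
      ContinuousLinearMap.smulRight_apply, innerSL_apply_apply, sum_inner, inner_smul_left]
    refine Finset.sum_congr rfl fun k _ => ?_
    rw [real_inner_comm y]
    simp [EuclideanSpace.inner_single_left, mul_comm]
  rw [hsecond, hfirst0, inner_sub_left, hΓ, hP, sub_self]

end NormalCoordinates

end Coordinates

/-! ### No null vector in the interior -/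

section AffineChart

variable {n : ℕ} [NeZero n] {M : Type*} [TopologicalSpace M]
  [ChartedSpace (EuclideanHalfSpace n) M]

/-- The target of a chart is relatively open in the half-space. -/
theorem exists_isOpen_extChartAt_target (p₀ : M) :
    ∃ O : Set (EuclideanSpace ℝ (Fin n)), IsOpen O
      ∧ (extChartAt (𝓡∂ n) p₀).target = O ∩ {y | 0 ≤ y 0} := by
  refine ⟨(𝓡∂ n).symm ⁻¹' (chartAt (EuclideanHalfSpace n) p₀).target, ?_, ?_⟩
  · exact (chartAt _ p₀).open_target.preimage (𝓡∂ n).continuous_symm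
  · rw [extChartAt_target, range_modelWithCornersEuclideanHalfSpace]

/-- The affine change of coordinates centred at the point `p₀`, with linear part `L`. -/
noncomputable def affineChange (p₀ : M)
    (L : EuclideanSpace ℝ (Fin n) →L[ℝ] EuclideanSpace ℝ (Fin n)) (z : EuclideanSpace ℝ (Fin n)) :
    EuclideanSpace ℝ (Fin n) := extChartAt (𝓡∂ n) p₀ p₀ + L z

/-- The differential at `p₀` of a surface, in the coordinates given by the chart at `p₀`. -/
noncomputable def chartDiff (p₀ : M) (G : M → Ambient n) :
    EuclideanSpace ℝ (Fin n) →ₗ[ℝ] Ambient n :=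
  (mfderiv (𝓡∂ n) 𝓘(ℝ, Ambient n) G p₀).toLinearMap ∘ₗ
    (mfderivWithin 𝓘(ℝ, EuclideanSpace ℝ (Fin n)) (𝓡∂ n) (extChartAt (𝓡∂ n) p₀).symm
      (range (𝓡∂ n)) (extChartAt (𝓡∂ n) p₀ p₀)).toLinearMap

variable {p₀ : M} {L : EuclideanSpace ℝ (Fin n) →L[ℝ] EuclideanSpace ℝ (Fin n)}
  {χ : EuclideanSpace ℝ (Fin n) → EuclideanSpace ℝ (Fin n)}
  {U : Set (EuclideanSpace ℝ (Fin n))}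

theorem affineChange_zero : affineChange p₀ L 0 = extChartAt (𝓡∂ n) p₀ p₀ := by
  simp [affineChange]

theorem contDiff_affineChange : ContDiff ℝ ∞ (affineChange p₀ L) := by
  unfold affineChange
  fun_prop

theorem hasFDerivAt_affineChange (z : EuclideanSpace ℝ (Fin n)) :
    HasFDerivAt (affineChange p₀ L) L z := L.hasFDerivAt.const_add _

theorem chartParam_affineChange_zero : chartParam p₀ (affineChange p₀ L) 0 = p₀ := by
  rw [chartParam, affineChange_zero, extChartAt_to_inv]

theorem IsChartChange.affineChange (hL : Function.Injective L)
    (hU : ∀ z ∈ U, affineChange p₀ L z ∈ (extChartAt (𝓡∂ n) p₀).target) (hd : UniqueDiffOn ℝ U) :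
    IsChartChange p₀ (affineChange p₀ L) U :=
  ⟨contDiff_affineChange, hU, fun z _ => by rwa [(hasFDerivAt_affineChange z).fderiv], hd⟩

theorem diff_chartParamDeriv_affineChange (G : M → Ambient n) (a : EuclideanSpace ℝ (Fin n)) :
    diff G (chartParam p₀ (affineChange p₀ L) 0) (chartParamDeriv p₀ (affineChange p₀ L) 0 a)
      = chartDiff p₀ G (L a) := by
  have h : ∀ (y : EuclideanSpace ℝ (Fin n)) (p : M), y = extChartAt (𝓡∂ n) p₀ p₀ → p = p₀ →
      ∀ b : EuclideanSpace ℝ (Fin n), mfderiv (𝓡∂ n) 𝓘(ℝ, Ambient n) G p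
        (mfderivWithin 𝓘(ℝ, EuclideanSpace ℝ (Fin n)) (𝓡∂ n) (extChartAt (𝓡∂ n) p₀).symm
          (range (𝓡∂ n)) y b) = chartDiff p₀ G b := by
    rintro y p rfl rfl b
    rfl
  have h2 : fderiv ℝ (CapillaryFlow.affineChange p₀ L) 0 = L := (hasFDerivAt_affineChange 0).fderiv
  refine Eq.trans ?_ (h _ _ (affineChange_zero (p₀ := p₀) (L := L))
    (chartParam_affineChange_zero (L := L)) (L a))
  exact congrArg (fun b : EuclideanSpace ℝ (Fin n) => mfderiv (𝓡∂ n) 𝓘(ℝ, Ambient n) G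
    (chartParam p₀ (CapillaryFlow.affineChange p₀ L) 0)
    (mfderivWithin 𝓘(ℝ, EuclideanSpace ℝ (Fin n)) (𝓡∂ n) (extChartAt (𝓡∂ n) p₀).symm
      (range (𝓡∂ n)) (CapillaryFlow.affineChange p₀ L 0) b)) (DFunLike.congr_fun h2 a)

end AffineChart

/-- Second derivatives without tangential part are given by the second fundamental form. -/
theorem FlowPatch.spaceDeriv_spaceDeriv_eq_smul_normal {n : ℕ} {α θ : ℝ} {s : Set (SpaceTime n)}
    {F N : SpaceTime n → Ambient n} {A : Fin n → Fin n → SpaceTime n → ℝ} {H q : SpaceTime n → ℝ}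
    {x : SpaceTime n} (hp : FlowPatch α θ s F N A H q) (hx : x ∈ s)
    (hon : ∀ a b, ⟪spaceDeriv s a F x, spaceDeriv s b F x⟫ = ⟪a, b⟫)
    (hnorm : ∀ a b w, ⟪spaceDeriv s a (spaceDeriv s b F) x, spaceDeriv s w F x⟫ = 0)
    (a b : EuclideanSpace ℝ (Fin n)) :
    spaceDeriv s a (spaceDeriv s b F) x
      = -⟪spaceDeriv s a N x, spaceDeriv s b F x⟫ • N x := by
  let dF : EuclideanSpace ℝ (Fin n) →ₗ[ℝ] Ambient n :=
    ((fderivWithin ℝ F s x).comp (ContinuousLinearMap.inr ℝ ℝ _)).toLinearMap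
  have hdF : ∀ v, dF v = spaceDeriv s v F x := fun v => rfl
  have hinj : Function.Injective dF := by
    refine (injective_iff_map_eq_zero dF).2 fun v hv => ?_
    have h := hon v v
    rw [← hdF, hv, inner_zero_left] at h
    exact inner_self_eq_zero.1 h.symm
  have h1 : ‖N x‖ = 1 := by
    have := hp.unit x hx
    rw [real_inner_self_eq_norm_sq] at this
    exact (pow_eq_one_iff_of_nonneg (norm_nonneg _) two_ne_zero).1 this
  have h2 := eq_inner_smul_normal hinj h1 (fun v => hp.normal v x hx)
    (y := spaceDeriv s a (spaceDeriv s b F) x) (fun v => hnorm a b v)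
  rw [hp.inner_dirDeriv_normal _ b hx, neg_neg, real_inner_comm]
  exact h2

section Interior

variable {n : ℕ} {M : Type*} {ε K : ℝ}

/-- The barrier `ε e^{-K t} (1 + ⟪X, Eₙ₊₁⟫)` along a family of hypersurfaces. -/
noncomputable def flowBarrier (ε K : ℝ) (X : ℝ → M → Ambient n) (t : ℝ) (p : M) : ℝ :=
  ε * Real.exp (-K * t) * (1 + ⟪X t p, vertical n⟫)

variable [NeZero n] [TopologicalSpace M] [ChartedSpace (EuclideanHalfSpace n) M]

/-- The quadratic form `h - L g` on the tangent bundle, `L` being the barrier. -/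
noncomputable def flowPinch (ε K : ℝ) (X ν : ℝ → M → Ambient n) (t : ℝ) (p : M)
    (v : EuclideanSpace ℝ (Fin n)) : ℝ :=
  ⟪diff (ν t) p v - flowBarrier ε K X t p • diff (X t) p v, diff (X t) p v⟫

variable [IsManifold (𝓡∂ n) ∞ M] [MeasurableSpace M] {c : Constraint} {α θ : ℝ} {T : EReal}
  {X ν : ℝ → M → Ambient n}
  {p₀ : M} {ψ : EuclideanSpace ℝ (Fin n) → EuclideanSpace ℝ (Fin n)}
  {U : Set (EuclideanSpace ℝ (Fin n))}

namespace IsSolution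

variable (hX : IsSolution c α θ T X ν)
include hX

theorem pinchForm_patch (hc : IsChartChange p₀ ψ U) {x : SpaceTime n}
    (hx : x ∈ positiveTimes T ×ˢ U) (w : EuclideanSpace ℝ (Fin n)) :
    pinchForm (positiveTimes T ×ˢ U) (fun x => X x.1 (chartParam p₀ ψ x.2))
      (fun x => ν x.1 (chartParam p₀ ψ x.2))
      (barrier ε K fun x => X x.1 (chartParam p₀ ψ x.2)) w w x
      = flowPinch ε K X ν x.1 (chartParam p₀ ψ x.2) (chartParamDeriv p₀ ψ x.2 w) := by
  have h1 := hX.spaceDeriv_patch hc hx w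
  have h2 := hX.spaceDeriv_patch_normal hc hx w
  unfold pinchForm flowPinch
  rw [h1, h2]
  rfl

theorem injective_chartDiff (p₀ : M) {t : ℝ} (ht : t ∈ timeInterval T) :
    Function.Injective (chartDiff (n := n) p₀ (X t)) := by
  have : IsManifold (𝓡∂ n) 1 M := .of_le (n := ∞) (by simp)
  have h1 := isInvertible_mfderivWithin_extChartAt_symm (I := 𝓡∂ n)
    (mem_extChartAt_target (I := 𝓡∂ n) p₀)
  exact Function.Injective.comp (g := diff (X t) p₀) ((hX.capillary t ht).immersion p₀)
    h1.injective

/-- If the pinching form is nonnegative up to time `t` and has a null vector at time `t` over an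
interior point of `M`, then the decay rate of the barrier is at most the critical one. -/
theorem rate_le_of_interior_null (hα : 0 < α) (hθ : θ ∈ Ioo 0 (Real.pi / 2)) {t : ℝ}
    (ht : t ∈ positiveTimes T) (hp₀ : 0 < extChartAt (𝓡∂ n) p₀ p₀ 0) (hε : 0 < ε)
    (hpos : ∀ τ ∈ positiveTimes T, τ ≤ t → ∀ p v, 0 ≤ flowPinch ε K X ν τ p v)
    {v : EuclideanSpace ℝ (Fin n)} (hv : v ≠ 0) (hzero : flowPinch ε K X ν t p₀ v = 0) {B : ℝ}
    (hHB : meanCurv (X t) (ν t) p₀ ≤ B)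
    (hqB : |meanCurv (X t) (ν t) p₀ ^ α - nonlocalTerm α θ (X t) (ν t) c| ≤ B)
    (hB : α * meanCurv (X t) (ν t) p₀ ^ (α - 1) ≤ B) : K ≤ criticalRate θ B := by
  obtain ⟨O, hO, hOt⟩ := exists_isOpen_extChartAt_target (n := n) p₀
  set O₁ : Set (EuclideanSpace ℝ (Fin n)) := O ∩ {y | 0 < y 0} with hO₁
  have hO₁o : IsOpen O₁ := hO.inter (isOpen_lt continuous_const (by fun_prop))
  have hO₁t : O₁ ⊆ (extChartAt (𝓡∂ n) p₀).target := by
    rw [hOt]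
    rintro y ⟨hy, hy' : 0 < y 0⟩
    exact ⟨hy, hy'.le⟩
  have hy₀ : extChartAt (𝓡∂ n) p₀ p₀ ∈ O₁ :=
    ⟨(hOt ▸ mem_extChartAt_target (I := 𝓡∂ n) p₀ : _ ∈ O ∩ _).1, hp₀⟩
  -- linear coordinates which are isometric at the given point
  have hinj : Function.Injective (chartDiff (n := n) p₀ (X t)) := hX.injective_chartDiff p₀ ht.1
  have hv0 : basisVec (0 : Fin n) ≠ 0 := by simp [basisVec]
  have hd0 : chartDiff p₀ (X t) (basisVec 0) ≠ 0 := by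
    rw [Ne, map_eq_zero_iff _ hinj]; exact hv0
  obtain ⟨L, hLinj, hLon, -⟩ := exists_isometric_coordinates hinj
    (m := ‖chartDiff p₀ (X t) (basisVec 0)‖⁻¹ • chartDiff p₀ (X t) (basisVec 0))
    (Submodule.smul_mem _ _ (LinearMap.mem_range_self _ _))
    (by rw [norm_smul, norm_inv, norm_norm, inv_mul_cancel₀ (norm_ne_zero_iff.2 hd0)])
  set U₁ := affineChange p₀ L ⁻¹' O₁ with hU₁
  have hU₁o : IsOpen U₁ := hO₁o.preimage contDiff_affineChange.continuous
  have h0U₁ : (0 : EuclideanSpace ℝ (Fin n)) ∈ U₁ := by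
    rw [hU₁, mem_preimage, affineChange_zero]; exact hy₀
  have hc₁ : IsChartChange p₀ (affineChange p₀ L) U₁ :=
    IsChartChange.affineChange hLinj (fun z hz => hO₁t hz) hU₁o.uniqueDiffOn
  have hs₁ : IsOpen (positiveTimes T ×ˢ U₁) := (isOpen_positiveTimes T).prod hU₁o
  have hx₁ : ((t, 0) : SpaceTime n) ∈ positiveTimes T ×ˢ U₁ := ⟨ht, h0U₁⟩
  have hon₁ : ∀ a b, ⟪spaceDeriv (positiveTimes T ×ˢ U₁) a
      (fun x : SpaceTime n => X x.1 (chartParam p₀ (affineChange p₀ L) x.2)) (t, 0),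
      spaceDeriv (positiveTimes T ×ˢ U₁) b
      (fun x : SpaceTime n => X x.1 (chartParam p₀ (affineChange p₀ L) x.2)) (t, 0)⟫
        = ⟪a, b⟫ := fun a b => by
    rw [hX.spaceDeriv_patch hc₁ hx₁, hX.spaceDeriv_patch hc₁ hx₁,
      diff_chartParamDeriv_affineChange, diff_chartParamDeriv_affineChange, hLon]
  obtain ⟨Γ, hΓ⟩ := exists_normal_coordinates hs₁ (hX.smooth_patch hc₁) hx₁ hon₁
  -- normal coordinates
  set ψ := fun z => affineChange p₀ L (quadraticChange Γ z) with hψ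
  set U := (quadraticChange Γ ⁻¹' U₁)
    ∩ fderiv ℝ (quadraticChange Γ) ⁻¹' {A | Function.Injective A} with hU
  have hUo : IsOpen U := (hU₁o.preimage contDiff_quadraticChange.continuous).inter
    (ContinuousLinearMap.isOpen_injective.preimage
      (contDiff_quadraticChange.continuous_fderiv (by simp)))
  have hχ0 : quadraticChange Γ 0 = 0 := by simp [quadraticChange]
  have h0U : (0 : EuclideanSpace ℝ (Fin n)) ∈ U := by
    refine ⟨by rw [mem_preimage, hχ0]; exact h0U₁, ?_⟩
    rw [mem_preimage, (hasFDerivAt_quadraticChange 0).fderiv]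
    intro a b hab
    simpa using hab
  have hc : IsChartChange p₀ ψ U := by
    refine ⟨contDiff_affineChange.comp contDiff_quadraticChange, fun z hz => hO₁t hz.1,
      fun z hz => ?_, hUo.uniqueDiffOn⟩
    have h1 : HasFDerivAt ψ _ z := (hasFDerivAt_affineChange (quadraticChange Γ z)).comp z
      ((contDiff_quadraticChange (Γ := Γ)).differentiable (by simp) z).hasFDerivAt
    rw [h1.fderiv]
    exact hLinj.comp hz.2
  have hs : IsOpen (positiveTimes T ×ˢ U) := (isOpen_positiveTimes T).prod hUo
  have hx : ((t, 0) : SpaceTime n) ∈ positiveTimes T ×ˢ U := ⟨ht, h0U⟩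
  have hfp := hX.flowPatch hc (.of_isOpen hs) hθ
  obtain ⟨hfirst, hsecond⟩ := hΓ _ hs hx fun x hx => ⟨hx.1, hx.2.1⟩
  have hon : ∀ a b, ⟪spaceDeriv (positiveTimes T ×ˢ U) a
      (fun x : SpaceTime n => X x.1 (chartParam p₀ ψ x.2)) (t, 0),
      spaceDeriv (positiveTimes T ×ˢ U) b
      (fun x : SpaceTime n => X x.1 (chartParam p₀ ψ x.2)) (t, 0)⟫ = ⟪a, b⟫ := fun a b => by
    have e := fun a => hfirst a
    have := hon₁ a b
    rw [← e, ← e] at this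
    exact this
  have hp0 : chartParam p₀ ψ 0 = p₀ := by
    have : ψ 0 = affineChange p₀ L 0 := by rw [hψ]; simp only [hχ0]
    rw [chartParam, this]
    exact chartParam_affineChange_zero
  have hpinch : ∀ y ∈ positiveTimes T ×ˢ U, y.1 ≤ t → ∀ w,
      0 ≤ pinchForm (positiveTimes T ×ˢ U) (fun x => X x.1 (chartParam p₀ ψ x.2))
        (fun x => ν x.1 (chartParam p₀ ψ x.2))
        (barrier ε K fun x => X x.1 (chartParam p₀ ψ x.2)) w w y := fun y hy hyt w => by
    rw [hX.pinchForm_patch hc hy]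
    exact hpos _ hy.1 hyt _ _
  obtain ⟨w, hw⟩ := hc.exists_chartParamDeriv_eq h0U v
  have hw0 : w ≠ 0 := by
    rintro rfl
    exact hv (by rw [← hw, map_zero])
  have hwzero : pinchForm (positiveTimes T ×ˢ U) (fun x => X x.1 (chartParam p₀ ψ x.2))
        (fun x => ν x.1 (chartParam p₀ ψ x.2))
        (barrier ε K fun x => X x.1 (chartParam p₀ ψ x.2)) w w (t, 0) = 0 := by
    rw [hX.pinchForm_patch hc hx, hw]
    simp only [hp0, hzero]
  have hnull := hfp.null_direction hx (hpinch _ hx le_rfl) hwzero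
  refine hfp.rate_le_of_null (v := ‖w‖⁻¹ • w) (ε := ε) (B := B) hα hθ hs hx hε hon
    (fun a b => hfp.spaceDeriv_spaceDeriv_eq_smul_normal hx hon hsecond a b) ?_
    ((hX.capillary t ht.1).mem_halfSpace _) ?_ hpinch ?_ ?_ ?_
  · rw [real_inner_self_eq_norm_sq, norm_smul, norm_inv, norm_norm,
      inv_mul_cancel₀ (norm_ne_zero_iff.2 hw0), one_pow]
  · rw [spaceDeriv_smul_dir, spaceDeriv_smul_dir, hnull, smul_comm]
  · simpa only [hp0] using hHB
  · simpa only [hp0] using hqB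
  · simpa only [hp0] using hB

end IsSolution

end Interior

/-! ### No null vector at the boundary of a solution -/

section HalfSpaceDomain

variable {n : ℕ} [NeZero n]

theorem convex_halfSpace : Convex ℝ {z : EuclideanSpace ℝ (Fin n) | 0 ≤ z 0} := by
  intro a ha b hb s t hs ht _
  have ha' : 0 ≤ a 0 := ha
  have hb' : 0 ≤ b 0 := hb
  have : 0 ≤ s * a 0 + t * b 0 := by positivity
  simpa using this

theorem isCalculusDomain_inter_halfSpace {O : Set (EuclideanSpace ℝ (Fin n))} (hO : IsOpen O) :
    IsCalculusDomain (O ∩ {z | 0 ≤ z 0}) := by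
  refine .of_convex_inter hO convex_halfSpace ⟨basisVec 0, ?_⟩
  have ho : IsOpen {z : EuclideanSpace ℝ (Fin n) | 0 < z 0} :=
    isOpen_lt continuous_const (by fun_prop)
  refine interior_maximal ?_ ho (by simp [basisVec])
  exact fun z (hz : 0 < z 0) => show 0 ≤ z 0 from hz.le

theorem prod_inter_halfSpace (J : Set ℝ) (O : Set (EuclideanSpace ℝ (Fin n))) :
    J ×ˢ (O ∩ {z | 0 ≤ z 0}) = (J ×ˢ O) ∩ {x : SpaceTime n | 0 ≤ x.2 0} := by
  ext x
  exact and_assoc.symm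

theorem isCalculusDomain_prod_halfSpace {J : Set ℝ} (hJ : IsOpen J)
    {O : Set (EuclideanSpace ℝ (Fin n))} (hO : IsOpen O) :
    IsCalculusDomain (J ×ˢ (O ∩ {z | 0 ≤ z 0})) := by
  rw [prod_inter_halfSpace]
  refine .of_convex_inter (hJ.prod hO)
    (convex_halfSpace.linear_preimage (LinearMap.snd ℝ ℝ (EuclideanSpace ℝ (Fin n))))
    ⟨(0, basisVec 0), ?_⟩
  have ho : IsOpen {x : SpaceTime n | 0 < x.2 0} := isOpen_lt continuous_const (by fun_prop)
  refine interior_maximal ?_ ho (by simp [basisVec])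
  exact fun x (hx : 0 < x.2 0) => show 0 ≤ x.2 0 from hx.le

end HalfSpaceDomain

section BoundaryPoint

variable {n : ℕ} [NeZero n] {M : Type*} [TopologicalSpace M]
  [ChartedSpace (EuclideanHalfSpace n) M] [IsManifold (𝓡∂ n) ∞ M]

theorem extChartAt_symm_mem_boundary {p₀ : M} {y : EuclideanSpace ℝ (Fin n)}
    (hy : y ∈ (extChartAt (𝓡∂ n) p₀).target) (hy0 : y 0 = 0) :
    (extChartAt (𝓡∂ n) p₀).symm y ∈ (𝓡∂ n).boundary M := by
  have hx : (extChartAt (𝓡∂ n) p₀).symm y ∈ (chartAt (EuclideanHalfSpace n) p₀).source := by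
    rw [← extChartAt_source (𝓡∂ n)]
    exact (extChartAt (𝓡∂ n) p₀).map_target hy
  have h1 : (𝓡∂ n).IsBoundaryPoint ((extChartAt (𝓡∂ n) p₀).symm y) := by
    rw [ModelWithCorners.isBoundaryPoint_iff_of_mem_atlas (n := ∞) (by simp)
      (chart_mem_atlas _ p₀) hx]
    have h2 : (chartAt (EuclideanHalfSpace n) p₀).extend (𝓡∂ n)
        ((extChartAt (𝓡∂ n) p₀).symm y) = y := (extChartAt (𝓡∂ n) p₀).right_inv hy
    rw [h2]
    refine ⟨_root_.subset_closure hy, fun hint => ?_⟩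
    have h3 : y ∈ interior (range (𝓡∂ n)) :=
      interior_mono (extChartAt_target_subset_range p₀) hint
    rw [interior_range_modelWithCornersEuclideanHalfSpace] at h3
    exact (ne_of_gt h3) hy0
  exact h1

variable [MeasurableSpace M] {c : Constraint} {α θ : ℝ} {T : EReal} {X ν : ℝ → M → Ambient n}
  {p₀ : M} {ε K : ℝ}

/-- In affine coordinates preserving the half-space, a solution defines a flow patch at the
capillary boundary. -/
theorem IsSolution.exists_boundaryFlowPatch (hX : IsSolution c α θ T X ν)
    (hθ : θ ∈ Ioo 0 (Real.pi / 2)) (hp₀ : extChartAt (𝓡∂ n) p₀ p₀ 0 = 0)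
    {L : EuclideanSpace ℝ (Fin n) →L[ℝ] EuclideanSpace ℝ (Fin n)} (hL : Function.Injective L)
    {κ : ℝ} (hκ : 0 < κ) (hLκ : ∀ z, L z 0 = κ * z 0) :
    ∃ U : Set (EuclideanSpace ℝ (Fin n)), 0 ∈ U ∧ IsChartChange p₀ (affineChange p₀ L) U ∧
      ∃ A H q, BoundaryFlowPatch α θ (positiveTimes T ×ˢ U)
        (fun x => X x.1 (chartParam p₀ (affineChange p₀ L) x.2))
        (fun x => ν x.1 (chartParam p₀ (affineChange p₀ L) x.2)) A H q := by
  obtain ⟨O, hO, hOt⟩ := exists_isOpen_extChartAt_target (n := n) p₀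
  have hchange : ∀ z, affineChange p₀ L z 0 = κ * z 0 := fun z => by
    rw [affineChange, PiLp.add_apply, hp₀, hLκ, zero_add]
  set U := affineChange p₀ L ⁻¹' O ∩ {z | 0 ≤ z 0} with hU
  have hUo : IsOpen (affineChange p₀ L ⁻¹' O) := hO.preimage contDiff_affineChange.continuous
  have hUt : ∀ z ∈ U, affineChange p₀ L z ∈ (extChartAt (𝓡∂ n) p₀).target := by
    rintro z ⟨hz, hz0 : 0 ≤ z 0⟩
    rw [hOt]
    refine ⟨hz, ?_⟩
    change 0 ≤ affineChange p₀ L z 0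
    rw [hchange]
    positivity
  have hc : IsChartChange p₀ (affineChange p₀ L) U :=
    IsChartChange.affineChange hL hUt (isCalculusDomain_inter_halfSpace hUo).uniqueDiffOn
  have hdom : IsCalculusDomain (positiveTimes T ×ˢ U) :=
    isCalculusDomain_prod_halfSpace (isOpen_positiveTimes T) hUo
  have hbd : ∀ x ∈ positiveTimes T ×ˢ U, x.2 0 = 0 →
      chartParam p₀ (affineChange p₀ L) x.2 ∈ (𝓡∂ n).boundary M := fun x hx hx0 =>
    extChartAt_symm_mem_boundary (hUt _ hx.2) (by rw [hchange, hx0, mul_zero])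
  refine ⟨U, ⟨?_, by simp⟩, hc, _, _, _, hX.flowPatch hc hdom hθ,
    ⟨_, (isOpen_positiveTimes T).prod hUo, prod_inter_halfSpace _ _⟩,
    fun x hx hx0 => (hX.capillary x.1 hx.1.1).boundary_mem _ (hbd x hx hx0),
    fun x hx hx0 => (hX.capillary x.1 hx.1.1).contact_angle _ (hbd x hx hx0)⟩
  rw [mem_preimage, affineChange_zero]
  exact (hOt ▸ mem_extChartAt_target (I := 𝓡∂ n) p₀ : _ ∈ O ∩ _).1

/-- If the pinching form is nonnegative at a positive time, then at that time it has no null vector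
over the boundary of `M`. -/
theorem IsSolution.flowPinch_ne_zero_of_boundary (hX : IsSolution c α θ T X ν) (hα : 0 < α)
    (hθ : θ ∈ Ioo 0 (Real.pi / 2)) {t : ℝ} (ht : t ∈ positiveTimes T)
    (hp₀ : extChartAt (𝓡∂ n) p₀ p₀ 0 = 0) (hε : 0 < ε)
    (hpos : ∀ p v, 0 ≤ flowPinch ε K X ν t p v) {v : EuclideanSpace ℝ (Fin n)} (hv : v ≠ 0) :
    flowPinch ε K X ν t p₀ v ≠ 0 := by
  have hcap := hX.capillary t ht.1
  have hinj : Function.Injective (chartDiff p₀ (X t)) := hX.injective_chartDiff p₀ ht.1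
  have hsin := sin_pos_of_acute hθ
  have hp₀b : p₀ ∈ (𝓡∂ n).boundary M := by
    have := extChartAt_symm_mem_boundary (mem_extChartAt_target (I := 𝓡∂ n) p₀) hp₀
    rwa [extChartAt_to_inv] at this
  have hangle := hcap.contact_angle p₀ hp₀b
  have hunit : ⟪ν t p₀, ν t p₀⟫ = 1 := by
    rw [real_inner_self_eq_norm_sq, hcap.outwardNormal.unit, one_pow]
  have hvert : ⟪vertical n, vertical n⟫ = 1 := by
    rw [real_inner_self_eq_norm_sq, norm_vertical, one_pow]
  have hnorm : ∀ a, ⟪chartDiff p₀ (X t) a, ν t p₀⟫ = 0 := fun a =>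
    hcap.outwardNormal.normal p₀ _
  -- the height is a nonnegative function which vanishes on the boundary
  obtain ⟨hlam0, hlam⟩ : 0 ≤ ⟪chartDiff p₀ (X t) (basisVec 0), vertical n⟫ ∧
      ∀ a : EuclideanSpace ℝ (Fin n), ⟪chartDiff p₀ (X t) a, vertical n⟫
        = a 0 * ⟪chartDiff p₀ (X t) (basisVec 0), vertical n⟫ := by
    obtain ⟨U, h0U, hc, A, H, q, hp⟩ := hX.exists_boundaryFlowPatch hθ hp₀
      (L := ContinuousLinearMap.id ℝ _) Function.injective_id one_pos (by simp)
    have hx : ((t, 0) : SpaceTime n) ∈ positiveTimes T ×ˢ U := ⟨ht, h0U⟩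
    have hd : ∀ a, spaceDeriv (positiveTimes T ×ˢ U) a (fun x : SpaceTime n =>
        X x.1 (chartParam p₀ (affineChange p₀ (ContinuousLinearMap.id ℝ _)) x.2)) (t, 0)
        = chartDiff p₀ (X t) a := fun a => by
      rw [hX.spaceDeriv_patch hc hx, diff_chartParamDeriv_affineChange]
      rfl
    have htan : ∀ a : EuclideanSpace ℝ (Fin n), a 0 = 0 →
        ⟪chartDiff p₀ (X t) a, vertical n⟫ = 0 := fun a ha => by
      rw [← hd]
      exact hp.inner_spaceDeriv_vertical ha hx rfl
    refine ⟨?_, fun a => ?_⟩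
    · rw [← hd, ← hp.dirDeriv_inner_const hp.smooth_F _ _ hx]
      refine dirDeriv_nonneg_of_segment (hp.smooth_F.inner ℝ contDiffOn_const) hx ?_
        (hp.height_eq _ hx rfl)
      filter_upwards [hp.eventually_mem (v := ((0 : ℝ), basisVec (0 : Fin n)))
        (by simp [basisVec]) hx] with η hη
      exact ⟨hη, (hX.capillary _ hη.1.1).mem_halfSpace _⟩
    · have h1 := htan (a - a 0 • basisVec 0) (by simp [basisVec])
      rw [map_sub, map_smul, inner_sub_left, inner_smul_left] at h1
      simpa using sub_eq_zero.1 h1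
  -- linear coordinates, isometric at the given point, with first axis along the conormal
  set m : Ambient n := (Real.sin θ)⁻¹ • (vertical n - Real.cos θ • ν t p₀) with hm
  clear_value m
  have hvm : vertical n = Real.cos θ • ν t p₀ + Real.sin θ • m := by
    rw [hm, smul_smul, mul_inv_cancel₀ hsin.ne', one_smul]
    abel
  have hangle' : ⟪vertical n, ν t p₀⟫ = Real.cos θ := by rw [real_inner_comm, hangle]
  have hmν : ⟪m, ν t p₀⟫ = 0 := by
    rw [hm, inner_smul_left, inner_sub_left, inner_smul_left, hunit, hangle']
    simp
  have hmm : ‖m‖ = 1 := by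
    have h1 : ⟪m, m⟫ = 1 := by
      have h2 : Real.sin θ ^ 2 * ⟪m, m⟫ = Real.sin θ ^ 2 := by
        have h3 : Real.sin θ • m = vertical n - Real.cos θ • ν t p₀ := by
          rw [hm, smul_smul, mul_inv_cancel₀ hsin.ne', one_smul]
        have h4 : Real.sin θ ^ 2 * ⟪m, m⟫ = ⟪Real.sin θ • m, Real.sin θ • m⟫ := by
          rw [inner_smul_left, inner_smul_right]; simp only [conj_trivial]; ring
        rw [h4, h3, inner_sub_left, inner_sub_right, inner_sub_right, inner_smul_left,
          inner_smul_left, inner_smul_right, inner_smul_right, hunit, hvert, hangle, hangle']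
        simp only [conj_trivial]
        nlinarith [Real.sin_sq_add_cos_sq θ]
      exact mul_left_cancel₀ (pow_pos hsin 2).ne' (by rw [h2, mul_one])
    rw [real_inner_self_eq_norm_sq] at h1
    exact (pow_eq_one_iff_of_nonneg (norm_nonneg _) two_ne_zero).1 h1
  have hmem : m ∈ LinearMap.range (chartDiff p₀ (X t)) := by
    rw [range_eq_orthogonal hinj (hcap.outwardNormal.unit p₀) hnorm,
      Submodule.mem_orthogonal_singleton_iff_inner_left]
    exact hmν
  obtain ⟨L, hLinj, hLon, hL0⟩ := exists_isometric_coordinates hinj hmem hmm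
  have hLz : ∀ z : EuclideanSpace ℝ (Fin n),
      L z 0 * ⟪chartDiff p₀ (X t) (basisVec 0), vertical n⟫ = Real.sin θ * z 0 := fun z => by
    rw [← hlam, hvm, inner_add_right, inner_smul_right, inner_smul_right, hnorm, ← hL0, hLon]
    simp [basisVec, EuclideanSpace.inner_single_right]
  have hlam_pos : 0 < ⟪chartDiff p₀ (X t) (basisVec 0), vertical n⟫ := by
    refine lt_of_le_of_ne hlam0 fun h => ?_
    have h1 := hLz (basisVec 0)
    rw [← h, mul_zero] at h1
    have h2 : Real.sin θ = 0 := by simpa [basisVec] using h1.symm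
    exact hsin.ne' h2
  obtain ⟨U, h0U, hc, A, H, q, hp⟩ := hX.exists_boundaryFlowPatch hθ hp₀ hLinj
    (div_pos hsin hlam_pos) (fun z => by
      rw [div_mul_eq_mul_div, eq_div_iff hlam_pos.ne', hLz])
  have hx : ((t, 0) : SpaceTime n) ∈ positiveTimes T ×ˢ U := ⟨ht, h0U⟩
  have hd : ∀ a, spaceDeriv (positiveTimes T ×ˢ U) a (fun x : SpaceTime n =>
      X x.1 (chartParam p₀ (affineChange p₀ L) x.2)) (t, 0) = chartDiff p₀ (X t) (L a) :=
    fun a => by rw [hX.spaceDeriv_patch hc hx, diff_chartParamDeriv_affineChange]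
  obtain ⟨w, hw⟩ := hc.exists_chartParamDeriv_eq h0U v
  have hw0 : w ≠ 0 := by
    rintro rfl
    exact hv (by rw [← hw, map_zero])
  have h := hp.not_null (ε := ε) (K := K) hθ hx rfl
    (fun a b => by rw [hd, hd, hLon])
    (by rw [hd, hL0]; simp only [chartParam_affineChange_zero]; exact hvm) hα hε
    (hcap.mem_halfSpace _) (fun y hy hyt u => by
      rw [hX.pinchForm_patch hc hy]
      have : y.1 = t := hyt
      rw [this]
      exact hpos _ _) hw0
  rw [hX.pinchForm_patch hc hx, hw] at h
  simpa only [chartParam_affineChange_zero] using h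

end BoundaryPoint

/-! ### Compactness -/

section Compactness

variable {n : ℕ} [NeZero n] {M : Type*} [TopologicalSpace M]
  [ChartedSpace (EuclideanHalfSpace n) M] [IsManifold (𝓡∂ n) ∞ M]

/-- On a compact manifold, the positivity of a continuous family of functions on the tangent bundle
which are homogeneous of degree two is an open condition. -/
theorem eventually_pos_of_homogeneous [CompactSpace M] {Z : Type*} [TopologicalSpace Z] {D : Set Z}
    {P : Z → M → EuclideanSpace ℝ (Fin n) → ℝ}
    (hP : ContinuousOn (fun q : Z × TangentBundle (𝓡∂ n) M => P q.1 q.2.proj q.2.snd)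
      (D ×ˢ univ))
    (hhom : ∀ z p (r : ℝ) v, P z p (r • v) = r ^ 2 * P z p v) {z₀ : Z} (hz₀ : z₀ ∈ D)
    (hpos : ∀ p v, v ≠ 0 → 0 < P z₀ p v) :
    ∀ᶠ z in 𝓝[D] z₀, ∀ p v, v ≠ 0 → 0 < P z p v := by
  have : IsManifold (𝓡∂ n) 1 M := .of_le (n := ∞) (by simp)
  have hlocal : ∀ p₀ : M, ∀ᶠ x in 𝓝[D] z₀ ×ˢ 𝓝 p₀, ∀ v, v ≠ 0 → 0 < P x.1 x.2 v := by
    intro p₀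
    let e := trivializationAt (EuclideanSpace ℝ (Fin n)) (TangentSpace (𝓡∂ n) : M → Type _) p₀
    have hp₀ : p₀ ∈ e.baseSet := FiberBundle.mem_baseSet_trivializationAt' p₀
    let Q : Z × M → EuclideanSpace ℝ (Fin n) → ℝ := fun x w => P x.1 x.2 (e.symm x.2 w)
    have hQ : ∀ w : EuclideanSpace ℝ (Fin n), w ≠ 0 →
        {q : (Z × M) × EuclideanSpace ℝ (Fin n) | 0 < Q q.1 q.2} ∈ (𝓝[D] z₀ ×ˢ 𝓝 p₀) ×ˢ 𝓝 w := by
      intro w hw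
      have h1 : ContinuousWithinAt (fun q : Z × (M × EuclideanSpace ℝ (Fin n)) =>
          Q (q.1, q.2.1) q.2.2) (D ×ˢ (e.baseSet ×ˢ univ)) (z₀, (p₀, w)) := by
        refine ContinuousOn.comp (t := D ×ˢ univ)
          (g := fun q : Z × TangentBundle (𝓡∂ n) M => P q.1 q.2.proj q.2.snd)
          (f := fun q : Z × (M × EuclideanSpace ℝ (Fin n)) =>
            (q.1, ⟨q.2.1, e.symm q.2.1 q.2.2⟩)) hP ?_ (fun q hq => ⟨hq.1, mem_univ _⟩) _
          ⟨hz₀, hp₀, mem_univ _⟩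
        refine continuousOn_fst.prodMk (e.continuousOn_symm.comp continuousOn_snd fun q hq => ?_)
        exact hq.2
      have h4 : 0 < Q (z₀, p₀) w := by
        refine hpos _ _ fun h => hw ?_
        have h5 := e.continuousLinearMapAt_symmL (R := ℝ) hp₀ w
        rw [← h5, e.symmL_apply hp₀]
        exact (congrArg _ h).trans (map_zero _)
      have h6 := h1.eventually (p := fun r => 0 < r) (lt_mem_nhds h4)
      have h7 : ∀ᶠ q in 𝓝[D] z₀ ×ˢ (𝓝 p₀ ×ˢ 𝓝 w), 0 < Q (q.1, q.2.1) q.2.2 := by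
        have h8 : 𝓝[e.baseSet ×ˢ (univ : Set (EuclideanSpace ℝ (Fin n)))] (p₀, w)
            = 𝓝 p₀ ×ˢ 𝓝 w := by
          rw [(e.open_baseSet.prod isOpen_univ).nhdsWithin_eq ⟨hp₀, mem_univ _⟩, nhds_prod_eq]
        rw [← h8, ← nhdsWithin_prod_eq]
        exact h6
      exact tendsto_prodAssoc.eventually h7
    have hsphere := IsCompact.mem_prod_nhdsSet_of_forall
      (isCompact_sphere (0 : EuclideanSpace ℝ (Fin n)) 1) fun w hw => hQ w (by
        rintro rfl
        simp at hw)
    have hall : ∀ᶠ x in 𝓝[D] z₀ ×ˢ 𝓝 p₀, ∀ w ∈ Metric.sphere (0 : EuclideanSpace ℝ (Fin n)) 1,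
        0 < Q x w := (Eventually.curry hsphere).mono fun _ h => h.self_of_nhdsSet
    filter_upwards [hall, prod_mem_prod univ_mem (e.open_baseSet.mem_nhds hp₀)] with x hx hxb v hv
    have hxb' : x.2 ∈ e.baseSet := hxb.2
    set u : EuclideanSpace ℝ (Fin n) := e.continuousLinearMapAt ℝ x.2 v with hu
    have huv : e.symmL ℝ x.2 u = v := e.symmL_continuousLinearMapAt (R := ℝ) hxb' v
    have hu0 : u ≠ 0 := by
      intro h
      rw [h, map_zero] at huv
      exact hv huv.symm
    have h1 := hx (‖u‖⁻¹ • u) (by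
      rw [mem_sphere_zero_iff_norm, norm_smul, norm_inv, norm_norm,
        inv_mul_cancel₀ (norm_ne_zero_iff.2 hu0)])
    have h2 : Q x (‖u‖⁻¹ • u) = ‖u‖⁻¹ ^ 2 * P x.1 x.2 v := by
      simp only [Q]
      rw [← e.symmL_apply (R := ℝ) hxb', map_smul, huv]
      exact hhom _ _ _ _
    rw [h2] at h1
    exact pos_of_mul_pos_right h1 (by positivity)
  have h := IsCompact.mem_prod_nhdsSet_of_forall (isCompact_univ (X := M)) fun p _ => hlocal p
  exact (Eventually.curry h).mono fun _ h p => h.self_of_nhdsSet p (mem_univ p)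

omit [IsManifold (𝓡∂ n) ∞ M] in
theorem diff_smul (G : M → Ambient n) (p : M) (r : ℝ) (v : EuclideanSpace ℝ (Fin n)) :
    diff G p (r • v : EuclideanSpace ℝ (Fin n)) = r • diff G p v :=
  (mfderiv (𝓡∂ n) 𝓘(ℝ, Ambient n) G p).map_smul r v

omit [IsManifold (𝓡∂ n) ∞ M] in
theorem flowPinch_smul (ε K : ℝ) (X ν : ℝ → M → Ambient n) (t : ℝ) (p : M) (r : ℝ)
    (v : EuclideanSpace ℝ (Fin n)) :
    flowPinch ε K X ν t p (r • v) = r ^ 2 * flowPinch ε K X ν t p v := by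
  unfold flowPinch
  rw [diff_smul, diff_smul, smul_comm _ r, ← smul_sub, inner_smul_left, inner_smul_right]
  simp only [conj_trivial]
  ring

variable [MeasurableSpace M] {c : Constraint} {α θ : ℝ} {T : EReal} {X ν : ℝ → M → Ambient n}
  {K : ℝ}

namespace IsSolution

variable (hX : IsSolution c α θ T X ν)
include hX

theorem continuousOn_flowPinch :
    ContinuousOn (fun q : (ℝ × ℝ) × TangentBundle (𝓡∂ n) M =>
      flowPinch q.1.2 K X ν q.1.1 q.2.proj q.2.snd) ((timeInterval T ×ˢ univ) ×ˢ univ) := by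
  have : IsManifold (𝓡∂ n) 1 M := .of_le (n := ∞) (by simp)
  have hmap : MapsTo (fun q : (ℝ × ℝ) × TangentBundle (𝓡∂ n) M => (q.1.1, q.2))
      ((timeInterval T ×ˢ univ) ×ˢ univ) (timeInterval T ×ˢ univ) :=
    fun q hq => ⟨hq.1.1, mem_univ _⟩
  have h1 : ContinuousOn (fun q : (ℝ × ℝ) × TangentBundle (𝓡∂ n) M =>
      diff (X q.1.1) q.2.proj q.2.snd) ((timeInterval T ×ˢ univ) ×ˢ univ) :=
    hX.smooth.continuous_diff.comp (by fun_prop) hmap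
  have h2 : ContinuousOn (fun q : (ℝ × ℝ) × TangentBundle (𝓡∂ n) M =>
      diff (ν q.1.1) q.2.proj q.2.snd) ((timeInterval T ×ˢ univ) ×ˢ univ) :=
    hX.smooth_normal.continuous_diff.comp (by fun_prop) hmap
  have hproj : Continuous fun x : TangentBundle (𝓡∂ n) M => x.proj :=
    FiberBundle.continuous_proj (EuclideanSpace ℝ (Fin n)) (TangentSpace (𝓡∂ n))
  have h3 : ContinuousOn (fun q : (ℝ × ℝ) × TangentBundle (𝓡∂ n) M => X q.1.1 q.2.proj)
      ((timeInterval T ×ˢ univ) ×ˢ univ) :=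
    hX.smooth.continuous.comp (t := timeInterval T ×ˢ univ)
      (f := fun q : (ℝ × ℝ) × TangentBundle (𝓡∂ n) M => (q.1.1, q.2.proj))
      (by fun_prop) fun q hq => ⟨hq.1.1, mem_univ _⟩
  have h4 : ContinuousOn (fun q : (ℝ × ℝ) × TangentBundle (𝓡∂ n) M =>
      flowBarrier q.1.2 K X q.1.1 q.2.proj) ((timeInterval T ×ˢ univ) ×ˢ univ) := by
    unfold flowBarrier
    exact ContinuousOn.mul (by fun_prop)
      (continuousOn_const.add (h3.inner continuousOn_const))
  exact (h2.sub (h4.smul h1)).inner h1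

theorem eventually_flowPinch_pos [CompactSpace M] {t ε : ℝ} (ht : t ∈ timeInterval T)
    (hpos : ∀ p v, v ≠ 0 → 0 < flowPinch ε K X ν t p v) :
    ∀ᶠ z in 𝓝[timeInterval T ×ˢ univ] (t, ε), ∀ p v, v ≠ 0 →
      0 < flowPinch z.2 K X ν z.1 p v := by
  have hz : ((t, ε) : ℝ × ℝ) ∈ timeInterval T ×ˢ (univ : Set ℝ) := ⟨ht, mem_univ _⟩
  set P : ℝ × ℝ → M → EuclideanSpace ℝ (Fin n) → ℝ :=
    fun z p v => flowPinch z.2 K X ν z.1 p v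
  have hcont : ContinuousOn (fun q : (ℝ × ℝ) × TangentBundle (𝓡∂ n) M =>
      P q.1 q.2.proj q.2.snd) ((timeInterval T ×ˢ univ) ×ˢ univ) := hX.continuousOn_flowPinch
  have hhom : ∀ z p (r : ℝ) v, P z p (r • v) = r ^ 2 * P z p v :=
    fun z p r v => flowPinch_smul z.2 K X ν z.1 p r v
  have hpos' : ∀ p v, v ≠ 0 → 0 < P (t, ε) p v := hpos
  change ∀ᶠ z in 𝓝[timeInterval T ×ˢ univ] (t, ε), ∀ p v, v ≠ 0 → 0 < P z p v
  clear_value P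
  exact eventually_pos_of_homogeneous hcont hhom hz hpos'

/-- The mean curvature and the normal speed are continuous at positive times. -/
theorem continuousOn_meanCurv_speed (hθ : θ ∈ Ioo 0 (Real.pi / 2)) :
    ContinuousOn (fun x : ℝ × M => meanCurv (X x.1) (ν x.1) x.2) (positiveTimes T ×ˢ univ) ∧
      ContinuousOn (fun x : ℝ × M => meanCurv (X x.1) (ν x.1) x.2 ^ α
        - nonlocalTerm α θ (X x.1) (ν x.1) c) (positiveTimes T ×ˢ univ) := by
  have hlocal : ∀ p₀ : M,
      ContinuousOn (fun x : ℝ × M => meanCurv (X x.1) (ν x.1) x.2)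
        (positiveTimes T ×ˢ (extChartAt (𝓡∂ n) p₀).source) ∧
      ContinuousOn (fun x : ℝ × M => meanCurv (X x.1) (ν x.1) x.2 ^ α
        - nonlocalTerm α θ (X x.1) (ν x.1) c)
        (positiveTimes T ×ˢ (extChartAt (𝓡∂ n) p₀).source) := by
    intro p₀
    have hc : IsChartChange p₀ id (extChartAt (𝓡∂ n) p₀).target :=
      ⟨contDiff_id, fun z hz => hz, fun z _ => by rw [fderiv_id]; exact Function.injective_id,
        uniqueDiffOn_extChartAt_target p₀⟩
    obtain ⟨O, hO, hOt⟩ := exists_isOpen_extChartAt_target (n := n) p₀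
    have hdom : IsCalculusDomain (positiveTimes T ×ˢ (extChartAt (𝓡∂ n) p₀).target) := by
      rw [hOt]
      exact isCalculusDomain_prod_halfSpace (isOpen_positiveTimes T) hO
    have hfp := hX.flowPatch hc hdom hθ
    have hmap : ContinuousOn (fun x : ℝ × M => (x.1, extChartAt (𝓡∂ n) p₀ x.2))
        (positiveTimes T ×ˢ (extChartAt (𝓡∂ n) p₀).source) :=
      continuousOn_fst.prodMk ((continuousOn_extChartAt p₀).comp continuousOn_snd fun x hx => hx.2)
    have hmaps : MapsTo (fun x : ℝ × M => (x.1, extChartAt (𝓡∂ n) p₀ x.2))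
        (positiveTimes T ×ˢ (extChartAt (𝓡∂ n) p₀).source)
        (positiveTimes T ×ˢ (extChartAt (𝓡∂ n) p₀).target) :=
      fun x hx => ⟨hx.1, (extChartAt (𝓡∂ n) p₀).map_source hx.2⟩
    have hinv : ∀ x ∈ positiveTimes T ×ˢ (extChartAt (𝓡∂ n) p₀).source,
        chartParam p₀ id (extChartAt (𝓡∂ n) p₀ x.2) = x.2 :=
      fun x hx => (extChartAt (𝓡∂ n) p₀).left_inv hx.2
    constructor
    · refine (hfp.smooth_H.continuousOn.comp hmap hmaps).congr fun x hx => ?_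
      simp only [Function.comp_apply, hinv x hx]
    · refine (hfp.smooth_q.continuousOn.comp hmap hmaps).congr fun x hx => ?_
      simp only [Function.comp_apply, hinv x hx]
  have hnhds : ∀ x ∈ positiveTimes T ×ˢ (univ : Set M),
      positiveTimes T ×ˢ (extChartAt (𝓡∂ n) x.2).source ∈ 𝓝 x := fun x hx =>
    ((isOpen_positiveTimes T).prod (isOpen_extChartAt_source x.2)).mem_nhds
      ⟨hx.1, mem_extChartAt_source x.2⟩
  exact ⟨fun x hx => ((hlocal x.2).1.continuousAt (hnhds x hx)).continuousWithinAt,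
    fun x hx => ((hlocal x.2).2.continuousAt (hnhds x hx)).continuousWithinAt⟩

/-- The mean curvature and the speed are bounded on compact intervals of positive times. -/
theorem exists_bound [CompactSpace M] (hθ : θ ∈ Ioo 0 (Real.pi / 2)) {a b : ℝ}
    (hab : Icc a b ⊆ positiveTimes T) :
    ∃ B : ℝ, ∀ t ∈ Icc a b, ∀ p, meanCurv (X t) (ν t) p ≤ B
      ∧ |meanCurv (X t) (ν t) p ^ α - nonlocalTerm α θ (X t) (ν t) c| ≤ B
      ∧ α * meanCurv (X t) (ν t) p ^ (α - 1) ≤ B := by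
  have hK : IsCompact (Icc a b ×ˢ (univ : Set M)) := isCompact_Icc.prod isCompact_univ
  have hsub : Icc a b ×ˢ (univ : Set M) ⊆ positiveTimes T ×ˢ univ := prod_mono hab subset_rfl
  obtain ⟨hH, hq⟩ := hX.continuousOn_meanCurv_speed hθ
  have hH' := hH.mono hsub
  have hr : ContinuousOn (fun x : ℝ × M => α * meanCurv (X x.1) (ν x.1) x.2 ^ (α - 1))
      (Icc a b ×ˢ (univ : Set M)) :=
    continuousOn_const.mul (hH'.rpow_const fun x hx =>
      Or.inl (hX.meanCurv_pos x.1 (hsub hx).1.1 x.2).ne')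
  obtain ⟨B₁, h1⟩ := hK.exists_bound_of_continuousOn hH'
  obtain ⟨B₂, h2⟩ := hK.exists_bound_of_continuousOn (hq.mono hsub)
  obtain ⟨B₃, h3⟩ := hK.exists_bound_of_continuousOn hr
  refine ⟨max B₁ (max B₂ B₃), fun t ht p => ⟨?_, ?_, ?_⟩⟩
  · exact ((le_abs_self _).trans (h1 (t, p) ⟨ht, mem_univ p⟩)).trans (le_max_left _ _)
  · exact (h2 (t, p) ⟨ht, mem_univ p⟩).trans ((le_max_left _ _).trans (le_max_right _ _))
  · exact ((le_abs_self _).trans (h3 (t, p) ⟨ht, mem_univ p⟩)).trans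
      ((le_max_right _ _).trans (le_max_right _ _))

end IsSolution

end Compactness

/-! ### Preservation of strict convexity -/

section Preservation

variable {n : ℕ} [NeZero n] {M : Type*} [TopologicalSpace M]
  [ChartedSpace (EuclideanHalfSpace n) M]

theorem secondForm_eq_flowPinch_add (ε K : ℝ) (X ν : ℝ → M → Ambient n) (t : ℝ) (p : M)
    (v : EuclideanSpace ℝ (Fin n)) :
    secondForm (X t) (ν t) p v v
      = flowPinch ε K X ν t p v + flowBarrier ε K X t p * ‖diff (X t) p v‖ ^ 2 := by
  unfold secondForm flowPinch
  rw [inner_sub_left, inner_smul_left, real_inner_self_eq_norm_sq]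
  simp

variable [IsManifold (𝓡∂ n) ∞ M] [MeasurableSpace M] {c : Constraint} {α θ : ℝ} {T : EReal}
  {X ν : ℝ → M → Ambient n} {ε K : ℝ}

namespace IsSolution

variable (hX : IsSolution c α θ T X ν)
include hX

theorem flowBarrier_nonneg (hε : 0 ≤ ε) {t : ℝ} (ht : t ∈ timeInterval T) (p : M) :
    0 ≤ flowBarrier ε K X t p := by
  have := (hX.capillary t ht).mem_halfSpace p
  unfold flowBarrier
  positivity

/-- A faster decay of the barrier makes the pinching form larger. -/
theorem flowPinch_zero_rate_le (hε : 0 ≤ ε) (hK : 0 ≤ K) {t : ℝ} (ht : t ∈ timeInterval T) (p : M)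
    (v : EuclideanSpace ℝ (Fin n)) : flowPinch ε 0 X ν t p v ≤ flowPinch ε K X ν t p v := by
  have h1 := secondForm_eq_flowPinch_add ε 0 X ν t p v
  have h2 := secondForm_eq_flowPinch_add ε K X ν t p v
  have hh := (hX.capillary t ht).mem_halfSpace p
  have hexp : Real.exp (-K * t) ≤ Real.exp (-0 * t) :=
    Real.exp_le_exp.2 (by nlinarith [mul_nonneg hK ht.1])
  have h3 : flowBarrier ε K X t p ≤ flowBarrier ε 0 X t p := by
    unfold flowBarrier
    gcongr
  nlinarith [mul_le_mul_of_nonneg_right h3 (sq_nonneg ‖diff (X t) p v‖)]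

variable [CompactSpace M]

/-- If the initial hypersurface is strictly convex, its second fundamental form dominates a positive
barrier on a short time interval. -/
theorem exists_initial_pinching (h0 : (0 : ℝ) ∈ timeInterval T)
    (hconv : StrictlyConvex (X 0) (ν 0)) :
    ∃ τ > 0, ∃ ε > 0, ∀ t ∈ timeInterval T, t ≤ τ → ∀ p v, v ≠ 0 →
      0 < flowPinch ε 0 X ν t p v := by
  have hpos : ∀ (p : M) (v : EuclideanSpace ℝ (Fin n)), v ≠ 0 → 0 < flowPinch 0 0 X ν 0 p v := by
    intro p v hv
    have h1 := secondForm_eq_flowPinch_add 0 0 X ν 0 p v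
    have h2 : flowBarrier 0 0 X 0 p = 0 := by simp [flowBarrier]
    rw [h2, zero_mul, add_zero] at h1
    rw [← h1]
    exact hconv p v hv
  have hev := hX.eventually_flowPinch_pos h0 hpos
  rw [eventually_iff, Metric.mem_nhdsWithin_iff] at hev
  obtain ⟨δ, hδ, hsub⟩ := hev
  refine ⟨δ / 2, half_pos hδ, δ / 2, half_pos hδ, fun t ht htδ p v hv => ?_⟩
  have hball : ((t, δ / 2) : ℝ × ℝ) ∈ Metric.ball (0, 0) δ := by
    rw [Metric.mem_ball, Prod.dist_eq, max_lt_iff]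
    simp only [Real.dist_eq, sub_zero]
    rw [abs_of_nonneg ht.1, abs_of_pos (half_pos hδ)]
    constructor <;> linarith
  exact hsub ⟨hball, ht, mem_univ _⟩ p v hv

omit [CompactSpace M] in
/-- The pinching form cannot lose its positivity at a first positive time when the barrier decays
faster than the critical rate. -/
theorem flowPinch_pos_of_forall_lt (hα : 0 < α) (hθ : θ ∈ Ioo 0 (Real.pi / 2)) (hε : 0 < ε) {t : ℝ}
    (ht : t ∈ positiveTimes T)
    (hlt : ∀ τ ∈ positiveTimes T, τ < t → ∀ p v, v ≠ 0 → 0 < flowPinch ε K X ν τ p v) {B : ℝ}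
    (hB : ∀ p, meanCurv (X t) (ν t) p ≤ B
      ∧ |meanCurv (X t) (ν t) p ^ α - nonlocalTerm α θ (X t) (ν t) c| ≤ B
      ∧ α * meanCurv (X t) (ν t) p ^ (α - 1) ≤ B)
    (hK : criticalRate θ B < K) (p : M) {v : EuclideanSpace ℝ (Fin n)} (hv : v ≠ 0) :
    0 < flowPinch ε K X ν t p v := by
  have hle : ∀ τ ∈ positiveTimes T, τ ≤ t → ∀ p (v : EuclideanSpace ℝ (Fin n)),
      0 ≤ flowPinch ε K X ν τ p v := by
    intro τ hτ hτt p v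
    rcases eq_or_ne v 0 with rfl | hv
    · have h := flowPinch_smul ε K X ν τ p 0 0
      simpa using h.ge
    rcases hτt.lt_or_eq with h | rfl
    · exact (hlt τ hτ h p v hv).le
    have hcont : ContinuousWithinAt (fun σ => flowPinch ε K X ν σ p v) (positiveTimes T) τ := by
      have h1 := hX.continuousOn_flowPinch (K := K)
      exact ContinuousOn.comp (t := (timeInterval T ×ˢ univ) ×ˢ univ)
        (g := fun q : (ℝ × ℝ) × TangentBundle (𝓡∂ n) M =>
          flowPinch q.1.2 K X ν q.1.1 q.2.proj q.2.snd)
        (f := fun σ : ℝ => ((σ, ε), (⟨p, v⟩ : TangentBundle (𝓡∂ n) M))) h1 (by fun_prop)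
        (fun σ hσ => ⟨⟨hσ.1, mem_univ _⟩, mem_univ _⟩) τ hτ
    have hcont' : Tendsto (fun σ => flowPinch ε K X ν σ p v) (𝓝[<] τ)
        (𝓝 (flowPinch ε K X ν τ p v)) :=
      ((hcont.continuousAt ((isOpen_positiveTimes T).mem_nhds hτ)).tendsto).mono_left
        nhdsWithin_le_nhds
    refine ge_of_tendsto hcont' ?_
    filter_upwards [self_mem_nhdsWithin,
      nhdsWithin_le_nhds ((isOpen_positiveTimes T).mem_nhds hτ)] with σ hσ hσ'
    exact (hlt σ hσ' hσ p v hv).le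
  refine lt_of_le_of_ne (hle t ht le_rfl p v) fun hzero => ?_
  have hy : 0 ≤ extChartAt (𝓡∂ n) p p 0 := by
    have h := extChartAt_target_subset_range (I := 𝓡∂ n) p (mem_extChartAt_target p)
    rw [range_modelWithCornersEuclideanHalfSpace] at h
    exact h
  rcases hy.lt_or_eq with h | h
  · exact hK.not_ge (hX.rate_le_of_interior_null hα hθ ht h hε hle hv hzero.symm (hB p).1
      (hB p).2.1 (hB p).2.2)
  · exact hX.flowPinch_ne_zero_of_boundary hα hθ ht h.symm hε (hle t ht le_rfl) hv hzero.symm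

/-- Strict convexity is preserved by the flow. -/
theorem strictlyConvex (hα : 0 < α) (hθ : θ ∈ Ioo 0 (Real.pi / 2))
    (hconv : StrictlyConvex (X 0) (ν 0)) {t : ℝ} (ht : t ∈ timeInterval T) :
    StrictlyConvex (X t) (ν t) := by
  have hsub : ∀ s, 0 ≤ s → s ≤ t → s ∈ timeInterval T := fun s hs hst =>
    ⟨hs, (EReal.coe_le_coe_iff.2 hst).trans_lt ht.2⟩
  obtain ⟨τ, hτ, ε, hε, hinit⟩ := hX.exists_initial_pinching (hsub 0 le_rfl ht.1) hconv
  obtain ⟨B, hB⟩ := hX.exists_bound hθ (a := τ) (b := t) fun s hs =>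
    ⟨hsub s (hτ.le.trans hs.1) hs.2, hτ.trans_le hs.1⟩
  set K : ℝ := max (criticalRate θ B + 1) 0 with hKdef
  have hK : criticalRate θ B < K := (lt_add_one _).trans_le (le_max_left _ _)
  have hK0 : 0 ≤ K := le_max_right _ _
  -- the set of times at which the second fundamental form fails to dominate the barrier
  set S : Set ℝ := {s | s ∈ Icc 0 t ∧ ¬ ∀ (p : M) (v : EuclideanSpace ℝ (Fin n)), v ≠ 0 →
    0 < flowPinch ε K X ν s p v} with hS
  have hSempty : S = ∅ := by
    by_contra hne
    have hclosed : IsClosed S := by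
      refine isClosed_of_closure_subset fun s hs => ?_
      have hsI : s ∈ Icc 0 t :=
        isClosed_Icc.closure_subset_iff.2 (fun r (hr : r ∈ S) => hr.1) hs
      refine ⟨hsI, fun hpos => ?_⟩
      have hev := hX.eventually_flowPinch_pos (hsub s hsI.1 hsI.2) hpos
      have htend : Tendsto (fun r : ℝ => (r, ε)) (𝓝[Icc 0 t] s)
          (𝓝[timeInterval T ×ˢ univ] (s, ε)) := by
        refine tendsto_nhdsWithin_iff.2 ⟨?_, ?_⟩
        · exact (Continuous.tendsto (by fun_prop) s).mono_left nhdsWithin_le_nhds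
        · filter_upwards [self_mem_nhdsWithin] with r hr
          exact ⟨hsub r hr.1 hr.2, mem_univ _⟩
      have hev' := htend.eventually hev
      have hfreq : ∃ᶠ r in 𝓝 s, r ∈ S := mem_closure_iff_frequently.1 hs
      obtain ⟨r, hr, hr'⟩ := (hfreq.and_eventually (eventually_nhdsWithin_iff.1 hev')).exists
      exact hr.2 (hr' hr.1)
    obtain ⟨t₁, ht₁, hmin⟩ := (isCompact_Icc.of_isClosed_subset hclosed
      fun r (hr : r ∈ S) => hr.1).exists_isLeast (nonempty_iff_ne_empty.2 hne)
    have hτt₁ : τ < t₁ := by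
      by_contra! h
      exact ht₁.2 fun p v hv => (hinit t₁ (hsub t₁ ht₁.1.1 ht₁.1.2) h p v hv).trans_le
        (hX.flowPinch_zero_rate_le hε.le hK0 (hsub t₁ ht₁.1.1 ht₁.1.2) p v)
    refine ht₁.2 fun p v hv => hX.flowPinch_pos_of_forall_lt hα hθ hε
      ⟨hsub t₁ ht₁.1.1 ht₁.1.2, hτ.trans hτt₁⟩ (fun s hs hst₁ => ?_)
      (hB t₁ ⟨hτt₁.le, ht₁.1.2⟩) hK p hv
    by_contra hbad
    exact hst₁.not_ge (hmin ⟨⟨hs.2.le, hst₁.le.trans ht₁.1.2⟩, hbad⟩)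
  intro p v hv
  have hpos : 0 < flowPinch ε K X ν t p v := by
    by_contra hneg
    have : t ∈ S := ⟨⟨ht.1, le_rfl⟩, fun h => hneg (h p v hv)⟩
    rw [hSempty] at this
    exact this
  have h1 := secondForm_eq_flowPinch_add ε K X ν t p v
  have h2 := hX.flowBarrier_nonneg (K := K) hε.le ht p
  exact lt_of_lt_of_eq (by positivity) h1.symm

end IsSolution

end Preservation

end CapillaryFlow

theorem mainTheorem4 {n : ℕ} [NeZero n] {M : Type*} [TopologicalSpace M] [T2Space M]
    [CompactSpace M] [ChartedSpace (EuclideanHalfSpace n) M] [IsManifold (𝓡∂ n) ∞ M]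
    [MeasurableSpace M] [BorelSpace M]
    (c : CapillaryFlow.Constraint) (α θ : ℝ) (hα : 0 < α) (hθ : θ ∈ Ioo 0 (Real.pi / 2))
    (T : EReal) (X₀ : M → CapillaryFlow.Ambient n) (X ν : ℝ → M → CapillaryFlow.Ambient n)
    (hX : CapillaryFlow.IsSolution c α θ T X ν) (hX₀ : X 0 = X₀)
    (hconv : CapillaryFlow.StrictlyConvex X₀ (ν 0)) :
    ∀ t ∈ CapillaryFlow.timeInterval T, CapillaryFlow.StrictlyConvex (X t) (ν t) := by
  subst hX₀
  exact fun t ht => hX.strictlyConvex hα hθ hconv ht
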